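/- **Setting.** All chains $L$ (linearly ordered sets) below are nontrivial, dense and without endpoints; $\bar L$ is the Dedekind completion of $L$ without endpoints, with its order topology. For a chain $L$ the *equal direction relation* $\mathrm{Ed}(x_1,x_2;y_1,y_2)$ says that $x_1<x_2$ and $y_1<y_2$, or $x_2<x_1$ and $y_2<y_1$; $\mathrm{ED}(L)=(L,\mathrm{Ed})$. A *linear permutation group* is a pair $(L,G)$ with $G\le\mathrm{Aut}(L,<)$; a *monotonic permutation group* is a pair $(\mathrm{ED}(L),G)$ with $G\le \mathrm{Aut}(\mathrm{ED}(L))$, so the elements of $G$ preserve or reverse the order. $N$ stands for $L$ or $\mathrm{ED}(L)$. $G$ acts on $\bar L$; "orbit" means orbit of $G$ in $\bar L$. Bounded intervals are the sets $(a,b)$ with $a<b$, rays are the sets $(-\infty,a)$ and $(a,\infty)$. For $g\in G$ put $\mathrm{supp}(g)=\{x\in\bar L: g(x)\ne x\}$ and $\mathrm{var}(g)=\mathrm{int}(\mathrm{cl}(\mathrm{supp}(g)))$, and $\mathrm{Var}(N,G)=\{\mathrm{var}(g):g\in G\}$. $\mathrm{Ep}(N,G)$ is the set of the endpoints in $\bar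 L$ (suprema and infima, when they exist in $\bar L$) of the sets $\mathrm{var}(g)$. $\mathrm{Opp}(G)$ consists of the order preserving elements of $G$; $\mathrm{Lft}(G)$, $\mathrm{Rt}(G)$, $\mathrm{Bdd}(G)$ consist of the elements whose support is bounded above, bounded below, bounded; $\mathrm{Bdd}'(G)$ is the derived group of $\mathrm{Bdd}(G)$. The pointwise order on $G$ is: $f\le g$ iff $f(a)\le g(a)$ for all $a\in L$; it is *nontrivial* if $f\le g$ for some $f\neq g$; $o\text{-}\mathrm{Aut}(G)$ is the group of automorphisms $\alpha$ of the group $G$ with $\alpha(f)\le\alpha(g)\iff f\le g$. An element $g\ne1$ is *signed* if $g(a)\ge a$ for all $a$ or $g(a)\le a$ for all $a$, and two signed elements have the *same sign* if the same of these alternatives holds for both. For $S\subseteq\bar L$ invariant under $H\le G$, $\mathrm{ACT}(S,H)$ is the two-sorted structure consisting of $S$ with $\mathrm{Ed}$, the group $H$, and the action. Second order logic has full semantics. A class of structures $M'_X$ $(X\in K)$, each containing a structure $M_X$, is *first (second) order strongly interpretable* in the $M_X$ if there are first (second) order formulas, independent of $X$, that represent the elements of $M'_X$ by tuples of elements (tuples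 of elements and relations) of $M_X$, and define the representing tuples, equality and the relations of $M'_X$ between represented elements, and the relation "the tuple represents the element $x$ of $M_X$". "Expressible" means expressible for all members of the class by one formula in the language of groups. $\equiv$ is elementary equivalence. For $H\le G$ and a group $A$ of permutations of $\bar L$, "$\mathrm{Aut}(H)=\mathrm{Norm}_A(H)$" means that $\tau\mapsto(h\mapsto\tau h\tau^{-1})$ is an isomorphism from the normalizer of $H$ in $A$ onto $\mathrm{Aut}(H)$. Inclusions between automorphism groups are inclusions between the normalizers so identified. $(N,G)$ is *locally moving* if for every interval $I$ of $L$ (bounded interval, ray, or $L$) some $g\ne1$ in $G$ fixes every point outside $I$. It is *span-transitive* if for all distinct $a,b\in\bar L$ and all bounded intervals $I\subseteq J$ of $\bar L$ there is $g\in G$ with $g(a)\in I$, $g(b)\notin J$ or with $g(b)\in I$, $g(a)\notin J$. $K^{\rm SPAN}$ is the class of span-transitive locally moving linear and monotonic permutation groups; $K^{\rm SPAN\text{-}INT}$ is the class of the $(N,G)\in K^{\rm SPAN}$ such that $\mathrm{Var}(N,G)$ contains a bounded interval or a ray of $\bar L$. **Theorem.** (1) First Order Reconstruction holds for $K^{\rm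 SPAN\text{-}INT}$. (2) Second Order Reconstruction holds for $K^{\rm SPAN}$. Here *Second Order Reconstruction* for $K$ means (S1)–(S8), for all members of $K$, separately for the class of the linear and for the class of the monotonic members. (S1) For $(N_1,G_1),(N_2,G_2)$ in the class and every group isomorphism $\alpha:G_1\to G_2$ there is a unique monotonic (order preserving or reversing) bijection $\tau:\bar L_1\to\bar L_2$ with $\alpha(g)=\tau g\tau^{-1}$ for all $g$; equivalently, a unique isomorphism $\tau:\mathrm{ED}(\bar L_1)\to\mathrm{ED}(\bar L_2)$ such that $\tau\cup\alpha$ is an isomorphism $\mathrm{ACT}(\bar L_1,G_1)\to\mathrm{ACT}(\bar L_2,G_2)$. For this $\tau$, $\tau|_{\mathrm{Ep}}\cup\alpha$ is an isomorphism $\mathrm{ACT}(\mathrm{Ep}(N_1,G_1),G_1)\to\mathrm{ACT}(\mathrm{Ep}(N_2,G_2),G_2)$, and $M\mapsto\tau(M)$ is a bijection between the sets of orbits. Either $\tau$ preserves order, and then $\tau|_M$ preserves order for every orbit $M$, $\tau|_M\cup\alpha:(M,G_1)\cong(\tau(M),G_2)$, and $\alpha$ preserves the pointwise order; or $\tau$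 reverses order, and then $\tau|_M$ reverses order for every orbit $M$, $\tau|_M\cup\alpha:(M,G_1)\cong(\tau(M)^*,G_2)$, and $\alpha$ reverses the pointwise order. If the pointwise order on $G_1$ is nontrivial and $\alpha$ preserves the pointwise order, then $\tau$ preserves order. (S2) Every automorphism of $G$ is conjugation by a unique automorphism of $\mathrm{ED}(\bar L)$, and $\mathrm{Aut}(G)=\mathrm{Norm}_{\mathrm{Aut}(\mathrm{ED}(\bar L))}(G)=\mathrm{Norm}_{\mathrm{Homeo}(\bar L)}(G)$. The index of $o\text{-}\mathrm{Aut}(G)$ in $\mathrm{Aut}(G)$ is at most $2$; if the pointwise order is nontrivial, every member of $o\text{-}\mathrm{Aut}(G)$ is conjugation by a unique automorphism of $(\bar L,<)$. (S3) $\mathrm{Bdd}(G)$ and $\mathrm{Bdd}'(G)$ are characteristic in $G$; every automorphism of $G$ preserves both or interchanges $\mathrm{Lft}(G)$ and $\mathrm{Rt}(G)$. (S4) $\mathrm{Aut}(G)\le\mathrm{Aut}(\mathrm{Bdd}(G))\le\mathrm{Aut}(\mathrm{Bdd}'(G))\le\mathrm{Aut}(\mathrm{ED}(\bar L))$, where each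 of the three automorphism groups is the normalizer of the respective group in $\mathrm{Aut}(\mathrm{ED}(\bar L))$, and automorphisms of $G$ are determined by their restrictions to $\mathrm{Bdd}'(G)$. For $H=\mathrm{Lft}(G)$ and $H=\mathrm{Rt}(G)$: automorphisms of $G$ are determined by their restrictions to $H$; if the pointwise order is nontrivial, $o\text{-}\mathrm{Aut}(G)$ preserves $H$; and if $H\ne\mathrm{Bdd}(G)$, then $\mathrm{Aut}(H)=\mathrm{Norm}_{\mathrm{Aut}(\bar L,<)}(H)$. (S5) If $G$ is transitive on $L$, then $\mathrm{Aut}(G)=\mathrm{Norm}_{\mathrm{Aut}(\mathrm{ED}(L))}(G)$ if and only if there is no orbit $M\ne L$ with $(L,G)\cong(M,G)$ or $(L,G)\cong(M^*,G)$ (isomorphisms of permutation groups: an order isomorphism together with a group automorphism of $G$). (S6) The structures $\mathrm{ACT}(\bar L,G)$ are second order strongly interpretable in the groups $G$. For every first order formula $\varphi$ in the language of $\mathrm{ACT}(\bar L,G)$ with only group variables free, "$\mathrm{ACT}(\bar L,G)\models\varphi[\vec g]$" is expressible by a second order formula; in particular so are "$g$ is signed", "$g_1,g_2$ have the same sign",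 "$g\in\mathrm{Bdd}(G)$", "$g\in\mathrm{Lft}(G)\cup\mathrm{Rt}(G)$", "$g_1,g_2$ are both in $\mathrm{Lft}(G)$ or both in $\mathrm{Rt}(G)$", and, for each natural number $n$, "$\bar L$ has exactly $n$ orbits". For members with $G$ transitive on $L$, "$L$ is Dedekind complete" is expressible by a second order sentence. (S7) In the monotonic case, moreover: $\mathrm{Opp}(G)$ is characteristic, $\mathrm{Aut}(\mathrm{Opp}(G))=\mathrm{Norm}_{\mathrm{Aut}(\mathrm{ED}(\bar L))}(\mathrm{Opp}(G))$, $\mathrm{Aut}(G)\le\mathrm{Aut}(\mathrm{Opp}(G))\le\mathrm{Aut}(\mathrm{Bdd}(G))$, and "$g\in\mathrm{Opp}(G)$" is expressible by a second order formula. (S8) There are second order sentences in the language of groups distinguishing, within $K$, the linear permutation groups from the monotonic ones that contain an order reversing element. *First Order Reconstruction* for $K$ means (S1)–(S8) and the following, again for the linear and for the monotonic members. (F1) If $G_1\equiv G_2$, then $\mathrm{ACT}(\mathrm{Ep}(N_1,G_1),H_1)\equiv\mathrm{ACT}(\mathrm{Ep}(N_2,G_2),H_2)$ for $H_i=G_i$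 and for $H_i=\mathrm{Bdd}(G_i)$; and this holds either for both $(H_1,H_2)=(\mathrm{Lft}(G_1),\mathrm{Lft}(G_2))$ and $(\mathrm{Rt}(G_1),\mathrm{Rt}(G_2))$, or for both $(\mathrm{Lft}(G_1),\mathrm{Rt}(G_2))$ and $(\mathrm{Rt}(G_1),\mathrm{Lft}(G_2))$; in the monotonic case also for $H_i=\mathrm{Opp}(G_i)$. (F2) If $G\equiv H$ for $H=\mathrm{Bdd}(G)$, $\mathrm{Lft}(G)$ or $\mathrm{Rt}(G)$ (in the monotonic case also for $H=\mathrm{Opp}(G)$), then $H=G$. (F3) The structures $\mathrm{ACT}(\mathrm{Ep}(N,G),G)$ are first order strongly interpretable in the groups $G$; the expressibility results of (S6) and (S7) (except the one about Dedekind completeness) hold with first order formulas in the language of groups when $\bar L$ is replaced by $\mathrm{Ep}(N,G)$. (F4) The sentences in (S8) can be taken to be first order. -/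

import Mathlib

open FirstOrder

universe u

noncomputable section

namespace NearlyOrdered

/-! ### Chains, equal direction structures and their automorphism groups -/

section Chains

variable {α : Type*} [LinearOrder α]

/-- The equal direction relation of a chain: the pairs `(x₁, x₂)` and `(y₁, y₂)` point in the
same direction. -/
def Ed (x₁ x₂ y₁ y₂ : α) : Prop := (x₁ < x₂ ∧ y₁ < y₂) ∨ (x₂ < x₁ ∧ y₂ < y₁)

variable (α) in
/-- `Aut (ED α)`: the permutations preserving the equal direction relation. -/
def edAut : Subgroup (Equiv.Perm α) where
  carrier := {g | ∀ x₁ x₂ y₁ y₂, Ed (g x₁) (g x₂) (g y₁) (g y₂) ↔ Ed x₁ x₂ y₁ y₂}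
  one_mem' := by intro x₁ x₂ y₁ y₂; rfl
  mul_mem' := by
    intro a b ha hb x₁ x₂ y₁ y₂
    simp only [Equiv.Perm.coe_mul, Function.comp_apply]
    rw [ha, hb]
  inv_mem' := by
    intro a ha x₁ x₂ y₁ y₂
    have := ha (a⁻¹ x₁) (a⁻¹ x₂) (a⁻¹ y₁) (a⁻¹ y₂)
    simpa using this.symm

variable (α) in
/-- `Aut (α, <)`: the order preserving permutations. -/
def ordAut : Subgroup (Equiv.Perm α) where
  carrier := {g | StrictMono g}
  one_mem' := strictMono_id
  mul_mem' := by
    intro a b ha hb x y hxy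
    exact ha (hb hxy)
  inv_mem' := by
    intro a ha x y hxy
    have h : a (a⁻¹ x) < a (a⁻¹ y) := by simpa using hxy
    exact (StrictMono.lt_iff_lt ha).1 h

/-- Automorphisms of the equal direction structure preserve or reverse the order. -/
theorem strictMono_or_strictAnti (g : edAut α) :
    StrictMono (g : Equiv.Perm α) ∨ StrictAnti (g : Equiv.Perm α) := by
  by_cases h : ∃ a b : α, a < b
  · obtain ⟨a, b, hab⟩ := h
    have key : ∀ x y, x < y → Ed ((g : Equiv.Perm α) x) ((g : Equiv.Perm α) y)
        ((g : Equiv.Perm α) a) ((g : Equiv.Perm α) b) :=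
      fun x y hxy => (g.2 x y a b).2 (Or.inl ⟨hxy, hab⟩)
    rcases key a b hab with h1 | h1
    · left
      intro x y hxy
      rcases key x y hxy with h2 | h2
      · exact h2.1
      · exact absurd h2.2 h1.1.asymm
    · right
      intro x y hxy
      rcases key x y hxy with h2 | h2
      · exact absurd h2.2 h1.1.asymm
      · exact h2.1
  · left
    intro x y hxy
    exact absurd ⟨x, y, hxy⟩ h

/-- Bounded intervals `(a, b)` of a chain. -/
def IsBddInterval (I : Set α) : Prop := ∃ a b, a < b ∧ I = Set.Ioo a b

/-- Open rays `(-∞, a)` and `(a, ∞)` of a chain. -/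
def IsRay (I : Set α) : Prop := ∃ a, I = Set.Iio a ∨ I = Set.Ioi a

/-- Intervals of a chain (all of them open). -/
def IsInterval (I : Set α) : Prop := IsBddInterval I ∨ IsRay I ∨ I = Set.univ

/-- A map between chains that preserves or reverses the order. -/
def IsMonotonic {β : Type*} [LinearOrder β] (f : α → β) : Prop := StrictMono f ∨ StrictAnti f

/-- An isomorphism of equal direction structures. -/
def IsEdIso {β : Type*} [LinearOrder β] (f : α ≃ β) : Prop :=
  ∀ x₁ x₂ y₁ y₂, Ed (f x₁) (f x₂) (f y₁) (f y₂) ↔ Ed x₁ x₂ y₁ y₂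

variable (α) in
/-- Every nonempty set that is bounded above has a supremum. -/
def DedekindComplete : Prop := ∀ S : Set α, S.Nonempty → BddAbove S → ∃ x, IsLUB S x

end Chains

/-! ### The Dedekind completion without endpoints -/

section Completion

variable (L : Type u) [LinearOrder L]

/-- The Dedekind completion without endpoints: the Dedekind cuts different from the two
improper ones. -/
def Completion : Type u := {c : DedekindCut L // c ≠ ⊥ ∧ c ≠ ⊤}

instance : LinearOrder (Completion L) :=
  inferInstanceAs (LinearOrder {c : DedekindCut L // c ≠ ⊥ ∧ c ≠ ⊤})

instance : TopologicalSpace (Completion L) := Preorder.topology _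

instance : OrderTopology (Completion L) := ⟨rfl⟩

variable {L}

/-- The canonical embedding of a chain without endpoints in its completion. -/
def toCompletion [NoMinOrder L] [NoMaxOrder L] (a : L) : Completion L :=
  ⟨DedekindCut.principal a, by
    constructor
    · intro h
      obtain ⟨b, hb⟩ := exists_lt a
      have h1 : DedekindCut.principal a ≤ DedekindCut.principal b := h ▸ bot_le
      exact absurd (DedekindCut.principal_le_principal.1 h1) (not_le.2 hb)
    · intro h
      obtain ⟨b, hb⟩ := exists_gt a
      have h1 : DedekindCut.principal b ≤ DedekindCut.principal a := h ▸ le_top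
      exact absurd (DedekindCut.principal_le_principal.1 h1) (not_le.2 hb)⟩

/-- The action of a monotonic permutation on Dedekind cuts: an order preserving `g` sends a cut
to the supremum of the image of its left set, an order reversing `g` to the supremum of the image
of its right set. -/
def cutMap (g : edAut L) (c : DedekindCut L) : DedekindCut L :=
  open Classical in
  if StrictMono (g : Equiv.Perm L) then ⨆ a ∈ c.left, DedekindCut.principal ((g : Equiv.Perm L) a)
  else ⨆ a ∈ c.right, DedekindCut.principal ((g : Equiv.Perm L) a)

theorem mem_right_iff (c : DedekindCut L) (b : L) : b ∈ c.right ↔ ∀ a ∈ c.left, a ≤ b := by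
  rw [← DedekindCut.upperBounds_left]; rfl

theorem mem_left_iff (c : DedekindCut L) (b : L) : b ∈ c.left ↔ ∀ a ∈ c.right, b ≤ a := by
  rw [← DedekindCut.lowerBounds_right]; rfl

theorem mem_right_iSup (s : Set L) (f : L → L) (b : L) :
    b ∈ (⨆ a ∈ s, DedekindCut.principal (f a)).right ↔ ∀ a ∈ s, f a ≤ b := by
  rw [← DedekindCut.le_principal_iff]
  simp

theorem right_cutMap_mono (g : edAut L) (hg : StrictMono (g : Equiv.Perm L)) (c : DedekindCut L)
    (b : L) : (g : Equiv.Perm L) b ∈ (cutMap g c).right ↔ b ∈ c.right := by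
  rw [cutMap, if_pos hg, mem_right_iSup, mem_right_iff]
  simp only [hg.le_iff_le]

theorem right_cutMap_anti (g : edAut L) (hg : ¬ StrictMono (g : Equiv.Perm L)) (c : DedekindCut L)
    (b : L) : (g : Equiv.Perm L) b ∈ (cutMap g c).right ↔ b ∈ c.left := by
  have ha := (strictMono_or_strictAnti g).resolve_left hg
  rw [cutMap, if_neg hg, mem_right_iSup, mem_left_iff]
  simp only [ha.le_iff_ge]

theorem left_cutMap_mono (g : edAut L) (hg : StrictMono (g : Equiv.Perm L)) (c : DedekindCut L)
    (b : L) : (g : Equiv.Perm L) b ∈ (cutMap g c).left ↔ b ∈ c.left := by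
  rw [mem_left_iff, mem_left_iff, (g : Equiv.Perm L).surjective.forall]
  simp only [right_cutMap_mono g hg, hg.le_iff_le]

theorem left_cutMap_anti (g : edAut L) (hg : ¬ StrictMono (g : Equiv.Perm L)) (c : DedekindCut L)
    (b : L) : (g : Equiv.Perm L) b ∈ (cutMap g c).left ↔ b ∈ c.right := by
  have ha := (strictMono_or_strictAnti g).resolve_left hg
  rw [mem_left_iff, mem_right_iff, (g : Equiv.Perm L).surjective.forall]
  simp only [right_cutMap_anti g hg, ha.le_iff_ge]

theorem cutMap_one (c : DedekindCut L) : cutMap 1 c = c := by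
  refine DedekindCut.ext' (Set.ext fun b => ?_)
  exact right_cutMap_mono 1 strictMono_id c b

theorem cutMap_mul (g h : edAut L) (c : DedekindCut L) :
    cutMap (g * h) c = cutMap g (cutMap h c) := by
  refine DedekindCut.ext' (Set.ext fun b => ?_)
  obtain ⟨b, rfl⟩ := ((g * h : edAut L) : Equiv.Perm L).surjective b
  have hb : ((g * h : edAut L) : Equiv.Perm L) b =
      (g : Equiv.Perm L) ((h : Equiv.Perm L) b) := rfl
  by_cases hne : ∃ x y : L, x < y
  · obtain ⟨x, y, hxy⟩ := hne
    by_cases hg : StrictMono (g : Equiv.Perm L) <;> by_cases hh : StrictMono (h : Equiv.Perm L)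
    · have hgh : StrictMono ((g * h : edAut L) : Equiv.Perm L) := hg.comp hh
      rw [right_cutMap_mono _ hgh, hb, right_cutMap_mono _ hg, right_cutMap_mono _ hh]
    · have hh' := (strictMono_or_strictAnti h).resolve_left hh
      have hgh : ¬ StrictMono ((g * h : edAut L) : Equiv.Perm L) := fun hc =>
        (hc hxy).asymm (hg (hh' hxy))
      rw [right_cutMap_anti _ hgh, hb, right_cutMap_mono _ hg, right_cutMap_anti _ hh]
    · have hg' := (strictMono_or_strictAnti g).resolve_left hg
      have hgh : ¬ StrictMono ((g * h : edAut L) : Equiv.Perm L) := fun hc =>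
        (hc hxy).asymm (hg' (hh hxy))
      rw [right_cutMap_anti _ hgh, hb, right_cutMap_anti _ hg, left_cutMap_mono _ hh]
    · have hg' := (strictMono_or_strictAnti g).resolve_left hg
      have hh' := (strictMono_or_strictAnti h).resolve_left hh
      have hgh : StrictMono ((g * h : edAut L) : Equiv.Perm L) := hg'.comp hh'
      rw [right_cutMap_mono _ hgh, hb, right_cutMap_anti _ hg, left_cutMap_anti _ hh]
  · have triv : ∀ k : edAut L, StrictMono (k : Equiv.Perm L) :=
      fun k x y hxy => absurd ⟨x, y, hxy⟩ hne
    rw [right_cutMap_mono _ (triv _), hb, right_cutMap_mono _ (triv _),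
      right_cutMap_mono _ (triv _)]

theorem cutMap_mono (g : edAut L) (hg : StrictMono (g : Equiv.Perm L)) {c d : DedekindCut L}
    (h : c ≤ d) : cutMap g c ≤ cutMap g d := by
  rw [← Concept.extent_subset_extent_iff] at h ⊢
  intro b hb
  obtain ⟨b, rfl⟩ := (g : Equiv.Perm L).surjective b
  exact (left_cutMap_mono g hg d b).2 (h ((left_cutMap_mono g hg c b).1 hb))

theorem cutMap_anti (g : edAut L) (hg : ¬ StrictMono (g : Equiv.Perm L)) {c d : DedekindCut L}
    (h : c ≤ d) : cutMap g d ≤ cutMap g c := by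
  rw [← Concept.intent_subset_intent_iff]
  rw [← Concept.extent_subset_extent_iff] at h
  intro b hb
  obtain ⟨b, rfl⟩ := (g : Equiv.Perm L).surjective b
  exact (right_cutMap_anti g hg d b).2 (h ((right_cutMap_anti g hg c b).1 hb))

theorem cutMap_inv_cancel (g : edAut L) (c : DedekindCut L) : cutMap g (cutMap g⁻¹ c) = c := by
  rw [← cutMap_mul, mul_inv_cancel, cutMap_one]

theorem inv_cutMap_cancel (g : edAut L) (c : DedekindCut L) : cutMap g⁻¹ (cutMap g c) = c := by
  rw [← cutMap_mul, inv_mul_cancel, cutMap_one]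

theorem cutMap_bot_top (g : edAut L) :
    (cutMap g ⊥ = ⊥ ∧ cutMap g ⊤ = ⊤) ∨ (cutMap g ⊥ = ⊤ ∧ cutMap g ⊤ = (⊥ : DedekindCut L)) := by
  by_cases hg : StrictMono (g : Equiv.Perm L)
  · left
    constructor
    · refine le_bot_iff.1 ?_
      calc cutMap g ⊥ ≤ cutMap g (cutMap g⁻¹ ⊥) := cutMap_mono g hg bot_le
        _ = ⊥ := cutMap_inv_cancel g ⊥
    · refine top_le_iff.1 ?_
      calc ⊤ = cutMap g (cutMap g⁻¹ ⊤) := (cutMap_inv_cancel g ⊤).symm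
        _ ≤ cutMap g ⊤ := cutMap_mono g hg le_top
  · right
    constructor
    · refine top_le_iff.1 ?_
      calc ⊤ = cutMap g (cutMap g⁻¹ ⊤) := (cutMap_inv_cancel g ⊤).symm
        _ ≤ cutMap g ⊥ := cutMap_anti g hg bot_le
    · refine le_bot_iff.1 ?_
      calc cutMap g ⊤ ≤ cutMap g (cutMap g⁻¹ ⊥) := cutMap_anti g hg le_top
        _ = ⊥ := cutMap_inv_cancel g ⊥

theorem cutMap_proper (g : edAut L) {c : DedekindCut L} (hc : c ≠ ⊥ ∧ c ≠ ⊤) :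
    cutMap g c ≠ ⊥ ∧ cutMap g c ≠ ⊤ := by
  have h1 : ∀ d, cutMap g c = cutMap g d → c = d := fun d h => by
    rw [← inv_cutMap_cancel g c, h, inv_cutMap_cancel]
  rcases cutMap_bot_top g with ⟨hb, ht⟩ | ⟨hb, ht⟩
  · exact ⟨fun h => hc.1 (h1 _ (h.trans hb.symm)), fun h => hc.2 (h1 _ (h.trans ht.symm))⟩
  · exact ⟨fun h => hc.2 (h1 _ (h.trans ht.symm)), fun h => hc.1 (h1 _ (h.trans hb.symm))⟩

/-- The extension of monotonic permutations of a chain to its Dedekind completion. -/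
instance : MulAction (edAut L) (Completion L) where
  smul g c := ⟨cutMap g c.1, cutMap_proper g c.2⟩
  one_smul c := Subtype.ext (cutMap_one c.1)
  mul_smul g h c := Subtype.ext (cutMap_mul g h c.1)

/-- The action on the completion extends the one on the chain. -/
theorem smul_toCompletion [NoMinOrder L] [NoMaxOrder L] (g : edAut L) (a : L) :
    g • toCompletion a = toCompletion ((g : Equiv.Perm L) a) := by
  refine Subtype.ext (DedekindCut.ext' (Set.ext fun b => ?_))
  obtain ⟨b, rfl⟩ := (g : Equiv.Perm L).surjective b
  change (g : Equiv.Perm L) b ∈ (cutMap g (DedekindCut.principal a)).right ↔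
    (g : Equiv.Perm L) a ≤ (g : Equiv.Perm L) b
  by_cases hg : StrictMono (g : Equiv.Perm L)
  · rw [right_cutMap_mono g hg, hg.le_iff_le]; rfl
  · rw [right_cutMap_anti g hg, ((strictMono_or_strictAnti g).resolve_left hg).le_iff_ge]; rfl

/-- The homeomorphisms of the completion, as a group of permutations. -/
def homeoGroup (L : Type u) [LinearOrder L] : Subgroup (Equiv.Perm (Completion L)) where
  carrier := {τ | Continuous τ ∧ Continuous τ.symm}
  one_mem' := ⟨continuous_id, continuous_id⟩
  mul_mem' := fun ha hb => ⟨ha.1.comp hb.1, hb.2.comp ha.2⟩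
  inv_mem' := fun ha => ⟨ha.2, ha.1⟩

end Completion

/-! ### Linear and monotonic permutation groups -/

/-- A dense chain `L` without endpoints with a group `G` of automorphisms of `ED(L)`, that is,
a monotonic permutation group `(ED(L), G)`.  When all elements of `G` preserve the order, the
same data also represent the linear permutation group `(L, G)`. -/
structure PermGroup : Type (u + 1) where
  /-- the chain -/
  L : Type u
  [linearOrder : LinearOrder L]
  [denselyOrdered : DenselyOrdered L]
  [noMinOrder : NoMinOrder L]
  [noMaxOrder : NoMaxOrder L]
  [nontrivial : Nontrivial L]
  /-- the group -/
  G : Subgroup (edAut L)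

attribute [instance] PermGroup.linearOrder PermGroup.denselyOrdered PermGroup.noMinOrder
  PermGroup.noMaxOrder PermGroup.nontrivial

namespace PermGroup

variable (X Y : PermGroup.{u})

/-- The Dedekind completion of the chain. -/
abbrev bar : Type u := Completion X.L

/-- The support of an element, a subset of the completion. -/
def supp (g : X.G) : Set X.bar := {x | g • x ≠ x}

/-- The interior of the closure of the support. -/
def var (g : X.G) : Set X.bar := interior (closure (X.supp g))

/-- The order preserving elements. -/
def opp : Subgroup X.G := ((ordAut X.L).comap (edAut X.L).subtype).comap X.G.subtype

theorem supp_mul_subset (g h : X.G) : X.supp (g * h) ⊆ X.supp g ∪ X.supp h := by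
  intro x hx
  by_contra hc
  simp only [supp, Set.mem_union, Set.mem_ofPred_eq, not_or, not_not] at hc hx
  exact hx (by rw [mul_smul, hc.2, hc.1])

theorem supp_inv (g : X.G) : X.supp g⁻¹ = X.supp g := by
  ext x
  simp only [supp, Set.mem_ofPred_eq, ne_eq, not_iff_not]
  rw [inv_smul_eq_iff, eq_comm]

theorem supp_one : X.supp 1 = ∅ := by
  ext x
  simp [supp]

theorem bar_nonempty : Nonempty X.bar := ⟨toCompletion (Classical.arbitrary X.L)⟩

/-- The elements whose support is bounded above. -/
def lft : Subgroup X.G where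
  carrier := {g | BddAbove (X.supp g)}
  one_mem' := by
    have := X.bar_nonempty
    rw [Set.mem_ofPred_eq, supp_one]; exact bddAbove_empty
  mul_mem' := fun {a b} ha hb => (ha.union hb).mono (X.supp_mul_subset a b)
  inv_mem' := fun {a} ha => by rw [Set.mem_ofPred_eq, supp_inv]; exact ha

/-- The elements whose support is bounded below. -/
def rt : Subgroup X.G where
  carrier := {g | BddBelow (X.supp g)}
  one_mem' := by
    have := X.bar_nonempty
    rw [Set.mem_ofPred_eq, supp_one]; exact bddBelow_empty
  mul_mem' := fun {a b} ha hb => (ha.union hb).mono (X.supp_mul_subset a b)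
  inv_mem' := fun {a} ha => by rw [Set.mem_ofPred_eq, supp_inv]; exact ha

/-- The elements with bounded support. -/
def bdd : Subgroup X.G := X.lft ⊓ X.rt

/-- The derived group of the group of elements with bounded support. -/
def bddDer : Subgroup X.G := ⁅X.bdd, X.bdd⁆

/-- All group elements preserve the order: the data represent a linear permutation group. -/
def IsLinear : Prop := X.opp = ⊤

/-- Every interval of the chain supports a nonidentity element of the group. -/
def LocallyMoving : Prop :=
  ∀ I : Set X.L, IsInterval I → ∃ g : X.G, g ≠ 1 ∧ ∀ a, a ∉ I → g • a = a

def SpanTransitive : Prop :=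
  ∀ a b : X.bar, a ≠ b → ∀ I J : Set X.bar, IsBddInterval I → IsBddInterval J → I ⊆ J →
    ∃ g : X.G, (g • a ∈ I ∧ g • b ∉ J) ∨ (g • b ∈ I ∧ g • a ∉ J)

/-- `Var(N, G)` contains a bounded interval or a ray of the completion. -/
def VarHasIntervalOrRay : Prop := ∃ g : X.G, IsBddInterval (X.var g) ∨ IsRay (X.var g)

/-- The set of endpoints in the completion of the convex hulls of the sets `var(g)`. -/
def ep : Set X.bar := {x | ∃ g : X.G, IsLUB (X.var g) x ∨ IsGLB (X.var g) x}

/-- The orbits of the group in the completion. -/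
def orbits : Set (Set X.bar) := Set.range fun x : X.bar => MulAction.orbit X.G x

/-- The pointwise order on the group. -/
def PtLE (f g : X.G) : Prop := ∀ a : X.L, f • a ≤ g • a

/-- The pointwise order is not merely equality. -/
def PtNontrivial : Prop := ∃ f g : X.G, f ≠ g ∧ X.PtLE f g

/-- `g` is a signed element: it is not the identity and it moves no point down, or none up. -/
def Signed (g : X.G) : Prop :=
  g ≠ 1 ∧ ((∀ a : X.L, a ≤ g • a) ∨ ∀ a : X.L, g • a ≤ a)

/-- `g` and `h` are signed elements of the same sign. -/
def SameSign (g h : X.G) : Prop :=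
  g ≠ 1 ∧ h ≠ 1 ∧ ((∀ a : X.L, a ≤ g • a ∧ a ≤ h • a) ∨ ∀ a : X.L, g • a ≤ a ∧ h • a ≤ a)

end PermGroup

/-! ### First order and second order languages -/

/-- The language of groups: one binary function symbol. -/
inductive GrpFun : ℕ → Type
  | mul : GrpFun 2

/-- The language of groups. -/
def grpLang : FirstOrder.Language.{0, 0} := ⟨GrpFun, fun _ => Empty⟩

instance grpStructure (M : Type*) [Mul M] : grpLang.Structure M where
  funMap := fun {_} f => match f with
    | GrpFun.mul => fun v => v 0 * v 1
  RelMap := fun {_} r => r.elim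

/-- The relation symbols of the language of monotonic permutation groups: being a point, being a
group element, the equal direction relation on points, the multiplication of group elements and
the application of group elements to points. -/
inductive ActRel : ℕ → Type
  | pt : ActRel 1
  | grp : ActRel 1
  | ed : ActRel 4
  | mul : ActRel 3
  | ap : ActRel 3

/-- The (relational) language of monotonic permutation groups. -/
def actLang : FirstOrder.Language.{0, 0} := ⟨fun _ => Empty, ActRel⟩

instance : actLang.IsRelational := fun _ => inferInstanceAs (IsEmpty Empty)

/-- The universe of the structure `ACT(S, H)` of the action of a subgroup `H` of `G` on a set `S`
of points of the completion, with the equal direction relation on `S`. -/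
def PermGroup.Act (X : PermGroup.{u}) (S : Set X.bar) (H : Subgroup X.G) : Type u := S ⊕ H

namespace PermGroup

/-- The points of `ACT(S, H)`. -/
def Act.point {X : PermGroup.{u}} {S : Set X.bar} {H : Subgroup X.G} (x : S) : X.Act S H := Sum.inl x

/-- The group elements of `ACT(S, H)`. -/
def Act.elt {X : PermGroup.{u}} {S : Set X.bar} {H : Subgroup X.G} (h : H) : X.Act S H := Sum.inr h

/-- `G` as a part of the universe of `ACT(S, G)`. -/
def Act.ofG {X : PermGroup.{u}} {S : Set X.bar} (g : X.G) : X.Act S ⊤ :=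
  Act.elt ⟨g, Subgroup.mem_top g⟩

instance (X : PermGroup.{u}) (S : Set X.bar) (H : Subgroup X.G) :
    actLang.Structure (X.Act S H) where
  funMap := fun {_} f => f.elim
  RelMap := fun {_} r => match r with
    | ActRel.pt => fun v => ∃ x : S, v 0 = Act.point x
    | ActRel.grp => fun v => ∃ h : H, v 0 = Act.elt h
    | ActRel.ed => fun v => ∃ x₁ x₂ y₁ y₂ : S, v 0 = Act.point x₁ ∧ v 1 = Act.point x₂ ∧
        v 2 = Act.point y₁ ∧ v 3 = Act.point y₂ ∧ Ed (x₁ : X.bar) x₂ y₁ y₂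
    | ActRel.mul => fun v => ∃ g h : H, v 0 = Act.elt g ∧ v 1 = Act.elt h ∧ v 2 = Act.elt (g * h)
    | ActRel.ap => fun v => ∃ (g : H) (x y : S), v 0 = Act.elt g ∧ v 1 = Act.point x ∧
        v 2 = Act.point y ∧ (g : X.G) • (x : X.bar) = y

end PermGroup

/-- Second order formulas over a language, with free first order variables in `α` and free
relation variables in `β`, the arity of the latter being given by `r`.  Quantification over
functions is expressible through quantification over relations. -/
inductive SOFormula (𝓛 : FirstOrder.Language.{0, 0}) : (α β : Type) → (β → ℕ) → Type 1
  | falsum {α β : Type} {r : β → ℕ} : SOFormula 𝓛 α β r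
  | eq {α β : Type} {r : β → ℕ} (t₁ t₂ : 𝓛.Term α) : SOFormula 𝓛 α β r
  | rel {α β : Type} {r : β → ℕ} {n : ℕ} (R : 𝓛.Relations n) (t : Fin n → 𝓛.Term α) :
      SOFormula 𝓛 α β r
  | var {α β : Type} {r : β → ℕ} (b : β) (t : Fin (r b) → 𝓛.Term α) : SOFormula 𝓛 α β r
  | imp {α β : Type} {r : β → ℕ} (φ ψ : SOFormula 𝓛 α β r) : SOFormula 𝓛 α β r
  | all {α β : Type} {r : β → ℕ} (φ : SOFormula 𝓛 (Option α) β r) : SOFormula 𝓛 α β r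
  | allRel {α β : Type} {r : β → ℕ} (n : ℕ)
      (φ : SOFormula 𝓛 α (Option β) (fun o => o.elim n r)) : SOFormula 𝓛 α β r

/-- Truth of second order formulas in a structure, with full (standard) semantics. -/
def SOFormula.Realize {𝓛 : FirstOrder.Language.{0, 0}} {M : Type u} [𝓛.Structure M] :
    {α β : Type} → {r : β → ℕ} → SOFormula 𝓛 α β r → (α → M) →
      ((b : β) → Set (Fin (r b) → M)) → Prop
  | _, _, _, .falsum, _, _ => False
  | _, _, _, .eq t₁ t₂, v, _ => t₁.realize v = t₂.realize v
  | _, _, _, .rel R t, v, _ => FirstOrder.Language.Structure.RelMap R fun i => (t i).realize v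
  | _, _, _, .var b t, v, V => (fun i => (t i).realize v) ∈ V b
  | _, _, _, .imp φ ψ, v, V => φ.Realize v V → ψ.Realize v V
  | _, _, _, .all φ, v, V => ∀ x : M, φ.Realize (fun o => o.elim x v) V
  | _, _, _, .allRel _ φ, v, V => ∀ A, φ.Realize v fun o => match o with
      | none => A
      | some b => V b

/-! ### Strong interpretations -/

section Interpretations

variable {ι : Type*} (𝓛 𝓛' : FirstOrder.Language.{0, 0}) [𝓛'.IsRelational] (M M' : ι → Type u)
  [∀ i, 𝓛.Structure (M i)] [∀ i, 𝓛'.Structure (M' i)] (e : ∀ i, M i → M' i)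

/-- The structures `M' i` are first order strongly interpretable in the structures `M i`, where
`M i` is regarded as a part of `M' i` by means of `e i`: there are formulas, independent of `i`,
defining the set of `n`-tuples that represent elements of `M' i`, the relation of representing
the same element, the relations of `M' i` between represented elements, and the relation between
the `n`-tuples that represent elements of `M i` and these elements. -/
def FOStrInterpretable : Prop :=
  ∃ (n : ℕ) (φU : 𝓛.Formula (Fin n)) (φEq : 𝓛.Formula (Fin 2 × Fin n))
    (φR : ∀ m, 𝓛'.Relations m → 𝓛.Formula (Fin m × Fin n)) (φImap : 𝓛.Formula (Option (Fin n))),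
    ∀ i, ∃ μ : {a : Fin n → M i // φU.Realize a} → M' i,
      Function.Surjective μ ∧
      (∀ a : Fin 2 → {a : Fin n → M i // φU.Realize a},
        μ (a 0) = μ (a 1) ↔ φEq.Realize fun p => (a p.1).1 p.2) ∧
      (∀ (m : ℕ) (R : 𝓛'.Relations m) (a : Fin m → {a : Fin n → M i // φU.Realize a}),
        FirstOrder.Language.Structure.RelMap R (fun j => μ (a j)) ↔
          (φR m R).Realize fun p => (a p.1).1 p.2) ∧
      ∀ (a : Fin n → M i) (x : M i),
        (φImap.Realize fun o => o.elim x a) ↔ ∃ h : φU.Realize a, μ ⟨a, h⟩ = e i x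

/-- The second order analogue of `FOStrInterpretable`: elements of `M' i` are represented by
`n`-tuples of elements of `M i` together with `k`-tuples of relations on `M i`, of arities
`r 0, …, r (k - 1)`. -/
def SOStrInterpretable : Prop :=
  ∃ (n k : ℕ) (r : Fin k → ℕ) (φU : SOFormula 𝓛 (Fin n) (Fin k) r)
    (φEq : SOFormula 𝓛 (Fin 2 × Fin n) (Fin 2 × Fin k) fun p => r p.2)
    (φR : ∀ m, 𝓛'.Relations m → SOFormula 𝓛 (Fin m × Fin n) (Fin m × Fin k) fun p => r p.2)
    (φImap : SOFormula 𝓛 (Option (Fin n)) (Fin k) r),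
    ∀ i, ∃ μ : {a : (Fin n → M i) × ((j : Fin k) → Set (Fin (r j) → M i)) //
          φU.Realize a.1 a.2} → M' i,
      Function.Surjective μ ∧
      (∀ a : Fin 2 → {a : (Fin n → M i) × ((j : Fin k) → Set (Fin (r j) → M i)) //
          φU.Realize a.1 a.2},
        μ (a 0) = μ (a 1) ↔
          φEq.Realize (fun p => (a p.1).1.1 p.2) fun p => (a p.1).1.2 p.2) ∧
      (∀ (m : ℕ) (R : 𝓛'.Relations m)
        (a : Fin m → {a : (Fin n → M i) × ((j : Fin k) → Set (Fin (r j) → M i)) //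
          φU.Realize a.1 a.2}),
        FirstOrder.Language.Structure.RelMap R (fun j => μ (a j)) ↔
          (φR m R).Realize (fun p => (a p.1).1.1 p.2) fun p => (a p.1).1.2 p.2) ∧
      ∀ (a : (Fin n → M i) × ((j : Fin k) → Set (Fin (r j) → M i))) (x : M i),
        φImap.Realize (fun o => o.elim x a.1) a.2 ↔ ∃ h : φU.Realize a.1 a.2, μ ⟨a, h⟩ = e i x

end Interpretations

/-! ### Reconstruction from the group: isomorphisms and automorphisms -/

section Isomorphisms

variable (X Y : PermGroup.{u})

variable {X Y} in
/-- `α(g) = τ ∘ g ∘ τ⁻¹` for all `g`. -/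
def Induces (τ : X.bar ≃ Y.bar) (α : X.G ≃* Y.G) : Prop :=
  ∀ (g : X.G) (y : Y.bar), α g • y = τ (g • τ.symm y)

variable {X Y} in
/-- The restriction of `τ` to `S`, together with `α`, is an isomorphism from `ACT(S, G₁)` to
`ACT(T, G₂)`. -/
def ActIso (S : Set X.bar) (T : Set Y.bar) (τ : X.bar ≃ Y.bar) (α : X.G ≃* Y.G) : Prop :=
  ∃ Φ : actLang.Equiv (X.Act S ⊤) (Y.Act T ⊤),
    (∀ x : S, ∃ hx : τ x ∈ T, Φ (PermGroup.Act.point x) = PermGroup.Act.point ⟨τ x, hx⟩) ∧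
    ∀ g : X.G, Φ (PermGroup.Act.ofG g) = PermGroup.Act.ofG (α g)

variable {X Y} in
/-- The restriction of `τ` to `M`, together with `α`, is an isomorphism of the permutation groups
induced on `M` and `N`. -/
def OrbitIso (M : Set X.bar) (N : Set Y.bar) (τ : X.bar ≃ Y.bar) (α : X.G ≃* Y.G) : Prop :=
  Set.BijOn τ M N ∧ ∀ (g : X.G), ∀ x ∈ M, τ (g • x) = α g • τ x

/-- Isomorphisms of the groups are induced by unique monotonic bijections of the completions,
with the consequences for endpoints, orbits and the pointwise order. -/
def IsoReconstruction : Prop :=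
  ∀ α : X.G ≃* Y.G,
    (∃! τ : X.bar ≃ Y.bar, IsMonotonic τ ∧ Induces τ α) ∧
    (∃! τ : X.bar ≃ Y.bar, IsEdIso τ ∧ ActIso Set.univ Set.univ τ α) ∧
    ∀ τ : X.bar ≃ Y.bar, IsMonotonic τ → Induces τ α →
      ActIso X.ep Y.ep τ α ∧
      Set.BijOn (fun M => τ '' M) X.orbits Y.orbits ∧
      ((StrictMono τ ∧
          (∀ M ∈ X.orbits, StrictMonoOn τ M ∧ OrbitIso M (τ '' M) τ α) ∧
          ∀ f g, X.PtLE f g ↔ Y.PtLE (α f) (α g)) ∨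
        (StrictAnti τ ∧
          (∀ M ∈ X.orbits, StrictAntiOn τ M ∧ OrbitIso M (τ '' M) τ α) ∧
          ∀ f g, X.PtLE f g ↔ Y.PtLE (α g) (α f))) ∧
      (X.PtNontrivial → (∀ f g, X.PtLE f g ↔ Y.PtLE (α f) (α g)) → StrictMono τ)

/-- The image of a subgroup of `G` in the group of permutations of the completion. -/
def PermGroup.img (H : Subgroup X.G) : Subgroup (Equiv.Perm X.bar) :=
  H.map (MulAction.toPermHom X.G X.bar)

/-- The normalizer in `A` of the group of permutations of the completion given by `H`. -/
def PermGroup.norm (A : Subgroup (Equiv.Perm X.bar)) (H : Subgroup X.G) :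
    Subgroup (Equiv.Perm X.bar) :=
  A ⊓ Subgroup.normalizer (X.img H : Set (Equiv.Perm X.bar))

/-- `Aut(H) = Norm_A(H)`: conjugation identifies the normalizer of `H` in `A` with `Aut(H)`. -/
def PermGroup.AutEqNorm (A : Subgroup (Equiv.Perm X.bar)) (H : Subgroup X.G) : Prop :=
  ∃ Θ : X.norm A H ≃* MulAut H, ∀ (τ : X.norm A H) (h : H) (x : X.bar),
    ((Θ τ h : H) : X.G) • x =
      (τ : Equiv.Perm X.bar) ((h : X.G) • (τ : Equiv.Perm X.bar)⁻¹ x)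

/-- The group automorphisms of `G` that preserve the pointwise order. -/
def PermGroup.oAut : Subgroup (MulAut X.G) where
  carrier := {α | ∀ f g, X.PtLE (α f) (α g) ↔ X.PtLE f g}
  one_mem' := fun _ _ => Iff.rfl
  mul_mem' := by
    intro a b ha hb f g
    simp only [MulAut.mul_apply]
    rw [ha, hb]
  inv_mem' := by
    intro a ha f g
    have := ha (a⁻¹ f) (a⁻¹ g)
    simpa using this.symm

/-- The automorphisms of `G`: each is conjugation by a unique automorphism of `ED(L̄)`. -/
def AutReconstruction : Prop :=
  X.AutEqNorm (edAut X.bar) ⊤ ∧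
  X.AutEqNorm (homeoGroup X.L) ⊤ ∧
  X.norm (edAut X.bar) ⊤ = X.norm (homeoGroup X.L) ⊤ ∧
  (∀ α : MulAut X.G, ∃! τ : Equiv.Perm X.bar, τ ∈ edAut X.bar ∧ Induces τ α) ∧
  (X.oAut.index = 1 ∨ X.oAut.index = 2) ∧
  (X.PtNontrivial → ∀ α ∈ X.oAut, ∃! τ : Equiv.Perm X.bar, τ ∈ ordAut X.bar ∧ Induces τ α)

/-- Characteristic subgroups of `G` and their automorphism groups. -/
def CharacteristicSubgroups : Prop :=
  (X.bdd.Characteristic ∧ X.bddDer.Characteristic) ∧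
  (∀ α : MulAut X.G,
    (X.lft.map α.toMonoidHom = X.lft ∧ X.rt.map α.toMonoidHom = X.rt) ∨
    (X.lft.map α.toMonoidHom = X.rt ∧ X.rt.map α.toMonoidHom = X.lft)) ∧
  -- `Aut(G) ≤ Aut(Bdd(G)) ≤ Aut(Bdd'(G)) ≤ Aut(ED(L̄))`
  (X.AutEqNorm (edAut X.bar) ⊤ ∧ X.AutEqNorm (edAut X.bar) X.bdd ∧
    X.AutEqNorm (edAut X.bar) X.bddDer ∧
    X.norm (edAut X.bar) ⊤ ≤ X.norm (edAut X.bar) X.bdd ∧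
    X.norm (edAut X.bar) X.bdd ≤ X.norm (edAut X.bar) X.bddDer ∧
    ∀ α β : MulAut X.G, (∀ h ∈ X.bddDer, α h = β h) → α = β) ∧
  -- `o-Aut(G) ≤ Aut(Lft(G))`, `Aut(Lft(G)) ≤ Aut(L̄)` if `Lft(G) ≠ Bdd(G)`; the same for `Rt(G)`
  (∀ H : Subgroup X.G, H = X.lft ∨ H = X.rt →
    (X.PtNontrivial → ∀ α ∈ X.oAut, H.map α.toMonoidHom = H) ∧
    (∀ α β : MulAut X.G, (∀ h ∈ H, α h = β h) → α = β) ∧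
    (H ≠ X.bdd → X.AutEqNorm (ordAut X.bar) H))

/-- If `G` is transitive on `L`, then `Aut(G)` is the normalizer of `G` in `Aut(ED(L))` if and only
if there is no orbit `M ≠ L` in the completion such that `(L, G)` is isomorphic to `(M, G)` or to
`(M*, G)`. -/
def OrbitCriterion : Prop :=
  MulAction.IsPretransitive X.G X.L →
    ((∃ Θ : Subgroup.normalizer (X.G : Set (edAut X.L)) ≃* MulAut X.G,
        ∀ (σ : Subgroup.normalizer (X.G : Set (edAut X.L))) (g : X.G),
          ((Θ σ g : X.G) : edAut X.L) = (σ : edAut X.L) * g * (σ : edAut X.L)⁻¹) ↔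
      ¬ ∃ M ∈ X.orbits, M ≠ Set.range (toCompletion (L := X.L)) ∧
        ∃ (σ : X.L → X.bar) (β : X.G ≃* X.G), Set.range σ = M ∧ IsMonotonic σ ∧
          ∀ (g : X.G) (a : X.L), σ (g • a) = β g • σ a)

end Isomorphisms

/-! ### Reconstruction packages for classes of permutation groups -/

section Packages

variable (K : Set PermGroup.{u})

/-- The property `P` of `n`-tuples of group elements is expressed by a first order formula in the
language of groups, uniformly for all members of `K`. -/
def FOExpressible (n : ℕ) (P : ∀ X : PermGroup.{u}, (Fin n → X.G) → Prop) : Prop :=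
  ∃ ψ : grpLang.Formula (Fin n), ∀ X ∈ K, ∀ g : Fin n → X.G, ψ.Realize g ↔ P X g

/-- The property `P` of `n`-tuples of group elements is expressed by a second order formula in the
language of groups, uniformly for all members of `K`. -/
def SOExpressible (n : ℕ) (P : ∀ X : PermGroup.{u}, (Fin n → X.G) → Prop) : Prop :=
  ∃ ψ : SOFormula grpLang (Fin n) Empty Empty.elim, ∀ X ∈ K, ∀ g : Fin n → X.G,
    ψ.Realize g (fun b => b.elim) ↔ P X g

/-- For an expressibility predicate `E`: everything about group elements that is first order in
`ACT(S, G)` is expressible, and in particular the listed properties are.  (Transitivity on `S` is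
the case `k = 1` of the last item.) -/
def ExpressibilityResults
    (E : (n : ℕ) → (∀ X : PermGroup.{u}, (Fin n → X.G) → Prop) → Prop)
    (S : ∀ X : PermGroup.{u}, Set X.bar) : Prop :=
  (∀ (n : ℕ) (φ : actLang.Formula (Fin n)),
    E n fun X g => φ.Realize fun i => (PermGroup.Act.ofG (g i) : X.Act (S X) ⊤)) ∧
  (E 1 fun X g => X.Signed (g 0)) ∧
  (E 2 fun X g => X.SameSign (g 0) (g 1)) ∧
  (E 1 fun X g => g 0 ∈ X.bdd) ∧
  (E 1 fun X g => g 0 ∈ X.lft ∨ g 0 ∈ X.rt) ∧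
  (E 2 fun X g => (g 0 ∈ X.lft ∧ g 1 ∈ X.lft) ∨ (g 0 ∈ X.rt ∧ g 1 ∈ X.rt)) ∧
  (∀ k : ℕ, E 0 fun X _ => {M ∈ X.orbits | (M ∩ S X).Nonempty}.encard = k)

/-- `ACT(EP(N, G), G)` is first order strongly interpretable in `G`. -/
def FOInterpretation : Prop :=
  FOStrInterpretable grpLang actLang (fun X : K => X.1.G) (fun X : K => X.1.Act X.1.ep ⊤)
    (fun _ g => PermGroup.Act.ofG g)

/-- `ACT(ED(L̄), G)` is second order strongly interpretable in `G`. -/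
def SOInterpretation : Prop :=
  SOStrInterpretable grpLang actLang (fun X : K => X.1.G) (fun X : K => X.1.Act Set.univ ⊤)
    (fun _ g => PermGroup.Act.ofG g)

/-- Second Order Reconstruction for a class of linear permutation groups. -/
def SecondOrderReconstruction : Prop :=
  (∀ X ∈ K, ∀ Y ∈ K, IsoReconstruction X Y) ∧
  (∀ X ∈ K, AutReconstruction X ∧ CharacteristicSubgroups X ∧ OrbitCriterion X) ∧
  SOInterpretation K ∧
  ExpressibilityResults (SOExpressible K) (fun _ => Set.univ) ∧
  SOExpressible {X ∈ K | MulAction.IsPretransitive X.G X.L} 0 (fun X _ => DedekindComplete X.L)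

/-- The elementary equivalence of the structures of the action of a subgroup on endpoints. -/
def EpActEquiv (X Y : PermGroup.{u}) (H₁ : Subgroup X.G) (H₂ : Subgroup Y.G) : Prop :=
  actLang.ElementarilyEquivalent (X.Act X.ep H₁) (Y.Act Y.ep H₂)

/-- First Order Reconstruction for a class of linear permutation groups. -/
def FirstOrderReconstruction : Prop :=
  SecondOrderReconstruction K ∧
  FOInterpretation K ∧
  ExpressibilityResults (FOExpressible K) (fun X => X.ep) ∧
  (∀ X ∈ K, ∀ Y ∈ K, grpLang.ElementarilyEquivalent X.G Y.G →
    EpActEquiv X Y ⊤ ⊤ ∧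
    EpActEquiv X Y X.bdd Y.bdd ∧
    ((EpActEquiv X Y X.lft Y.lft ∧ EpActEquiv X Y X.rt Y.rt) ∨
      (EpActEquiv X Y X.lft Y.rt ∧ EpActEquiv X Y X.rt Y.lft))) ∧
  (∀ X ∈ K, ∀ H : Subgroup X.G, H = X.bdd ∨ H = X.lft ∨ H = X.rt →
    grpLang.ElementarilyEquivalent X.G H → H = ⊤)

/-- Second Order Reconstruction for a class of monotonic permutation groups: as in the linear case,
with the additional statements about the subgroup of order preserving elements. -/
def MonotonicSecondOrderReconstruction : Prop :=
  SecondOrderReconstruction K ∧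
  (∀ X ∈ K, X.opp.Characteristic ∧
    X.AutEqNorm (edAut X.bar) X.opp ∧
    X.norm (edAut X.bar) ⊤ ≤ X.norm (edAut X.bar) X.opp ∧
    X.norm (edAut X.bar) X.opp ≤ X.norm (edAut X.bar) X.bdd) ∧
  SOExpressible K 1 (fun X g => g 0 ∈ X.opp)

/-- First Order Reconstruction for a class of monotonic permutation groups. -/
def MonotonicFirstOrderReconstruction : Prop :=
  FirstOrderReconstruction K ∧
  MonotonicSecondOrderReconstruction K ∧
  FOExpressible K 1 (fun X g => g 0 ∈ X.opp) ∧
  (∀ X ∈ K, ∀ Y ∈ K, grpLang.ElementarilyEquivalent X.G Y.G → EpActEquiv X Y X.opp Y.opp) ∧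
  (∀ X ∈ K, grpLang.ElementarilyEquivalent X.G X.opp → X.opp = ⊤)

/-- The members of a class that represent linear permutation groups. -/
def linearPart : Set PermGroup.{u} := {X ∈ K | X.IsLinear}

/-- The members of a class whose group contains an order reversing element. -/
def reversingPart : Set PermGroup.{u} := {X ∈ K | ∃ g : X.G, g ∉ X.opp}

/-- For an expressibility predicate `E`: linear permutation groups are distinguished from
monotonic ones with an order reversing element by sentences in the language of groups. -/
def TypesDistinguished
    (E : Set PermGroup.{u} → (n : ℕ) → (∀ X : PermGroup.{u}, (Fin n → X.G) → Prop) → Prop) :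
    Prop :=
  E (linearPart K ∪ reversingPart K) 0 (fun X _ => X ∈ linearPart K) ∧
  E (linearPart K ∪ reversingPart K) 0 (fun X _ => X ∈ reversingPart K)

end Packages

/-! ### Span-transitive classes -/

/-- Span-transitive locally moving monotonic permutation groups. -/
def KSpan : Set PermGroup.{u} := {X | X.LocallyMoving ∧ X.SpanTransitive}

/-- The members of `KSpan` such that `Var(N, G)` contains a bounded interval or a ray. -/
def KSpanInt : Set PermGroup.{u} := {X ∈ KSpan | X.VarHasIntervalOrRay}

end NearlyOrdered

end

set_option linter.unusedSectionVars false

noncomputable section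

namespace NearlyOrdered

/-! ### Flexible groups of monotonic permutations -/

section Flexible

/-! The chain is recovered from the group by describing supports inside the group and then replacing
points of the completion by families of group elements.

All that is used of the action is `Flexible`: for `a < x < y < b` some element supported in `(a, b)`
moves `x` beyond `y`. Span-transitivity gives this already for the derived group of the bounded
elements (`IsLocalNormal.exists_moves`), hence for every subgroup above it (`flexible_of_le`). The
recurring argument: if a displacement were impossible, the supremum or infimum of a suitable
invariant set would be fixed by elements that are known to move it.

In a flexible group the commutator condition `AlgDisj f g`, in the style of Rubin, follows from
disjointness of the supports of `f` and `g`, and implies that the supports of `f` and `g * g` are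
disjoint. This is exact enough to express `supp f ⊆ cl (supp g)` and disjointness of supports in the
group (`sub_iff`, `dj_iff`). The families of all elements supported in an open ray are then the
families closed under double `Perp` for which both the family and its `Perp` are nontrivial and
satisfy `Conv` (`isRayP_iff`). A point is a pair of complementary ray families; direction, equality
and action become inclusion and conjugation of families (`edP_iff`, `sameP_iff`, `rayAt_conjSet`).
Since `IsRayP` does not mention the action, an isomorphism between flexible groups carries points to
points and is induced by a monotonic bijection (`exists_inducing`); it is unique because the
stabilizer of a point fixes no other point (`inducing_unique`). The statements on automorphisms,
normalizers, characteristic subgroups and orbits are obtained by transport along this bijection.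

On the logical side, an arbitrary ray family is a second order object, which yields the
interpretation of the action on the whole completion. If `x` is an end of `supp p`, however, the ray
at `x` avoiding `supp p` is definable from `p` and one element `w` supported in it, as `Comp p w`
(`comp_eq_Id`); conversely a ray of the form `Comp p w` always starts at an endpoint
(`endPt_of_rayAt_comp`). So the action on endpoints is coded by pairs of group elements, in first
order logic. Both cases run through one abstract notion `Definability`, through `decode`, and
through `def_of_decoding`. The listed properties are then formulas about the direction relation on a
dense invariant set of points. Elementary equivalence passes to the actions of definable subgroups
(`def_realize_subgroup`), and `G ≡ H` implies `H = G` because `H` acts as a span-transitive locally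
moving group too, so that a sentence such as "all elements are bounded" can be compared in both
(`of_restrict`). -/

/-- A group acting monotonically and faithfully on a Dedekind complete chain, such that for
`a < x < y < b` some element supported in `(a, b)` moves `x` beyond `y`. -/
structure Flexible (H B : Type*) [LinearOrder B] [Group H] [MulAction H B] : Prop where
  complete : DedekindComplete B
  monotonic : ∀ h : H, IsMonotonic fun x : B => h • x
  faithful : ∀ h : H, (∀ x : B, h • x = x) → h = 1
  moves : ∀ a x y b : B, a < x → x < y → y < b →
    ∃ h : H, (∀ z, z ∉ Set.Ioo a b → h • z = z) ∧ y < h • x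

/-- The set of points moved by `h`. -/
def msupp {H : Type*} (B : Type*) [SMul H B] (h : H) : Set B := {x | h • x ≠ x}

section Basic

variable {H B : Type*} [Group H] [MulAction H B]

theorem mem_msupp {h : H} {x : B} : x ∈ msupp B h ↔ h • x ≠ x := Iff.rfl

theorem notMem_msupp {h : H} {x : B} : x ∉ msupp B h ↔ h • x = x := by simp [msupp]

theorem msupp_inv (h : H) : msupp B h⁻¹ = msupp B h := by
  ext x
  simp only [msupp, Set.mem_ofPred_eq, ne_eq, not_iff_not]
  rw [inv_smul_eq_iff, eq_comm]

theorem msupp_one : msupp B (1 : H) = ∅ := by ext x; simp [msupp]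

theorem msupp_mul (g h : H) : msupp B (g * h) ⊆ msupp B g ∪ msupp B h := by
  intro x hx
  by_contra hc
  rw [Set.mem_union, not_or, notMem_msupp, notMem_msupp] at hc
  exact hx (by rw [mul_smul, hc.2, hc.1])

theorem mem_msupp_conj {g h : H} {x : B} : x ∈ msupp B (g * h * g⁻¹) ↔ g⁻¹ • x ∈ msupp B h := by
  rw [mem_msupp, mem_msupp, not_iff_not, mul_smul, mul_smul]
  rw [eq_inv_smul_iff]

theorem smul_mem_msupp_conj {g h : H} {x : B} :
    g • x ∈ msupp B (g * h * g⁻¹) ↔ x ∈ msupp B h := by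
  rw [mem_msupp_conj, inv_smul_smul]

theorem smul_mem_msupp {h : H} {x : B} : h • x ∈ msupp B h ↔ x ∈ msupp B h := by
  simp [mem_msupp]

theorem smul_mem_of_commute {f g : H} (hc : f * g = g * f) {x : B} :
    f • x ∈ msupp B g ↔ x ∈ msupp B g := by
  rw [mem_msupp, mem_msupp, not_iff_not, ← mul_smul, ← hc, mul_smul, smul_left_cancel_iff]

end Basic

section Chain

variable {H B : Type*} [LinearOrder B] [Group H] [MulAction H B]

/-- An order reversing map has at most one fixed point. -/
theorem strictMono_of_fixes {h : H} (hm : IsMonotonic fun x : B => h • x) {x y : B} (hxy : x < y)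
    (hx : h • x = x) (hy : h • y = y) : StrictMono fun x : B => h • x := by
  rcases hm with hm | hm
  · exact hm
  · have := hm hxy
    simp only [hx, hy] at this
    exact absurd this hxy.asymm

variable [TopologicalSpace B] [OrderTopology B] [DenselyOrdered B] [NoMinOrder B] [NoMaxOrder B]

theorem IsMonotonic.continuous_smul {h : H} (hm : IsMonotonic fun x : B => h • x) :
    Continuous fun x : B => h • x := by
  have hs := MulAction.surjective (β := B) h
  rcases hm with hm | hm
  · exact hm.monotone.continuous_of_surjective hs
  · have : Continuous (OrderDual.toDual ∘ fun x : B => h • x) :=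
      Monotone.continuous_of_surjective (β := Bᵒᵈ) (fun x y hxy => hm.antitone hxy) hs
    exact continuous_ofDual.comp this

theorem IsMonotonic.isOpen_msupp {h : H} (hm : IsMonotonic fun x : B => h • x) :
    IsOpen (msupp B h) :=
  isOpen_ne_fun hm.continuous_smul continuous_id

theorem IsMonotonic.smul_eq_of_mem_closure {h : H} (hm : IsMonotonic fun x : B => h • x)
    {S : Set B} (hS : ∀ x ∈ S, h • x = x) {x : B} (hx : x ∈ closure S) : h • x = x := by
  have : IsClosed {x : B | h • x = x} := isClosed_eq hm.continuous_smul continuous_id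
  exact closure_minimal hS this hx

/-- A moved point has a neighbourhood in a given open set that is moved off itself. -/
theorem IsMonotonic.exists_Ioo_moved {h : H} (hm : IsMonotonic fun x : B => h • x) {x : B}
    (hx : h • x ≠ x) {U : Set B} (hU : IsOpen U) (hxU : x ∈ U) :
    ∃ a b, x ∈ Set.Ioo a b ∧ Set.Ioo a b ⊆ U ∧ ∀ z ∈ Set.Ioo a b, h • z ∉ Set.Ioo a b := by
  obtain ⟨V, W, hV, hW, hxV, hxW, hVW⟩ := t2_separation hx
  have hopen : IsOpen (U ∩ (W ∩ (fun x : B => h • x) ⁻¹' V)) :=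
    hU.inter (hW.inter (hV.preimage hm.continuous_smul))
  obtain ⟨a, b, hab, hs⟩ := mem_nhds_iff_exists_Ioo_subset.1 (hopen.mem_nhds ⟨hxU, hxW, hxV⟩)
  refine ⟨a, b, hab, fun z hz => (hs hz).1, fun z hz hz' => ?_⟩
  exact Set.disjoint_left.1 hVW (hs hz).2.2 (hs hz').2.1

theorem exists_Ioo_of_isOpen {U : Set B} (hU : IsOpen U) {x : B} (hx : x ∈ U) :
    ∃ a b, a < x ∧ x < b ∧ Set.Ioo a b ⊆ U := by
  obtain ⟨a, b, hab, hs⟩ := mem_nhds_iff_exists_Ioo_subset.1 (hU.mem_nhds hx)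
  exact ⟨a, b, hab.1, hab.2, hs⟩

end Chain

namespace Flexible

variable {H B : Type*} [LinearOrder B] [Group H] [MulAction H B]
  [TopologicalSpace B] [OrderTopology B] [DenselyOrdered B] [NoMinOrder B] [NoMaxOrder B]

theorem isOpen_msupp (F : Flexible H B) (h : H) : IsOpen (msupp B h) :=
  (F.monotonic h).isOpen_msupp

theorem exists_mem_msupp (F : Flexible H B) {h : H} (hh : h ≠ 1) : ∃ x, x ∈ msupp B h := by
  by_contra hc
  push Not at hc
  exact hh (F.faithful h fun x => notMem_msupp.1 (hc x))

theorem ne_one_of_mem {h : H} {x : B} (hx : x ∈ msupp B h) : h ≠ 1 := by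
  rintro rfl
  simp [msupp_one] at hx

/-- Every point of an open set is moved by an element supported in the set. -/
theorem exists_moving (F : Flexible H B) {U : Set B} (hU : IsOpen U) {x : B} (hx : x ∈ U) :
    ∃ h : H, x ∈ msupp B h ∧ msupp B h ⊆ U := by
  obtain ⟨a, b, ha, hb, hs⟩ := exists_Ioo_of_isOpen hU hx
  obtain ⟨y, hy, hyb⟩ := exists_between hb
  obtain ⟨h, h1, h2⟩ := F.moves a x y b ha hy hyb
  refine ⟨h, (hy.trans h2).ne', fun z hz => hs ?_⟩
  by_contra hc
  exact hz (h1 z hc)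

/-- An element permutes its support and fixes everything else, so it preserves every set containing
the support. -/
theorem smul_mem_of_msupp_subset {h : H} {U : Set B} (hU : msupp B h ⊆ U) {x : B} :
    h • x ∈ U ↔ x ∈ U := by
  by_cases hx : x ∈ msupp B h
  · exact ⟨fun _ => hU hx, fun _ => hU (smul_mem_msupp.2 hx)⟩
  · rw [notMem_msupp.1 hx]

/-- The elements supported in a convex open set act on it with dense orbits. -/
theorem exists_smul_mem (F : Flexible H B) {U : Set B} (hU : IsOpen U) (hc : U.OrdConnected)
    {W : Set B} (hW : IsOpen W) {x y : B} (hx : x ∈ U) (hy : y ∈ U) (hyW : y ∈ W) :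
    ∃ h : H, msupp B h ⊆ U ∧ h • x ∈ W := by
  obtain ⟨p, q, hp, hq, hs⟩ := exists_Ioo_of_isOpen (hW.inter hU) ⟨hyW, hy⟩
  rcases lt_trichotomy x y with hxy | rfl | hxy
  · obtain ⟨a, b, ha, hb, hs'⟩ := exists_Ioo_of_isOpen hU hx
    -- With `p'` above both `p` and `x`, an element supported in `(a, q)` that moves `x` beyond `p'`
    -- puts it into `(p, q)`.
    obtain ⟨p', hp', hp'y⟩ := exists_between (max_lt hp hxy)
    obtain ⟨h, h1, h2⟩ := F.moves a x p' q ha ((le_max_right _ _).trans_lt hp') (hp'y.trans hq)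
    have hsub : msupp B h ⊆ Set.Ioo a q := fun z hz => by_contra fun hc => hz (h1 z hc)
    refine ⟨h, hsub.trans fun z hz => ?_, ?_⟩
    · rcases lt_or_ge z x with hzx | hzx
      · exact hs' ⟨hz.1, hzx.trans hb⟩
      · rcases le_or_gt z y with hzy | hzy
        · exact hc.out hx hy ⟨hzx, hzy⟩
        · exact (hs ⟨hp.trans hzy, hz.2⟩).2
    · have : h • x ∈ Set.Ioo a q := (smul_mem_of_msupp_subset hsub).2 ⟨ha, hxy.trans hq⟩
      exact (hs ⟨((le_max_left _ _).trans_lt hp').trans h2, this.2⟩).1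
  · exact ⟨1, by simp [msupp_one], by simpa using hyW⟩
  · obtain ⟨a, b, ha, hb, hs'⟩ := exists_Ioo_of_isOpen hU hx
    obtain ⟨q', hyq', hq'⟩ := exists_between (lt_min hq hxy)
    -- `moves` only pushes points upwards; to lower `x` below `q'`, an element lifting `q'` above
    -- `x` is inverted.
    obtain ⟨h, h1, h2⟩ := F.moves p q' x b (hp.trans hyq') (hq'.trans_le (min_le_right _ _)) hb
    have hsub : msupp B h ⊆ Set.Ioo p b := fun z hz => by_contra fun hc => hz (h1 z hc)
    have hmono : StrictMono fun x : B => h • x :=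
      strictMono_of_fixes (F.monotonic h) (hp.trans (hxy.trans hb))
        (h1 p (by simp)) (h1 b (by simp))
    refine ⟨h⁻¹, by
      rw [msupp_inv]
      refine hsub.trans fun z hz => ?_
      rcases lt_or_ge x z with hzx | hzx
      · exact hs' ⟨ha.trans hzx, hz.2⟩
      · rcases le_or_gt y z with hzy | hzy
        · exact hc.out hy hx ⟨hzy, hzx⟩
        · exact (hs ⟨hz.1, hzy.trans hq⟩).2, ?_⟩
    have : h⁻¹ • x ∈ Set.Ioo p b :=
      (smul_mem_of_msupp_subset (by rwa [msupp_inv])).2 ⟨hp.trans hxy, hb⟩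
    have h3 : h⁻¹ • x < q' := by
      have := h2
      rw [← hmono.lt_iff_lt]
      simpa using h2
    exact (hs ⟨this.1, h3.trans (hq'.trans_le (min_le_left _ _))⟩).1

end Flexible

end Flexible

end NearlyOrdered

namespace NearlyOrdered

/-! ### Group theoretic description of supports -/

section GroupPredicates

variable {H : Type*} [Mul H]

/-- Algebraic disjointness: every `h` that does not commute with `f` admits `f₁`, `f₂` in the
centralizer of `g` such that `[f₁, [f₂, h]]` is a nontrivial element of that centralizer. -/
def AlgDisj (f g : H) : Prop :=
  ∀ h, f * h ≠ h * f → ∃ f₁ f₂ c d, f₁ * g = g * f₁ ∧ f₂ * g = g * f₂ ∧ f₂ * h = c * (h * f₂) ∧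
    f₁ * c = d * (c * f₁) ∧ d * d ≠ d ∧ d * g = g * d

/-- The group theoretic version of `supp f ⊆ cl (supp g)`. -/
def Sub (f g : H) : Prop := ∀ k, AlgDisj g k → f * (k * k) = (k * k) * f

/-- The group theoretic version of disjointness of supports. -/
def Dj (f g : H) : Prop := ∀ k, Sub k f → Sub k g → k * k = k

/-- The elements disjoint from all elements of `P`. -/
def Perp (P : Set H) : Set H := {k | ∀ a, a ∈ P → Dj k a}

/-- Nontrivial elements of `P` can be made to overlap by conjugation in `P`. -/
def Conv (P : Set H) : Prop :=
  ∀ k₁ k₂, k₁ ∈ P → k₂ ∈ P → k₁ * k₁ ≠ k₁ → k₂ * k₂ ≠ k₂ →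
    ∃ h c, h ∈ P ∧ c * h = h * k₁ ∧ ¬ Dj c k₂

/-- The group theoretic description of the sets of all elements supported in a ray. -/
def IsRayP (P : Set H) : Prop :=
  (∀ k, k ∈ Perp (Perp P) → k ∈ P) ∧ Conv P ∧ Conv (Perp P) ∧
    (∃ k, k ∈ P ∧ k * k ≠ k) ∧ ∃ k, k ∈ Perp P ∧ k * k ≠ k

/-- The group theoretic description of the set of all elements supported in the components of the
exterior of `supp p` that meet `supp w`. -/
def Comp (p w : H) : Set H :=
  {k | Dj k p ∧ ∀ k', k' * k' ≠ k' → Sub k' k → ∃ h c, Dj h p ∧ c * h = h * k' ∧ ¬ Dj c w}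

end GroupPredicates

/-- The elements supported in `U`. -/
def Id (H : Type*) {B : Type*} [SMul H B] (U : Set B) : Set H := {k | msupp B k ⊆ U}

theorem eq_conj_of_mul_eq {H : Type*} [Group H] {c h k : H} (e : c * h = h * k) :
    c = h * k * h⁻¹ := by rw [← e, mul_inv_cancel_right]

namespace Flexible

variable {H B : Type*} [LinearOrder B] [Group H] [MulAction H B]
  [TopologicalSpace B] [OrderTopology B] [DenselyOrdered B] [NoMinOrder B] [NoMaxOrder B]

/-- The support of `h` is invariant under everything that commutes with `h`. -/
theorem not_commute_of_moves {f h : H} {z : B} (hz : z ∈ msupp B h) (hf : f • z ∉ msupp B h) :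
    f * h ≠ h * f := fun hc => hf ((smul_mem_of_commute hc).2 hz)

theorem commute_of_disjoint (F : Flexible H B) {f g : H}
    (hd : Disjoint (msupp B f) (msupp B g)) : f * g = g * f := by
  have key : ∀ x : B, (f * g) • x = (g * f) • x := by
    intro x
    rw [mul_smul, mul_smul]
    by_cases hf : x ∈ msupp B f
    · rw [notMem_msupp.1 (Set.disjoint_left.1 hd hf),
        notMem_msupp.1 (Set.disjoint_left.1 hd (smul_mem_msupp.2 hf))]
    · rw [notMem_msupp.1 hf]
      by_cases hg : x ∈ msupp B g
      · exact notMem_msupp.1 (Set.disjoint_right.1 hd (smul_mem_msupp.2 hg))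
      · rw [notMem_msupp.1 hg, notMem_msupp.1 hf]
  have := F.faithful ((g * f)⁻¹ * (f * g)) fun x => by rw [mul_smul, key, inv_smul_smul]
  rwa [inv_mul_eq_one, eq_comm] at this

/-- Choose `x` in both `supp f` and `supp h`, and an interval `V` around `x` inside `supp f` that
`h` moves off itself. For `f₂` supported in `V`, the commutator `c = [f₂, h]` acts on `V` like `f₂`.
If `f₂` moves `W ⊆ V` off itself and `f₁` is supported in `W`, then `d = [f₁, c]` agrees with `f₁`
at `x`, so it is nontrivial. All of `f₁`, `f₂`, `d` are supported in `supp f` and therefore commute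
with `g`. -/
theorem algDisj_of_disjoint (F : Flexible H B) {f g : H}
    (hd : Disjoint (msupp B f) (msupp B g)) : AlgDisj f g := by
  intro h hh
  obtain ⟨x, hxf, hxh⟩ : ∃ x, x ∈ msupp B f ∧ x ∈ msupp B h := by
    by_contra hc
    push Not at hc
    exact hh (F.commute_of_disjoint (Set.disjoint_left.2 hc))
  obtain ⟨a, b, hab, hVf, hVh⟩ := (F.monotonic h).exists_Ioo_moved hxh (F.isOpen_msupp f) hxf
  obtain ⟨f₂, hx2, hf2⟩ := F.exists_moving isOpen_Ioo hab
  obtain ⟨a', b', hab', hW, hW2⟩ := (F.monotonic f₂).exists_Ioo_moved hx2 isOpen_Ioo hab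
  obtain ⟨f₁, hx1, hf1⟩ := F.exists_moving isOpen_Ioo hab'
  have hcomm : ∀ k : H, msupp B k ⊆ Set.Ioo a b → k * g = g * k := fun k hk =>
    F.commute_of_disjoint (hd.mono_left (hk.trans hVf))
  set c := f₂ * (h * f₂⁻¹ * h⁻¹) with hc
  have hcV : ∀ z ∈ Set.Ioo a b, c • z = f₂ • z := by
    intro z hz
    have : z ∉ msupp B (h * f₂⁻¹ * h⁻¹) := by
      rw [mem_msupp_conj, msupp_inv]
      intro h1
      have := hVh _ (hf2 h1)
      rw [smul_inv_smul] at this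
      exact this hz
    rw [hc, mul_smul, notMem_msupp.1 this]
  set d := f₁ * (c * f₁⁻¹ * c⁻¹) with hd'
  have hdsub : msupp B d ⊆ Set.Ioo a b := by
    refine (msupp_mul _ _).trans (Set.union_subset (hf1.trans hW) ?_)
    intro z hz
    rw [mem_msupp_conj, msupp_inv] at hz
    have h1 := hW (hf1 hz)
    have h2 : f₂ • c⁻¹ • z ∈ Set.Ioo a b := (smul_mem_of_msupp_subset hf2).2 h1
    rwa [← hcV _ h1, smul_inv_smul] at h2
  have hxd : x ∈ msupp B d := by
    have : x ∉ msupp B (c * f₁⁻¹ * c⁻¹) := by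
      rw [mem_msupp_conj, msupp_inv]
      intro h1
      have h2 := hW2 _ (hf1 h1)
      rw [← hcV _ (hW (hf1 h1)), smul_inv_smul] at h2
      exact h2 hab'
    rw [mem_msupp, hd', mul_smul, notMem_msupp.1 this]
    exact hx1
  refine ⟨f₁, f₂, c, d, hcomm _ (hf1.trans hW), hcomm _ hf2, by rw [hc]; group,
    by rw [hd']; group, ?_, hcomm _ hdsub⟩
  rw [Ne, mul_eq_left]
  exact ne_one_of_mem hxd

/-- Since `g * g` preserves the order, its positive powers all move a small interval `V` off itself
in one direction, so the square suffices. An element `h` supported in `V` yields a commutator `d`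
whose support is covered by four translates of `V` under elements commuting with `g`. As `d`
commutes with `g` as well, its support contains whole orbits of `g * g`, and five points of one
orbit do not fit into the four translates. -/
theorem disjoint_of_algDisj (F : Flexible H B) {f g : H} (hd : AlgDisj f g) :
    Disjoint (msupp B f) (msupp B (g * g)) := by
  rw [Set.disjoint_left]
  intro x hxf hxg
  obtain ⟨a, b, hab, -, hVf⟩ := (F.monotonic f).exists_Ioo_moved hxf isOpen_univ (Set.mem_univ x)
  obtain ⟨a', b', hab', hsub, hVg⟩ :=
    (F.monotonic (g * g)).exists_Ioo_moved hxg isOpen_Ioo hab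
  set V := Set.Ioo a' b' with hV
  have hG : StrictMono fun x : B => (g * g) • x := by
    rcases F.monotonic g with hm | hm
    · exact fun x y hxy => by simpa [mul_smul] using hm (hm hxy)
    · exact fun x y hxy => by simpa [mul_smul] using hm (hm hxy)
  have hpow : ∀ n : ℕ, ∀ z ∈ V, (g * g) ^ (n + 1) • z ∉ V := by
    -- the translates of `V` move in one direction
    have hdir : (∀ z ∈ V, b' ≤ (g * g) • z) ∨ ∀ z ∈ V, (g * g) • z ≤ a' := by
      have h1 := hVg x hab'
      rw [hV, Set.mem_Ioo, not_and_or, not_lt, not_lt] at h1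
      rcases h1 with h1 | h1
      · right
        intro z hz
        have h2 := hVg z hz
        rw [hV, Set.mem_Ioo, not_and_or, not_lt, not_lt] at h2
        refine h2.resolve_right fun h2 => ?_
        -- a point strictly between the images of `x` and `z` would lie in `V`
        obtain ⟨m, hm1, hm2⟩ := exists_between (hab'.1.trans hab'.2)
        have h3 := hVg ((g * g)⁻¹ • m)
        rw [smul_inv_smul] at h3
        refine h3 ⟨?_, ?_⟩ ⟨hm1, hm2⟩
        · refine hab'.1.trans (hG.lt_iff_lt.1 ?_)
          simpa only [smul_inv_smul] using h1.trans_lt hm1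
        · refine lt_trans (hG.lt_iff_lt.1 ?_) hz.2
          simpa only [smul_inv_smul] using hm2.trans_le h2
      · left
        intro z hz
        have h2 := hVg z hz
        rw [hV, Set.mem_Ioo, not_and_or, not_lt, not_lt] at h2
        refine h2.resolve_left fun h2 => ?_
        obtain ⟨m, hm1, hm2⟩ := exists_between (hab'.1.trans hab'.2)
        have h3 := hVg ((g * g)⁻¹ • m)
        rw [smul_inv_smul] at h3
        refine h3 ⟨?_, ?_⟩ ⟨hm1, hm2⟩
        · refine hz.1.trans (hG.lt_iff_lt.1 ?_)
          simpa only [smul_inv_smul] using h2.trans_lt hm1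
        · refine lt_trans (hG.lt_iff_lt.1 ?_) hab'.2
          simpa only [smul_inv_smul] using hm2.trans_le h1
    rcases hdir with hdir | hdir
    · have : ∀ n : ℕ, ∀ z ∈ V, b' ≤ (g * g) ^ (n + 1) • z := by
        intro n
        induction n with
        | zero => simpa using hdir
        | succ n ih =>
          intro z hz
          have h1 : (g * g) • z ≤ (g * g) • (g * g) ^ (n + 1) • z :=
            hG.monotone (hz.2.le.trans (ih z hz))
          rw [pow_succ' _ (n + 1), mul_smul]
          exact (hdir z hz).trans h1
      exact fun n z hz hz' => absurd hz'.2 (not_lt.2 (this n z hz))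
    · have : ∀ n : ℕ, ∀ z ∈ V, (g * g) ^ (n + 1) • z ≤ a' := by
        intro n
        induction n with
        | zero => simpa using hdir
        | succ n ih =>
          intro z hz
          have h1 : (g * g) • (g * g) ^ (n + 1) • z ≤ (g * g) • z :=
            hG.monotone ((ih z hz).trans hz.1.le)
          rw [pow_succ' _ (n + 1), mul_smul]
          exact h1.trans (hdir z hz)
      exact fun n z hz hz' => absurd hz'.1 (not_lt.2 (this n z hz))
  obtain ⟨h, hxh, hh⟩ := F.exists_moving isOpen_Ioo hab'
  have hfh : f * h ≠ h * f := not_commute_of_moves hxh fun h1 => hVf x hab (hsub (hh h1))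
  obtain ⟨f₁, f₂, c, d, h1, h2, hc, hd, hd1, hdg⟩ := hd h hfh
  have hc' : c = f₂ * h * f₂⁻¹ * h⁻¹ := by
    rw [show f₂ * h * f₂⁻¹ * h⁻¹ = f₂ * h * (h * f₂)⁻¹ by group, hc, mul_inv_cancel_right]
  have hd' : d = f₁ * c * f₁⁻¹ * c⁻¹ := by
    rw [show f₁ * c * f₁⁻¹ * c⁻¹ = f₁ * c * (c * f₁)⁻¹ by group, hd, mul_inv_cancel_right]
  have hcsupp : ∀ z ∈ msupp B c, z ∈ V ∨ f₂⁻¹ • z ∈ V := by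
    intro z hz
    rw [hc'] at hz
    rcases msupp_mul _ _ hz with hz | hz
    · exact Or.inr (hh (mem_msupp_conj.1 hz))
    · rw [msupp_inv] at hz
      exact Or.inl (hh hz)
  -- four elements commuting with `g` such that the inverse images of `V` cover the support of `d`
  set E : Fin 4 → H := ![1, f₂⁻¹, f₁⁻¹, f₂⁻¹ * f₁⁻¹] with hE
  have hEg : ∀ i, Commute (E i) g := by
    have c1 : Commute f₁⁻¹ g := Commute.inv_left h1
    have c2 : Commute f₂⁻¹ g := Commute.inv_left h2
    intro i
    fin_cases i
    · exact Commute.one_left g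
    · exact c2
    · exact c1
    · exact c2.mul_left c1
  have hdsupp : ∀ z ∈ msupp B d, ∃ i, E i • z ∈ V := by
    intro z hz
    rw [hd'] at hz
    rcases msupp_mul _ _ hz with hz | hz
    · rcases hcsupp _ (mem_msupp_conj.1 hz) with hz | hz
      · exact ⟨2, hz⟩
      · exact ⟨3, by simpa [hE, mul_smul] using hz⟩
    · rw [msupp_inv] at hz
      rcases hcsupp _ hz with hz | hz
      · exact ⟨0, by simpa [hE] using hz⟩
      · exact ⟨1, hz⟩
  rw [Ne, mul_eq_left] at hd1
  obtain ⟨z, hz⟩ := F.exists_mem_msupp (B := B) hd1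
  have horb : ∀ n : ℕ, (g * g) ^ n • z ∈ msupp B d := by
    have hcd : Commute ((g * g)) d := (Commute.mul_left (show Commute d g from hdg).symm (show Commute d g from hdg).symm)
    intro n
    exact (smul_mem_of_commute (hcd.pow_left n)).2 hz
  -- Pigeonhole: the points `(g * g) ^ n • z` for `n < 5` all lie in `supp d`, which is covered by
  -- four sets.
  choose i hi using fun n : Fin 5 => hdsupp _ (horb n)
  obtain ⟨m, n, hmn, himn⟩ := Fintype.exists_ne_map_eq_of_card_lt i (by simp)
  have main : ∀ m n : Fin 5, m < n → i m = i n → False := by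
    intro m n hmn e
    obtain ⟨k, hk⟩ := Nat.exists_eq_add_of_lt hmn
    have h3 := hi n
    rw [← e, hk] at h3
    have h4 : (g * g) ^ (m + k + 1 : ℕ) = (g * g) ^ (k + 1) * (g * g) ^ (m : ℕ) := by
      rw [← pow_add]; congr 1; ring
    -- Because `E (i m)` commutes with the power, two points of the orbit in the same translate give
    -- a point of `V` whose image under a positive power of `g * g` is again in `V`.
    have h5 : Commute (E (i m)) ((g * g) ^ (k + 1)) := ((hEg _).mul_right (hEg _)).pow_right _
    rw [h4, mul_smul, ← mul_smul, h5.eq, mul_smul] at h3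
    exact hpow k _ (hi m) h3
  rcases lt_or_gt_of_ne hmn with hlt | hlt
  · exact main m n hlt himn
  · exact main n m hlt himn.symm

end Flexible

end NearlyOrdered

/-! ### Supports and rays recognized inside the group -/

namespace NearlyOrdered

/-- `P` consists of the elements supported in one of the two rays given by `x`. -/
def RayAt {H B : Type*} [LinearOrder B] [SMul H B] (x : B) (P : Set H) : Prop :=
  P = Id H (Set.Iio x) ∨ P = Id H (Set.Ioi x)

namespace Flexible

variable {H B : Type*} [LinearOrder B] [Group H] [MulAction H B]
  [TopologicalSpace B] [OrderTopology B] [DenselyOrdered B] [NoMinOrder B] [NoMaxOrder B]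

theorem strictMono_of_disjoint (F : Flexible H B) {h : H} {U : Set B} (hU : IsOpen U)
    (hne : U.Nonempty) (hd : Disjoint (msupp B h) U) : StrictMono fun x : B => h • x := by
  obtain ⟨x, hx⟩ := hne
  obtain ⟨a, b, ha, hb, hs⟩ := exists_Ioo_of_isOpen hU hx
  obtain ⟨y, hy, hyb⟩ := exists_between hb
  exact strictMono_of_fixes (F.monotonic h) hy
    (notMem_msupp.1 (Set.disjoint_right.1 hd hx))
    (notMem_msupp.1 (Set.disjoint_right.1 hd (hs ⟨ha.trans hy, hyb⟩)))

/-- An order preserving map has no cycles of length two. -/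
theorem msupp_mul_self {h : H} (hm : StrictMono fun x : B => h • x) :
    msupp B (h * h) = msupp B h := by
  ext x
  rw [mem_msupp, mem_msupp, mul_smul, not_iff_not]
  constructor
  · intro e
    rcases lt_trichotomy (h • x) x with hx | hx | hx
    · have := hm hx
      simp only [e] at this
      exact absurd this hx.asymm
    · exact hx
    · have := hm hx
      simp only [e] at this
      exact absurd this hx.asymm
  · intro e
    rw [e, e]

/-- If `f` moves a point outside `cl (supp g)`, an element `k` supported near that point is disjoint
from `g`, and `k * k`, having the same support as `k`, does not commute with `f`. Conversely
`AlgDisj g k` makes the open set `supp (k * k)` disjoint from `supp g`, hence from its closure and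
from `supp f`. -/
theorem sub_iff (F : Flexible H B) {f g : H} :
    Sub f g ↔ msupp B f ⊆ closure (msupp B g) := by
  constructor
  · intro hs x hx
    by_contra hxg
    obtain ⟨a, b, hab, hVU, hV⟩ := (F.monotonic f).exists_Ioo_moved hx
      isClosed_closure.isOpen_compl hxg
    obtain ⟨k, hxk, hk⟩ := F.exists_moving isOpen_Ioo hab
    have hd : Disjoint (msupp B g) (msupp B k) :=
      Set.disjoint_left.2 fun z hz hz' => hVU (hk hz') (subset_closure hz)
    have hmono : StrictMono fun x : B => k • x := by
      refine F.strictMono_of_disjoint (U := Set.Iio a) isOpen_Iio (exists_lt a) ?_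
      exact Set.disjoint_left.2 fun z hz hz' => (hk hz).1.asymm hz'
    have hkk := msupp_mul_self hmono
    refine not_commute_of_moves (z := x) (by rwa [hkk]) (f := f) ?_
      (hs k (F.algDisj_of_disjoint hd))
    rw [hkk]
    exact fun h1 => hV x hab (hk h1)
  · intro hs k hk
    refine F.commute_of_disjoint (Disjoint.mono_left hs ?_)
    exact (F.disjoint_of_algDisj hk).closure_left (F.isOpen_msupp _)

/-- `Sub` only controls closures of supports, but this costs nothing: the support of a common lower
bound `k` is open, and disjoint open sets have closures that share no nonempty open set. -/
theorem dj_iff (F : Flexible H B) {f g : H} : Dj f g ↔ Disjoint (msupp B f) (msupp B g) := by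
  constructor
  · intro hd
    rw [Set.disjoint_left]
    intro x hxf hxg
    obtain ⟨k, hxk, hk⟩ :=
      F.exists_moving ((F.isOpen_msupp f).inter (F.isOpen_msupp g)) ⟨hxf, hxg⟩
    have := hd k (F.sub_iff.2 fun z hz => subset_closure (hk hz).1)
      (F.sub_iff.2 fun z hz => subset_closure (hk hz).2)
    rw [mul_eq_left] at this
    exact ne_one_of_mem hxk this
  · intro hd k h1 h2
    rw [F.sub_iff] at h1 h2
    rw [mul_eq_left]
    by_contra hk
    obtain ⟨x, hx⟩ := F.exists_mem_msupp (B := B) hk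
    have h3 := (hd.closure_left (F.isOpen_msupp g))
    obtain ⟨y, hyk, hyg⟩ := mem_closure_iff.1 (h2 hx) _ (F.isOpen_msupp k) hx
    exact Set.disjoint_left.1 h3 (h1 hyk) hyg

theorem not_dj_iff (F : Flexible H B) {f g : H} :
    ¬ Dj f g ↔ ∃ x, x ∈ msupp B f ∧ x ∈ msupp B g := by
  rw [F.dj_iff, Set.not_disjoint_iff]

theorem mul_self_ne {k : H} {x : B} (hx : x ∈ msupp B k) : k * k ≠ k := by
  rw [Ne, mul_eq_left]
  exact ne_one_of_mem hx

theorem exists_mem_of_mul_self_ne (F : Flexible H B) {k : H} (hk : k * k ≠ k) :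
    ∃ x, x ∈ msupp B k := F.exists_mem_msupp (by rwa [Ne, mul_eq_left] at hk)

theorem mem_perp_Id (F : Flexible H B) {U : Set B} (hU : IsOpen U) {k : H} :
    k ∈ Perp (Id H U) ↔ Disjoint (msupp B k) U := by
  constructor
  · intro hk
    rw [Set.disjoint_left]
    intro z hzk hzU
    obtain ⟨a, hza, ha⟩ := F.exists_moving hU hzU
    exact Set.disjoint_left.1 (F.dj_iff.1 (hk a ha)) hzk hza
  · intro hd a ha
    exact F.dj_iff.2 (hd.mono_right ha)

/-- Supports are open, so a support avoiding `(-∞, x)` lies in the interior of `[x, ∞)`. -/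
theorem perp_Id_Iio (F : Flexible H B) (x : B) : Perp (Id H (Set.Iio x)) = Id H (Set.Ioi x) := by
  ext k
  rw [F.mem_perp_Id isOpen_Iio, ← Set.subset_compl_iff_disjoint_right, Set.compl_Iio]
  constructor
  · intro h
    have := interior_maximal h (F.isOpen_msupp k)
    rwa [interior_Ici] at this
  · exact fun h => Set.Subset.trans h Set.Ioi_subset_Ici_self

theorem perp_Id_Ioi (F : Flexible H B) (x : B) : Perp (Id H (Set.Ioi x)) = Id H (Set.Iio x) := by
  ext k
  rw [F.mem_perp_Id isOpen_Ioi, ← Set.subset_compl_iff_disjoint_right, Set.compl_Ioi]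
  constructor
  · intro h
    have := interior_maximal h (F.isOpen_msupp k)
    rwa [interior_Iic] at this
  · exact fun h => Set.Subset.trans h Set.Iio_subset_Iic_self

theorem conv_Id (F : Flexible H B) {U : Set B} (hU : IsOpen U) (hc : U.OrdConnected) :
    Conv (Id H U) := by
  intro k₁ k₂ h1 h2 n1 n2
  obtain ⟨x, hx⟩ := F.exists_mem_of_mul_self_ne (B := B) n1
  obtain ⟨y, hy⟩ := F.exists_mem_of_mul_self_ne (B := B) n2
  obtain ⟨h, hh, hhx⟩ := F.exists_smul_mem hU hc (F.isOpen_msupp k₂) (h1 hx) (h2 hy) hy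
  refine ⟨h, h * k₁ * h⁻¹, hh, by group, F.not_dj_iff.2 ⟨h • x, ?_, hhx⟩⟩
  exact smul_mem_msupp_conj.2 hx

theorem exists_mem_Id (F : Flexible H B) {U : Set B} (hU : IsOpen U) (hne : U.Nonempty) :
    ∃ k, k ∈ Id H U ∧ k * k ≠ k := by
  obtain ⟨x, hx⟩ := hne
  obtain ⟨k, hk, hkU⟩ := F.exists_moving hU hx
  exact ⟨k, hkU, mul_self_ne hk⟩

theorem isRayP_of_rayAt (F : Flexible H B) {x : B} {P : Set H} (h : RayAt x P) : IsRayP P := by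
  rcases h with rfl | rfl
  · refine ⟨?_, F.conv_Id isOpen_Iio Set.ordConnected_Iio, ?_, F.exists_mem_Id isOpen_Iio
      (exists_lt x), ?_⟩ <;> rw [F.perp_Id_Iio]
    · rw [F.perp_Id_Ioi]; exact fun _ => id
    · exact F.conv_Id isOpen_Ioi Set.ordConnected_Ioi
    · exact F.exists_mem_Id isOpen_Ioi (exists_gt x)
  · refine ⟨?_, F.conv_Id isOpen_Ioi Set.ordConnected_Ioi, ?_, F.exists_mem_Id isOpen_Ioi
      (exists_gt x), ?_⟩ <;> rw [F.perp_Id_Ioi]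
    · rw [F.perp_Id_Iio]; exact fun _ => id
    · exact F.conv_Id isOpen_Iio Set.ordConnected_Iio
    · exact F.exists_mem_Id isOpen_Iio (exists_lt x)

theorem subset_perp_perp (F : Flexible H B) (P : Set H) : P ⊆ Perp (Perp P) := by
  intro k hk a ha
  exact F.dj_iff.2 (F.dj_iff.1 (ha k hk)).symm

/-- Elements supported in the support of a member of a regular family belong to the family. -/
theorem mem_of_msupp_subset (F : Flexible H B) {P : Set H} (hP : ∀ k, k ∈ Perp (Perp P) → k ∈ P)
    {k l : H} (hk : k ∈ P) (hl : msupp B l ⊆ msupp B k) : l ∈ P := by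
  refine hP l fun a ha => F.dj_iff.2 ?_
  exact ((F.dj_iff.1 (ha k hk)).symm).mono_left hl

/-- No point moved by an element disjoint from a convex family lies between points moved by
members of the family. -/
theorem not_between (F : Flexible H B) {P : Set H} (hP : ∀ k, k ∈ Perp (Perp P) → k ∈ P)
    (hc : Conv P) {k₁ k₂ l : H} (h1 : k₁ ∈ P) (h2 : k₂ ∈ P) (hl : l ∈ Perp P) {x v y : B}
    (hx : x ∈ msupp B k₁) (hy : y ∈ msupp B k₂) (hv : v ∈ msupp B l) (hxv : x < v)
    (hvy : v < y) : False := by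
  -- The two elements are replaced by ones supported strictly to the left and strictly to the right
  -- of `v`; closure of `P` under double `Perp` keeps them in `P`.
  obtain ⟨k₁', hx', hk₁'⟩ :=
    F.exists_moving ((F.isOpen_msupp k₁).inter (isOpen_Iio (a := v))) ⟨hx, hxv⟩
  obtain ⟨k₂', hy', hk₂'⟩ :=
    F.exists_moving ((F.isOpen_msupp k₂).inter (isOpen_Ioi (a := v))) ⟨hy, hvy⟩
  obtain ⟨h, c, hh, hc, hnd⟩ := hc k₁' k₂'
    (F.mem_of_msupp_subset hP h1 fun z hz => (hk₁' hz).1)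
    (F.mem_of_msupp_subset hP h2 fun z hz => (hk₂' hz).1) (mul_self_ne hx') (mul_self_ne hy')
  rw [eq_conj_of_mul_eq hc] at hnd
  obtain ⟨z, hz1, hz2⟩ := F.not_dj_iff.1 hnd
  -- The conjugator `h` belongs to `P`, so it fixes the open set `supp l` pointwise. Hence it
  -- preserves the order and fixes `v`, and cannot carry anything from the left of `v` to the right.
  have hd : Disjoint (msupp B h) (msupp B l) := (F.dj_iff.1 (hl h hh)).symm
  have hmono := F.strictMono_of_disjoint (F.isOpen_msupp l) ⟨v, hv⟩ hd
  have h3 : h⁻¹ • z < v := (hk₁' (mem_msupp_conj.1 hz1)).2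
  have h4 := hmono h3
  simp only [smul_inv_smul, notMem_msupp.1 (Set.disjoint_right.1 hd hv)] at h4
  exact h4.asymm (hk₂' hz2).2

/-- An element supported in the ray is disjoint from everything in `Perp P`, so double `Perp` puts
it into `P`. -/
theorem eq_Id_of_separated (F : Flexible H B) {P : Set H} (hP : ∀ k, k ∈ Perp (Perp P) → k ∈ P)
    {x : B} (hU : ∀ k ∈ P, msupp B k ⊆ Set.Iio x) (hV : ∀ k ∈ Perp P, msupp B k ⊆ Set.Ioi x) :
    P = Id H (Set.Iio x) := by
  ext k
  refine ⟨hU k, fun hk => hP k fun a ha => F.dj_iff.2 (Set.disjoint_left.2 fun z hz hz' => ?_)⟩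
  exact (show z < x from hk hz).asymm (hV a ha hz')

/-- Two regular families separated by the order are given by the rays at a point. -/
theorem exists_separation (F : Flexible H B) {P Q : Set H} (hneP : ∃ k ∈ P, k * k ≠ k)
    (hneQ : ∃ k ∈ Q, k * k ≠ k)
    (hsep : ∀ k ∈ P, ∀ l ∈ Q, ∀ u ∈ msupp B k, ∀ v ∈ msupp B l, u < v) :
    ∃ x : B, (∀ k ∈ P, msupp B k ⊆ Set.Iio x) ∧ ∀ k ∈ Q, msupp B k ⊆ Set.Ioi x := by
  obtain ⟨k₀, hk₀, n₀⟩ := hneP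
  obtain ⟨l₀, hl₀, m₀⟩ := hneQ
  obtain ⟨u₀, hu₀⟩ := F.exists_mem_of_mul_self_ne (B := B) n₀
  obtain ⟨v₀, hv₀⟩ := F.exists_mem_of_mul_self_ne (B := B) m₀
  obtain ⟨x, hx⟩ := F.complete {u : B | ∃ k ∈ P, u ∈ msupp B k} ⟨u₀, k₀, hk₀, hu₀⟩
    ⟨v₀, fun u ⟨k, hk, hu⟩ => (hsep k hk l₀ hl₀ u hu v₀ hv₀).le⟩
  refine ⟨x, fun k hk => ?_, fun l hl => ?_⟩
  · have : msupp B k ⊆ Set.Iic x := fun u hu => hx.1 ⟨k, hk, hu⟩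
    have := interior_maximal this (F.isOpen_msupp k)
    rwa [interior_Iic] at this
  · have : msupp B l ⊆ Set.Ici x := fun v hv => hx.2 fun u ⟨k, hk, hu⟩ =>
      (hsep k hk l hl u hu v hv).le
    have := interior_maximal this (F.isOpen_msupp l)
    rwa [interior_Ici] at this

/-- By `not_between`, no point moved by `Perp P` separates two points moved by `P`, nor the other
way round. So all points moved by one of the two families lie below all points moved by the other,
and Dedekind completeness supplies the point where they meet. -/
theorem isRayP_iff (F : Flexible H B) {P : Set H} : IsRayP P ↔ ∃ x : B, RayAt x P := by
  refine ⟨?_, fun ⟨x, hx⟩ => F.isRayP_of_rayAt hx⟩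
  rintro ⟨hP, hcP, hcQ, hneP, hneQ⟩
  have hQ : ∀ k, k ∈ Perp (Perp (Perp P)) → k ∈ Perp P := fun k hk a ha =>
    hk a (F.subset_perp_perp P ha)
  have hne : ∀ k ∈ P, ∀ l ∈ Perp P, ∀ u ∈ msupp B k, ∀ v ∈ msupp B l, u ≠ v := by
    rintro k hk l hl u hu v hv rfl
    exact Set.disjoint_left.1 (F.dj_iff.1 (hl k hk)) hv hu
  have nb1 : ∀ k₁ ∈ P, ∀ k₂ ∈ P, ∀ l ∈ Perp P, ∀ x ∈ msupp B k₁, ∀ y ∈ msupp B k₂,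
      ∀ v ∈ msupp B l, x < v → v < y → False := fun k₁ h1 k₂ h2 l hl x hx y hy v hv hxv hvy =>
    F.not_between hP hcP h1 h2 hl hx hy hv hxv hvy
  have nb2 : ∀ k₁ ∈ Perp P, ∀ k₂ ∈ Perp P, ∀ l ∈ P, ∀ x ∈ msupp B k₁, ∀ y ∈ msupp B k₂,
      ∀ v ∈ msupp B l, x < v → v < y → False := fun k₁ h1 k₂ h2 l hl x hx y hy v hv hxv hvy =>
    F.not_between hQ hcQ h1 h2 (F.subset_perp_perp P hl) hx hy hv hxv hvy
  obtain ⟨k₀, hk₀, n₀⟩ := id hneP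
  obtain ⟨l₀, hl₀, m₀⟩ := id hneQ
  obtain ⟨u₀, hu₀⟩ := F.exists_mem_of_mul_self_ne (B := B) n₀
  obtain ⟨v₀, hv₀⟩ := F.exists_mem_of_mul_self_ne (B := B) m₀
  rcases lt_or_gt_of_ne (hne _ hk₀ _ hl₀ _ hu₀ _ hv₀) with h0 | h0
  · have hsep : ∀ k ∈ P, ∀ l ∈ Perp P, ∀ u ∈ msupp B k, ∀ v ∈ msupp B l, u < v := by
      intro k hk l hl u hu v hv
      refine (lt_or_gt_of_ne (hne _ hk _ hl _ hu _ hv)).resolve_right fun hvu => ?_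
      have huv₀ : u < v₀ := (lt_or_gt_of_ne (hne _ hk _ hl₀ _ hu _ hv₀)).resolve_right fun h1 =>
        nb1 _ hk₀ _ hk _ hl₀ _ hu₀ _ hu _ hv₀ h0 h1
      exact nb2 _ hl _ hl₀ _ hk _ hv _ hv₀ _ hu hvu huv₀
    obtain ⟨x, hU, hV⟩ := F.exists_separation hneP hneQ hsep
    exact ⟨x, Or.inl (F.eq_Id_of_separated hP hU hV)⟩
  · have hsep : ∀ l ∈ Perp P, ∀ k ∈ P, ∀ v ∈ msupp B l, ∀ u ∈ msupp B k, v < u := by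
      intro l hl k hk v hv u hu
      refine (lt_or_gt_of_ne (hne _ hk _ hl _ hu _ hv)).resolve_left fun huv => ?_
      have huv₀ : v₀ < u := (lt_or_gt_of_ne (hne _ hk _ hl₀ _ hu _ hv₀)).resolve_left fun h1 =>
        nb1 _ hk _ hk₀ _ hl₀ _ hu _ hu₀ _ hv₀ h1 h0
      exact nb2 _ hl₀ _ hl _ hk _ hv₀ _ hv _ hu huv₀ huv
    obtain ⟨x, hU, hV⟩ := F.exists_separation hneQ hneP hsep
    -- Here `Perp P` is the left ray; `P` is recovered from it as its double `Perp`.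
    have h1 := F.eq_Id_of_separated hQ hU fun k hk => hV k (hP k hk)
    refine ⟨x, Or.inr ?_⟩
    rw [← F.perp_Id_Iio, ← h1]
    exact Set.Subset.antisymm (F.subset_perp_perp P) hP

theorem Id_Iio_subset (F : Flexible H B) {x y : B} :
    Id H (Set.Iio x) ⊆ Id H (Set.Iio y) ↔ x ≤ y := by
  refine ⟨fun h => not_lt.1 fun hyx => ?_, fun h k hk => hk.trans (Set.Iio_subset_Iio h)⟩
  obtain ⟨z, hz, hzx⟩ := exists_between hyx
  obtain ⟨k, hzk, hk⟩ := F.exists_moving isOpen_Iio (show z ∈ Set.Iio x from hzx)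
  exact hz.asymm (h hk hzk)

theorem Id_Ioi_subset (F : Flexible H B) {x y : B} :
    Id H (Set.Ioi x) ⊆ Id H (Set.Ioi y) ↔ y ≤ x := by
  refine ⟨fun h => not_lt.1 fun hyx => ?_, fun h k hk => hk.trans (Set.Ioi_subset_Ioi h)⟩
  obtain ⟨z, hz, hzx⟩ := exists_between hyx
  obtain ⟨k, hzk, hk⟩ := F.exists_moving isOpen_Ioi (show z ∈ Set.Ioi x from hz)
  exact hzx.asymm (h hk hzk)

theorem not_Id_Iio_subset_Id_Ioi (F : Flexible H B) {x y : B} :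
    ¬ Id H (Set.Iio x) ⊆ Id H (Set.Ioi y) := by
  intro h
  obtain ⟨z, hz⟩ := exists_lt (min x y)
  obtain ⟨k, hzk, hk⟩ := F.exists_moving isOpen_Iio
    (show z ∈ Set.Iio x from hz.trans_le (min_le_left _ _))
  exact (hz.trans_le (min_le_right _ _)).asymm (h hk hzk)

theorem not_Id_Ioi_subset_Id_Iio (F : Flexible H B) {x y : B} :
    ¬ Id H (Set.Ioi x) ⊆ Id H (Set.Iio y) := by
  intro h
  obtain ⟨z, hz⟩ := exists_gt (max x y)
  obtain ⟨k, hzk, hk⟩ := F.exists_moving isOpen_Ioi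
    (show z ∈ Set.Ioi x from (le_max_left _ _).trans_lt hz)
  exact ((le_max_right _ _).trans_lt hz).asymm (h hk hzk)

/-- Inclusion of rays of the same kind is the order of their endpoints, while a left and a right ray
are never comparable since the chain has no ends. -/
theorem rayAt_unique (F : Flexible H B) {x y : B} {P : Set H} (hx : RayAt x P)
    (hy : RayAt y P) : x = y := by
  rcases hx with rfl | rfl <;> rcases hy with h | h
  · exact le_antisymm (F.Id_Iio_subset.1 h.le) (F.Id_Iio_subset.1 h.ge)
  · exact absurd h.le F.not_Id_Iio_subset_Id_Ioi
  · exact absurd h.le F.not_Id_Ioi_subset_Id_Iio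
  · exact le_antisymm (F.Id_Ioi_subset.1 h.ge) (F.Id_Ioi_subset.1 h.le)

end Flexible

end NearlyOrdered

/-! ### Endpoints from pairs of elements; direction, equality and action in terms of rays -/

namespace NearlyOrdered

/-- `x` is the supremum or the infimum of the support of some element. -/
def EndPt (H : Type*) {B : Type*} [LinearOrder B] [SMul H B] (x : B) : Prop :=
  ∃ g : H, IsLUB (msupp B g) x ∨ IsGLB (msupp B g) x

/-- The direction from `x` to `y` given by nested rays at these points. -/
def EdP₀ {H : Type*} (A₁ A₂ C₁ C₂ : Set H) : Prop :=
  (A₁ ⊆ A₂ ∧ ¬ A₂ ⊆ A₁) ∧ (C₁ ⊆ C₂ ∧ ¬ C₂ ⊆ C₁) ∧ (A₁ ⊆ C₁ ∨ C₁ ⊆ A₁)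

/-- A property of a ray or of the complementary ray. -/
def EitherP {H : Type*} [Mul H] (Φ : Set H → Prop) (P : Set H) : Prop := Φ P ∨ Φ (Perp P)

/-- The equal direction relation for points given by families of group elements. -/
def EdP {H : Type*} [Mul H] (P₁ P₂ Q₁ Q₂ : Set H) : Prop :=
  EitherP (fun A₁ => EitherP (fun A₂ => EitherP (fun C₁ => EitherP (fun C₂ =>
    EdP₀ A₁ A₂ C₁ C₂) Q₂) Q₁) P₂) P₁

/-- Equality of the points given by families of group elements. -/
def SameP {H : Type*} [Mul H] (P Q : Set H) : Prop :=
  (P ⊆ Q ∧ Q ⊆ P) ∨ (Perp P ⊆ Q ∧ Q ⊆ Perp P)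

/-- The conjugate of a family of group elements. -/
def conjSet {H : Type*} [Mul H] (g : H) (P : Set H) : Set H := {k | ∃ l, l ∈ P ∧ k * g = g * l}

namespace Flexible

variable {H B : Type*} [LinearOrder B] [Group H] [MulAction H B]
  [TopologicalSpace B] [OrderTopology B] [DenselyOrdered B] [NoMinOrder B] [NoMaxOrder B]

/-- An element disjoint from `p` fixes `supp p` pointwise, hence preserves the order and fixes `x`
in the closure of `supp p`, so it maps each of the two rays at `x` to itself. Nothing on the far
side can therefore be brought to meet `w`. Inside `R`, where `supp p` is absent, dense orbits bring
everything to meet `w`. -/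
theorem comp_eq_Id (F : Flexible H B) {p w : H} {x : B} {R R' : Set B}
    (hR : (R = Set.Iio x ∧ R' = Set.Ioi x) ∨ (R = Set.Ioi x ∧ R' = Set.Iio x))
    (hx : x ∈ closure (msupp B p)) (hd : Disjoint (msupp B p) R) (hw : w ∈ Id H R)
    (hw1 : w * w ≠ w) : Comp p w = Id H R := by
  -- The facts needed about the two rays at `x`, collected so that both orientations share one
  -- argument.
  obtain ⟨oR, oR', cR, dR, iR, nR, hfix⟩ : IsOpen R ∧ IsOpen R' ∧ R.OrdConnected ∧
      Disjoint R R' ∧ interior R'ᶜ = R ∧ R.Nonempty ∧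
      ∀ h : H, StrictMono (fun y : B => h • y) → h • x = x → ∀ t ∈ R', h • t ∈ R' := by
    rcases hR with ⟨rfl, rfl⟩ | ⟨rfl, rfl⟩
    · refine ⟨isOpen_Iio, isOpen_Ioi, Set.ordConnected_Iio, ?_, by simp, exists_lt x, ?_⟩
      · exact Set.disjoint_left.2 fun z hz hz' => lt_asymm hz hz'
      · intro h hm hx t ht
        have := hm (show x < t from ht)
        exact show x < h • t by simpa only [hx] using this
    · refine ⟨isOpen_Ioi, isOpen_Iio, Set.ordConnected_Ioi, ?_, by simp, exists_gt x, ?_⟩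
      · exact Set.disjoint_left.2 fun z hz hz' => lt_asymm hz hz'
      · intro h hm hx t ht
        have := hm (show t < x from ht)
        exact show h • t < x by simpa only [hx] using this
  obtain ⟨y, hy⟩ := F.exists_mem_of_mul_self_ne (B := B) hw1
  ext k
  constructor
  · rintro ⟨hkp, hk⟩
    by_contra hkR
    have hne : ¬ Disjoint (msupp B k) R' := fun hc => hkR (by
      have h1 := interior_maximal (Set.subset_compl_iff_disjoint_right.2 hc) (F.isOpen_msupp k)
      rwa [iR] at h1)
    obtain ⟨z, hzk, hzR'⟩ := Set.not_disjoint_iff.1 hne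
    -- A part `k'` of `k` lying in `R'`: membership in `Comp p w` would let an element fixing `x`
    -- carry some of it into `R`.
    obtain ⟨k', hzk', hk'⟩ := F.exists_moving ((F.isOpen_msupp k).inter oR') ⟨hzk, hzR'⟩
    obtain ⟨h, c, hhp, hc, hnd⟩ := hk k' (mul_self_ne hzk')
      (F.sub_iff.2 fun z hz => subset_closure (hk' hz).1)
    rw [eq_conj_of_mul_eq hc] at hnd
    obtain ⟨t, ht, htw⟩ := F.not_dj_iff.1 hnd
    rw [F.dj_iff] at hhp
    have hpne : (msupp B p).Nonempty := closure_nonempty_iff.1 ⟨x, hx⟩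
    have hmono := F.strictMono_of_disjoint (F.isOpen_msupp p) hpne hhp
    have hhx : h • x = x := (F.monotonic h).smul_eq_of_mem_closure
      (fun z hz => notMem_msupp.1 (Set.disjoint_right.1 hhp hz)) hx
    have h1 := hfix h hmono hhx _ (hk' (mem_msupp_conj.1 ht)).2
    rw [smul_inv_smul] at h1
    exact Set.disjoint_left.1 dR (hw htw) h1
  · intro hk
    refine ⟨F.dj_iff.2 ((hd.mono_right hk).symm), fun k' hk' hs => ?_⟩
    obtain ⟨z, hz⟩ := F.exists_mem_of_mul_self_ne (B := B) hk'
    obtain ⟨z', hz'k', hz'k⟩ := mem_closure_iff.1 (F.sub_iff.1 hs hz) _ (F.isOpen_msupp k') hz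
    obtain ⟨h, hh, hhz⟩ := F.exists_smul_mem oR cR (F.isOpen_msupp w) (hk hz'k) (hw hy) hy
    exact ⟨h, h * k' * h⁻¹, F.dj_iff.2 ((hd.mono_right hh).symm), by group,
      F.not_dj_iff.2 ⟨h • z', smul_mem_msupp_conj.2 hz'k', hhz⟩⟩

/-- Every endpoint is given by a component of the exterior of a support. -/
theorem exists_comp_of_endPt (F : Flexible H B) {x : B} (hx : EndPt H x) :
    ∃ p w : H, RayAt x (Comp p w) := by
  obtain ⟨p, hp⟩ := hx
  -- In a chain without ends the empty set has neither a supremum nor an infimum.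
  have hpne : (msupp B p).Nonempty := by
    by_contra hc
    rw [Set.not_nonempty_iff_eq_empty] at hc
    rw [hc] at hp
    rcases hp with hp | hp
    · obtain ⟨y, hy⟩ := exists_lt x
      exact absurd (hp.2 (by simp : y ∈ upperBounds ∅)) (not_le.2 hy)
    · obtain ⟨y, hy⟩ := exists_gt x
      exact absurd (hp.2 (by simp : y ∈ lowerBounds ∅)) (not_le.2 hy)
  rcases hp with hp | hp
  · obtain ⟨w, hw, hw1⟩ := F.exists_mem_Id isOpen_Ioi (exists_gt x)
    refine ⟨p, w, Or.inr (F.comp_eq_Id (Or.inr ⟨rfl, rfl⟩) (hp.mem_closure hpne) ?_ hw hw1)⟩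
    exact Set.disjoint_left.2 fun z hz hz' => (hp.1 hz).not_gt hz'
  · obtain ⟨w, hw, hw1⟩ := F.exists_mem_Id isOpen_Iio (exists_lt x)
    refine ⟨p, w, Or.inl (F.comp_eq_Id (Or.inl ⟨rfl, rfl⟩) (hp.mem_closure hpne) ?_ hw hw1)⟩
    exact Set.disjoint_left.2 fun z hz hz' => (hp.1 hz).not_gt hz'

/-- If `supp p` stayed away from `x`, elements supported near `x` would be disjoint from `p` and
could carry points across `x`. Then `Comp p w` would contain elements supported beyond `x`. -/
theorem mem_closure_of_comp (F : Flexible H B) {p w : H} {x : B} {R R' : Set B}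
    (hR : (R = Set.Iio x ∧ R' = Set.Ioi x) ∨ (R = Set.Ioi x ∧ R' = Set.Iio x))
    (hc : Comp p w = Id H R) : x ∈ closure (msupp B p) ∧ Disjoint (msupp B p) R := by
  obtain ⟨oR, oR', dR, hnb⟩ : IsOpen R ∧ IsOpen R' ∧ Disjoint R R' ∧
      ∀ a b, a < x → x < b → (R ∩ Set.Ioo a b).Nonempty ∧ (R' ∩ Set.Ioo a b).Nonempty := by
    have hnb : ∀ a b, a < x → x < b →
        (Set.Iio x ∩ Set.Ioo a b).Nonempty ∧ (Set.Ioi x ∩ Set.Ioo a b).Nonempty := by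
      intro a b ha hb
      obtain ⟨y, hy1, hy2⟩ := exists_between ha
      obtain ⟨z, hz1, hz2⟩ := exists_between hb
      exact ⟨⟨y, hy2, hy1, hy2.trans hb⟩, ⟨z, hz1, ha.trans hz1, hz2⟩⟩
    rcases hR with ⟨rfl, rfl⟩ | ⟨rfl, rfl⟩
    · exact ⟨isOpen_Iio, isOpen_Ioi, Set.disjoint_left.2 fun z hz hz' => lt_asymm hz hz', hnb⟩
    · exact ⟨isOpen_Ioi, isOpen_Iio, Set.disjoint_left.2 fun z hz hz' => lt_asymm hz hz',
        fun a b ha hb => (hnb a b ha hb).symm⟩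
  have hdisj : Disjoint (msupp B p) R := by
    rw [Set.disjoint_left]
    intro z hzp hzR
    obtain ⟨k, hzk, hk⟩ := F.exists_moving oR hzR
    have : k ∈ Comp p w := hc ▸ hk
    exact Set.disjoint_left.1 (F.dj_iff.1 this.1) hzk hzp
  refine ⟨?_, hdisj⟩
  by_contra hx
  obtain ⟨a, b, ha, hb, hs⟩ := exists_Ioo_of_isOpen isClosed_closure.isOpen_compl hx
  have hdab : Disjoint (msupp B p) (Set.Ioo a b) :=
    Set.disjoint_left.2 fun z hz hz' => hs hz' (subset_closure hz)
  obtain ⟨⟨y, hyR, hyab⟩, ⟨z, hzR', hzab⟩⟩ := hnb a b ha hb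
  -- an element supported in `(a, b) ∩ R'` belongs to the family, a contradiction
  obtain ⟨k, hzk, hk⟩ := F.exists_moving (oR'.inter isOpen_Ioo) (show z ∈ R' ∩ Set.Ioo a b from
    ⟨hzR', hzab⟩)
  suffices h : k ∈ Comp p w by
    rw [hc] at h
    exact Set.disjoint_left.1 dR (h hzk) hzR'
  refine ⟨F.dj_iff.2 (hdab.mono_right fun t ht => (hk ht).2).symm, fun k' hk' hs' => ?_⟩
  obtain ⟨t, ht⟩ := F.exists_mem_of_mul_self_ne (B := B) hk'
  obtain ⟨t', ht'k', ht'k⟩ := mem_closure_iff.1 (F.sub_iff.1 hs' ht) _ (F.isOpen_msupp k') ht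
  -- The journey of `k'` to `w` has two stages: a local element `h₁` crosses `x` within `(a, b)`,
  -- and `h₂`, borrowed from an element `k₂` of the family near `x`, goes on to `supp w`.
  obtain ⟨k₂, hyk₂, hk₂⟩ := F.exists_moving (oR.inter isOpen_Ioo) (show y ∈ R ∩ Set.Ioo a b from
    ⟨hyR, hyab⟩)
  have hk₂c : k₂ ∈ Comp p w := hc ▸ (fun t ht => (hk₂ ht).1 : msupp B k₂ ⊆ R)
  obtain ⟨h₂, c, hh₂, hc₂, hnd⟩ := hk₂c.2 k₂ (mul_self_ne hyk₂)
    (F.sub_iff.2 subset_closure)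
  rw [eq_conj_of_mul_eq hc₂] at hnd
  obtain ⟨s, hs1, hs2⟩ := F.not_dj_iff.1 hnd
  rw [mem_msupp_conj] at hs1
  have hopen : IsOpen ((fun x : B => h₂ • x) ⁻¹' msupp B w) :=
    (F.isOpen_msupp w).preimage (F.monotonic h₂).continuous_smul
  obtain ⟨h₁, hh₁, hh₁t⟩ := F.exists_smul_mem (isOpen_Ioo (a := a) (b := b))
    Set.ordConnected_Ioo hopen (hk ht'k).2 (hk₂ hs1).2 (by simpa using hs2)
  refine ⟨h₂ * h₁, h₂ * h₁ * k' * (h₂ * h₁)⁻¹, F.dj_iff.2 ?_, by group,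
    F.not_dj_iff.2 ⟨(h₂ * h₁) • t', smul_mem_msupp_conj.2 ht'k', by simpa [mul_smul] using hh₁t⟩⟩
  refine Set.disjoint_left.2 fun q hq hqp => ?_
  rcases msupp_mul _ _ hq with hq | hq
  · exact Set.disjoint_left.1 (F.dj_iff.1 hh₂) hq hqp
  · exact Set.disjoint_right.1 hdab (hh₁ hq) hqp

theorem endPt_of_rayAt_comp (F : Flexible H B) {p w : H} {x : B} (h : RayAt x (Comp p w)) :
    EndPt H x := by
  refine ⟨p, ?_⟩
  rcases h with h | h
  · obtain ⟨h1, h2⟩ := F.mem_closure_of_comp (Or.inl ⟨rfl, rfl⟩) h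
    exact Or.inr (isGLB_of_mem_closure
      (fun z hz => not_lt.1 fun hc => Set.disjoint_left.1 h2 hz hc) h1)
  · obtain ⟨h1, h2⟩ := F.mem_closure_of_comp (Or.inr ⟨rfl, rfl⟩) h
    exact Or.inl (isLUB_of_mem_closure
      (fun z hz => not_lt.1 fun hc => Set.disjoint_left.1 h2 hz hc) h1)

theorem rayAt_perp (F : Flexible H B) {x : B} {P : Set H} (h : RayAt x P) :
    RayAt x (Perp P) := by
  rcases h with rfl | rfl
  · rw [F.perp_Id_Iio]; exact Or.inr rfl
  · rw [F.perp_Id_Ioi]; exact Or.inl rfl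

theorem eitherP_iff (F : Flexible H B) {x : B} {P : Set H} (h : RayAt x P) (Φ : Set H → Prop) :
    EitherP Φ P ↔ Φ (Id H (Set.Iio x)) ∨ Φ (Id H (Set.Ioi x)) := by
  rcases h with rfl | rfl
  · rw [EitherP, F.perp_Id_Iio]
  · rw [EitherP, F.perp_Id_Ioi, or_comm]

/-- Left and right rays are never comparable, so the inclusions force all four chosen rays to be of
the same kind. Choosing left rays everywhere gives one alternative of `Ed`, choosing right rays
everywhere the other. -/
theorem edP_iff (F : Flexible H B) {x₁ x₂ y₁ y₂ : B} {P₁ P₂ Q₁ Q₂ : Set H} (h1 : RayAt x₁ P₁)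
    (h2 : RayAt x₂ P₂) (h3 : RayAt y₁ Q₁) (h4 : RayAt y₂ Q₂) :
    EdP P₁ P₂ Q₁ Q₂ ↔ Ed x₁ x₂ y₁ y₂ := by
  simp only [EdP, F.eitherP_iff h1, F.eitherP_iff h2, F.eitherP_iff h3, F.eitherP_iff h4, EdP₀,
    F.Id_Iio_subset, F.Id_Ioi_subset, F.not_Id_Iio_subset_Id_Ioi, F.not_Id_Ioi_subset_Id_Iio,
    Ed]
  -- Rays of the same kind are always comparable, so the last clause of `EdP₀` disappears.
  have t1 := le_total x₁ y₁
  simp only [not_le, false_and, and_false, or_false, false_or, not_false_eq_true, and_true,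
    or_self, t1, t1.symm]
  constructor
  · rintro (⟨⟨-, h⟩, ⟨-, h'⟩⟩ | ⟨⟨-, h⟩, ⟨-, h'⟩⟩)
    · exact Or.inl ⟨h, h'⟩
    · exact Or.inr ⟨h, h'⟩
  · rintro (⟨h, h'⟩ | ⟨h, h'⟩)
    · exact Or.inl ⟨⟨h.le, h⟩, ⟨h'.le, h'⟩⟩
    · exact Or.inr ⟨⟨h.le, h⟩, ⟨h'.le, h'⟩⟩

theorem sameP_iff (F : Flexible H B) {x y : B} {P Q : Set H} (hx : RayAt x P) (hy : RayAt y Q) :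
    SameP P Q ↔ x = y := by
  constructor
  · rintro (h | h)
    · exact F.rayAt_unique hx (Set.Subset.antisymm h.1 h.2 ▸ hy)
    · exact F.rayAt_unique (F.rayAt_perp hx) (Set.Subset.antisymm h.1 h.2 ▸ hy)
  · rintro rfl
    rcases hx with rfl | rfl <;> rcases hy with rfl | rfl <;> simp [SameP, F.perp_Id_Iio,
      F.perp_Id_Ioi]

theorem conjSet_Id (g : H) (U : Set B) :
    conjSet g (Id H U) = Id H ((fun x : B => g⁻¹ • x) ⁻¹' U) := by
  ext k
  constructor
  · rintro ⟨l, hl, e⟩ z hz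
    rw [eq_conj_of_mul_eq e, mem_msupp_conj] at hz
    exact hl hz
  · intro hk
    refine ⟨g⁻¹ * k * g, fun z hz => ?_, by group⟩
    have : g • z ∈ msupp B k := by
      rw [← smul_mem_msupp_conj (g := g)] at hz
      simpa [mul_assoc] using hz
    simpa using hk this

theorem rayAt_conjSet (F : Flexible H B) (g : H) {x : B} {P : Set H} (h : RayAt x P) :
    RayAt (g • x) (conjSet g P) := by
  rcases F.monotonic g⁻¹ with hm | hm <;> rcases h with rfl | rfl <;> rw [conjSet_Id]
  · left; congr 1; ext z
    rw [Set.mem_preimage, Set.mem_Iio, Set.mem_Iio, ← hm.lt_iff_lt (b := g • x), inv_smul_smul]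
  · right; congr 1; ext z
    rw [Set.mem_preimage, Set.mem_Ioi, Set.mem_Ioi, ← hm.lt_iff_lt (a := g • x), inv_smul_smul]
  · right; congr 1; ext z
    rw [Set.mem_preimage, Set.mem_Iio, Set.mem_Ioi, ← hm.lt_iff_gt (b := g • x), inv_smul_smul]
  · left; congr 1; ext z
    rw [Set.mem_preimage, Set.mem_Ioi, Set.mem_Iio, ← hm.lt_iff_gt (a := g • x), inv_smul_smul]

end Flexible

end NearlyOrdered

/-! ### Monotonic maps, and reconstruction of a flexible action up to a monotonic bijection -/

namespace NearlyOrdered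

section Monotonic

variable {α β : Type*} [LinearOrder α] [LinearOrder β]

theorem isMonotonic_of_ed {f : α → β} (hf : ∀ x₁ x₂ y₁ y₂, Ed x₁ x₂ y₁ y₂ →
    Ed (f x₁) (f x₂) (f y₁) (f y₂)) : IsMonotonic f := by
  by_cases h : ∃ a b : α, a < b
  · obtain ⟨a, b, hab⟩ := h
    have key : ∀ x y, x < y → Ed (f x) (f y) (f a) (f b) :=
      fun x y hxy => hf x y a b (Or.inl ⟨hxy, hab⟩)
    rcases key a b hab with h1 | h1
    · left
      intro x y hxy
      rcases key x y hxy with h2 | h2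
      · exact h2.1
      · exact absurd h2.2 h1.1.asymm
    · right
      intro x y hxy
      rcases key x y hxy with h2 | h2
      · exact absurd h2.2 h1.1.asymm
      · exact h2.1
  · left
    intro x y hxy
    exact absurd ⟨x, y, hxy⟩ h

theorem IsMonotonic.ed_iff {f : α → β} (hf : IsMonotonic f) (x₁ x₂ y₁ y₂ : α) :
    Ed (f x₁) (f x₂) (f y₁) (f y₂) ↔ Ed x₁ x₂ y₁ y₂ := by
  rcases hf with hf | hf
  · simp only [Ed, hf.lt_iff_lt]
  · simp only [Ed, hf.lt_iff_gt]
    exact or_comm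

theorem isEdIso_iff {f : α ≃ β} : IsEdIso f ↔ IsMonotonic f :=
  ⟨fun h => isMonotonic_of_ed fun _ _ _ _ => (h _ _ _ _).2, fun h => h.ed_iff⟩

theorem mem_edAut_iff {f : Equiv.Perm α} : f ∈ edAut α ↔ IsMonotonic f := isEdIso_iff (f := f)

theorem IsMonotonic.comp {γ : Type*} [LinearOrder γ] {g : β → γ} {f : α → β}
    (hg : IsMonotonic g) (hf : IsMonotonic f) : IsMonotonic (g ∘ f) := by
  rcases hg with hg | hg <;> rcases hf with hf | hf
  · exact Or.inl (hg.comp hf)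
  · exact Or.inr (hg.comp_strictAnti hf)
  · exact Or.inr (hg.comp_strictMono hf)
  · exact Or.inl (hg.comp hf)

theorem StrictMono.equiv_symm {f : α ≃ β} (hf : StrictMono f) : StrictMono f.symm := by
  intro x y hxy
  rw [← hf.lt_iff_lt]
  simpa

theorem StrictAnti.equiv_symm {f : α ≃ β} (hf : StrictAnti f) : StrictAnti f.symm := by
  intro x y hxy
  rw [← hf.lt_iff_gt]
  simpa

theorem IsMonotonic.symm {f : α ≃ β} (hf : IsMonotonic f) : IsMonotonic f.symm :=
  hf.imp StrictMono.equiv_symm StrictAnti.equiv_symm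

theorem IsMonotonic.continuous_equiv [TopologicalSpace α] [OrderTopology α] [DenselyOrdered β]
    [TopologicalSpace β] [OrderTopology β] {f : α ≃ β} (hf : IsMonotonic f) : Continuous f := by
  rcases hf with hm | hm
  · exact hm.monotone.continuous_of_surjective f.surjective
  · have : Continuous (OrderDual.toDual ∘ f) :=
      Monotone.continuous_of_surjective (β := βᵒᵈ) (fun x y hxy => hm.antitone hxy) f.surjective
    exact continuous_ofDual.comp this

end Monotonic

namespace Flexible

section Reconstruction

variable {H B B' : Type*} [Group H] [LinearOrder B] [MulAction H B]
  [TopologicalSpace B] [OrderTopology B] [DenselyOrdered B] [NoMinOrder B] [NoMaxOrder B]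
  [LinearOrder B'] [MulAction H B']
  [TopologicalSpace B'] [OrderTopology B'] [DenselyOrdered B'] [NoMinOrder B'] [NoMaxOrder B']

/-- `IsRayP` speaks about the group only, so a ray family for one action is a ray family for the
other. -/
theorem exists_rayAt (F : Flexible H B) (F' : Flexible H B') :
    ∃ f : B → B', ∀ (x : B) (P : Set H), RayAt x P → RayAt (f x) P := by
  have key : ∀ x : B, ∃ y : B', RayAt y (Id H (Set.Iio x)) := fun x =>
    F'.isRayP_iff.1 (F.isRayP_of_rayAt (x := x) (Or.inl rfl))
  choose f hf using key
  refine ⟨f, fun x P hP => ?_⟩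
  rcases hP with rfl | rfl
  · exact hf x
  · rw [← F.perp_Id_Iio]
    exact F'.rayAt_perp (hf x)

/-- Two flexible actions of a group are equivalent by a monotonic bijection. -/
theorem exists_equivariant (F : Flexible H B) (F' : Flexible H B') :
    ∃ τ : B ≃ B', IsMonotonic τ ∧ ∀ (h : H) (x : B), τ (h • x) = h • τ x := by
  obtain ⟨f, hf⟩ := F.exists_rayAt F'
  obtain ⟨g, hg⟩ := F'.exists_rayAt F
  have hr : ∀ x : B, RayAt (H := H) x (Id H (Set.Iio x)) := fun x => Or.inl rfl
  have hr' : ∀ x : B', RayAt (H := H) x (Id H (Set.Iio x)) := fun x => Or.inl rfl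
  let τ : B ≃ B' :=
    { toFun := f
      invFun := g
      left_inv := fun x => F.rayAt_unique (hg _ _ (hf x _ (hr x))) (hr x)
      right_inv := fun y => F'.rayAt_unique (hf _ _ (hg y _ (hr' y))) (hr' y) }
  refine ⟨τ, isMonotonic_of_ed fun x₁ x₂ y₁ y₂ h => ?_, fun h x => ?_⟩
  · rw [← F.edP_iff (hr x₁) (hr x₂) (hr y₁) (hr y₂)] at h
    exact (F'.edP_iff (hf _ _ (hr x₁)) (hf _ _ (hr x₂)) (hf _ _ (hr y₁)) (hf _ _ (hr y₂))).1 h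
  · exact F'.rayAt_unique (hf _ _ (F.rayAt_conjSet h (hr x)))
      (F'.rayAt_conjSet h (hf _ _ (hr x)))

/-- A map commuting with a flexible action is the identity, even on an invariant subset. -/
theorem eq_of_stabilizer (F : Flexible H B) {x y : B}
    (hxy : ∀ h : H, h • x = x → h • y = y) : y = x := by
  by_contra hne
  obtain ⟨h, hy, hh⟩ := F.exists_moving (isOpen_compl_singleton (x := x)) (show y ∈ _ from hne)
  refine hy (hxy h (notMem_msupp.1 fun hx => hh hx rfl))

end Reconstruction

theorem comp_mulEquiv {H H' B : Type*} [Group H] [Group H'] [LinearOrder B] [MulAction H B]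
    (F : Flexible H B) (α : H' ≃* H) :
    @Flexible H' B _ _ (MulAction.compHom B α.toMonoidHom) := by
  let := MulAction.compHom B α.toMonoidHom
  refine ⟨F.complete, fun h => F.monotonic (α h), fun h hh => ?_, fun a x y b ha hx hy => ?_⟩
  · have := F.faithful (α h) hh
    simpa using this
  · obtain ⟨h, h1, h2⟩ := F.moves a x y b ha hx hy
    refine ⟨α.symm h, fun z hz => ?_, ?_⟩
    · change α (α.symm h) • z = z
      simpa using h1 z hz
    · change y < α (α.symm h) • x
      simpa using h2

section Isomorphism

variable {H H' B B' : Type*} [Group H] [Group H'] [LinearOrder B] [MulAction H B]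
  [TopologicalSpace B] [OrderTopology B] [DenselyOrdered B] [NoMinOrder B] [NoMaxOrder B]
  [LinearOrder B'] [MulAction H' B']
  [TopologicalSpace B'] [OrderTopology B'] [DenselyOrdered B'] [NoMinOrder B'] [NoMaxOrder B']

/-- Isomorphisms between flexible groups are induced by monotonic bijections. -/
theorem exists_inducing (F : Flexible H B) (F' : Flexible H' B') (α : H ≃* H') :
    ∃ τ : B ≃ B', IsMonotonic τ ∧ ∀ (h : H) (x : B), τ (h • x) = α h • τ x := by
  let := MulAction.compHom B' α.toMonoidHom
  exact F.exists_equivariant (F'.comp_mulEquiv α)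

/-- The point `σ⁻¹ (τ x)` is fixed by the whole stabilizer of `x`, so it is `x`. -/
theorem inducing_unique (F : Flexible H B) (α : H ≃* H') {τ σ : B ≃ B'}
    (hτ : ∀ (h : H) (x : B), τ (h • x) = α h • τ x)
    (hσ : ∀ (h : H) (x : B), σ (h • x) = α h • σ x) : τ = σ := by
  ext x
  have : σ.symm (τ x) = x := by
    refine F.eq_of_stabilizer fun h hx => ?_
    rw [← σ.apply_eq_iff_eq, hσ, σ.apply_symm_apply, ← hτ, hx]
  rw [← this, σ.apply_symm_apply, this]

end Isomorphism

end Flexible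

end NearlyOrdered

/-! ### The completion, and the action extended to it -/

namespace NearlyOrdered

section CompletionFacts

variable {L : Type u} [LinearOrder L]

/-- The supremum is taken in the complete lattice of all cuts; a member of the set and an upper
bound keep it away from the two improper cuts. -/
theorem dedekindComplete_completion : DedekindComplete (Completion L) := by
  intro S ⟨c, hc⟩ ⟨d, hd⟩
  have hle : sSup (Subtype.val '' S) ≤ d.1 := sSup_le fun x ⟨y, hy, e⟩ => e ▸ hd hy
  have hge : c.1 ≤ sSup (Subtype.val '' S) := le_sSup ⟨c, hc, rfl⟩
  refine ⟨⟨sSup (Subtype.val '' S), ?_, ?_⟩, ?_, ?_⟩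
  · intro h
    rw [h, le_bot_iff] at hge
    exact c.2.1 hge
  · intro h
    rw [h, top_le_iff] at hle
    exact d.2.2 hle
  · intro x hx
    exact le_sSup (s := Subtype.val '' S) ⟨x, hx, rfl⟩
  · intro x hx
    exact sSup_le (s := Subtype.val '' S) fun y ⟨z, hz, e⟩ => e ▸ hx hz

variable [NoMinOrder L] [NoMaxOrder L]

theorem toCompletion_strictMono : StrictMono (toCompletion (L := L)) := by
  intro a b hab
  exact DedekindCut.principal_lt_principal.2 hab

theorem exists_toCompletion_le (c : Completion L) : ∃ a : L, toCompletion a ≤ c := by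
  by_contra hc
  push Not at hc
  refine c.2.1 (le_bot_iff.1 ?_)
  rw [← Concept.extent_subset_extent_iff]
  intro a ha
  exact absurd (DedekindCut.principal_le_iff.2 ha) (not_le.2 (hc a))

theorem exists_le_toCompletion (c : Completion L) : ∃ a : L, c ≤ toCompletion a := by
  by_contra hc
  push Not at hc
  refine c.2.2 (top_le_iff.1 ?_)
  rw [← Concept.intent_subset_intent_iff]
  intro a ha
  exact absurd (DedekindCut.le_principal_iff.2 ha) (not_le.2 (hc a))

instance : NoMinOrder (Completion L) := ⟨fun c => by
  obtain ⟨a, ha⟩ := exists_toCompletion_le c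
  obtain ⟨b, hb⟩ := exists_lt a
  exact ⟨toCompletion b, (toCompletion_strictMono hb).trans_le ha⟩⟩

instance : NoMaxOrder (Completion L) := ⟨fun c => by
  obtain ⟨a, ha⟩ := exists_le_toCompletion c
  obtain ⟨b, hb⟩ := exists_gt a
  exact ⟨toCompletion b, ha.trans_lt (toCompletion_strictMono hb)⟩⟩

/-- The left sets of two distinct cuts give elements `r < a` of the chain lying weakly between them;
a third element between `r` and `a` makes both inequalities strict. -/
theorem exists_toCompletion_between [DenselyOrdered L] {c d : Completion L} (h : c < d) :
    ∃ a : L, c < toCompletion a ∧ toCompletion a < d := by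
  have h1 : ¬ d.1 ≤ c.1 := not_le.2 h
  rw [← Concept.extent_subset_extent_iff, Set.not_subset] at h1
  obtain ⟨a, had, hac⟩ := h1
  have h2 : ¬ ∀ r ∈ c.1.right, a ≤ r := fun hc => hac ((mem_left_iff c.1 a).2 hc)
  push Not at h2
  obtain ⟨r, hr, hra⟩ := h2
  obtain ⟨b, hrb, hba⟩ := exists_between hra
  have h3 : c ≤ toCompletion r := DedekindCut.le_principal_iff.2 hr
  have h4 : toCompletion a ≤ d := DedekindCut.principal_le_iff.2 had
  exact ⟨b, h3.trans_lt (toCompletion_strictMono hrb), (toCompletion_strictMono hba).trans_le h4⟩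

instance [DenselyOrdered L] : DenselyOrdered (Completion L) := ⟨fun _ _ h => by
  obtain ⟨a, h1, h2⟩ := exists_toCompletion_between h
  exact ⟨_, h1, h2⟩⟩

theorem isMonotonic_smul (g : edAut L) : IsMonotonic fun x : Completion L => g • x := by
  have hinj : Function.Injective fun x : Completion L => g • x := MulAction.injective g
  by_cases hg : StrictMono (g : Equiv.Perm L)
  · left
    exact Monotone.strictMono_of_injective (fun c d h => cutMap_mono g hg h) hinj
  · right
    exact Antitone.strictAnti_of_injective (fun c d h => cutMap_anti g hg h) hinj

theorem strictMono_smul_iff [Nontrivial L] {g : edAut L} :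
    (StrictMono fun x : Completion L => g • x) ↔ StrictMono (g : Equiv.Perm L) := by
  constructor
  · intro h a b hab
    have := h (toCompletion_strictMono hab)
    simp only [smul_toCompletion] at this
    exact toCompletion_strictMono.lt_iff_lt.1 this
  · intro hg
    refine (isMonotonic_smul g).resolve_right fun h => ?_
    obtain ⟨a, b, hab⟩ := exists_pair_lt L
    have := h (toCompletion_strictMono hab)
    simp only [smul_toCompletion] at this
    exact (toCompletion_strictMono (hg hab)).asymm this

end CompletionFacts

section PermGroupFacts

namespace PermGroup

variable (X : PermGroup.{u})

theorem smul_toCompletion (g : X.G) (a : X.L) :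
    g • toCompletion a = (toCompletion (g • a) : X.bar) :=
  NearlyOrdered.smul_toCompletion (g : edAut X.L) a

theorem isMonotonic_smul (g : X.G) : IsMonotonic fun x : X.bar => g • x :=
  NearlyOrdered.isMonotonic_smul (g : edAut X.L)

theorem mem_opp_iff {g : X.G} : g ∈ X.opp ↔ StrictMono fun x : X.bar => g • x :=
  (strictMono_smul_iff (g := (g : edAut X.L))).symm

theorem faithful {g : X.G} (h : ∀ x : X.bar, g • x = x) : g = 1 := by
  refine Subtype.ext (Subtype.ext (Equiv.ext fun a => ?_))
  have := h (toCompletion a)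
  rw [X.smul_toCompletion] at this
  exact toCompletion_strictMono.injective this

theorem exists_mem_of_isOpen {U : Set X.bar} (hU : IsOpen U) (hne : U.Nonempty) :
    ∃ a : X.L, toCompletion a ∈ U := by
  obtain ⟨x, hx⟩ := hne
  obtain ⟨c, d, hc, hd, hs⟩ := exists_Ioo_of_isOpen hU hx
  obtain ⟨a, h1, h2⟩ := exists_toCompletion_between (hc.trans hd)
  exact ⟨a, hs ⟨h1, h2⟩⟩

/-- Closed conditions hold in the completion if they hold in the chain. -/
theorem forall_bar_of_isClosed {p : X.bar → Prop} (hp : IsClosed {x | p x})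
    (h : ∀ a : X.L, p (toCompletion a)) (x : X.bar) : p x := by
  by_contra hx
  obtain ⟨a, ha⟩ := X.exists_mem_of_isOpen hp.isOpen_compl ⟨x, hx⟩
  exact ha (h a)

theorem continuous_smul (g : X.G) : Continuous fun x : X.bar => g • x :=
  (X.isMonotonic_smul g).continuous_smul

theorem ptLE_iff {f g : X.G} : X.PtLE f g ↔ ∀ x : X.bar, f • x ≤ g • x := by
  constructor
  · intro h
    refine X.forall_bar_of_isClosed (isClosed_le (X.continuous_smul f) (X.continuous_smul g)) ?_
    intro a
    rw [X.smul_toCompletion, X.smul_toCompletion]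
    exact toCompletion_strictMono.monotone (h a)
  · intro h a
    have := h (toCompletion a)
    rw [X.smul_toCompletion, X.smul_toCompletion] at this
    exact toCompletion_strictMono.le_iff_le.1 this

theorem supp_eq (g : X.G) : X.supp g = msupp X.bar g := rfl

/-- The elements moving points of a given open interval of the completion only. -/
theorem LocallyMoving.exists_ne_one {X : PermGroup.{u}} (h : X.LocallyMoving) {a b : X.bar}
    (hab : a < b) : ∃ g : X.G, g ≠ 1 ∧ msupp X.bar g ⊆ Set.Ioo a b := by
  obtain ⟨c, h1, h2⟩ := exists_toCompletion_between hab
  obtain ⟨d, h3, h4⟩ := exists_toCompletion_between h2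
  -- The interval is taken with closure inside `(a, b)`. Points of the completion moved outside `[c,
  -- d]` would form a nonempty open set, hence include a point of the chain, contradicting the
  -- choice of `g`.
  obtain ⟨g, hg, hfix⟩ := h (Set.Ioo c d)
    (Or.inl ⟨c, d, toCompletion_strictMono.lt_iff_lt.1 h3, rfl⟩)
  refine ⟨g, hg, fun x hx => ?_⟩
  by_contra hc
  have hopen : IsOpen (msupp X.bar g ∩ (Set.Icc (toCompletion c) (toCompletion d))ᶜ) :=
    (X.isMonotonic_smul g).isOpen_msupp.inter isClosed_Icc.isOpen_compl
  obtain ⟨e, he1, he2⟩ := X.exists_mem_of_isOpen hopen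
    ⟨x, hx, fun hx' => hc ⟨h1.trans_le hx'.1, hx'.2.trans_lt h4⟩⟩
  refine he1 ?_
  rw [X.smul_toCompletion, hfix e]
  exact fun he => he2 ⟨toCompletion_strictMono.monotone he.1.le,
    toCompletion_strictMono.monotone he.2.le⟩

end PermGroup

end PermGroupFacts

end NearlyOrdered

namespace NearlyOrdered

/-! ### Span-transitive groups have a flexible derived group of bounded elements -/

section FixedBounds

variable {H B : Type*} [LinearOrder B] [Group H] [MulAction H B]

theorem StrictMono.inv_smul {k : H} (hk : StrictMono fun x : B => k • x) :
    StrictMono fun x : B => k⁻¹ • x := by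
  intro x y hxy
  rw [← hk.lt_iff_lt]
  simpa using hxy

/-- An order preserving map fixes the supremum of a set invariant under it and its inverse. This is
the source of most contradictions below. -/
theorem smul_eq_of_isLUB {k : H} (hk : StrictMono fun x : B => k • x) {S : Set B} {s : B}
    (hs : IsLUB S s) (h1 : ∀ y ∈ S, k • y ∈ S) (h2 : ∀ y ∈ S, k⁻¹ • y ∈ S) : k • s = s := by
  refine le_antisymm ?_ (hs.2 fun y hy => ?_)
  · have : s ≤ k⁻¹ • s := hs.2 fun y hy => by
      have := (StrictMono.inv_smul hk).monotone (hs.1 (h1 y hy))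
      simpa using this
    simpa using hk.monotone this
  · simpa using hk.monotone (hs.1 (h2 y hy))

theorem smul_eq_of_isGLB {k : H} (hk : StrictMono fun x : B => k • x) {S : Set B} {s : B}
    (hs : IsGLB S s) (h1 : ∀ y ∈ S, k • y ∈ S) (h2 : ∀ y ∈ S, k⁻¹ • y ∈ S) : k • s = s := by
  refine le_antisymm (hs.2 fun y hy => ?_) ?_
  · simpa using hk.monotone (hs.1 (h2 y hy))
  · have : k⁻¹ • s ≤ s := hs.2 fun y hy => by
      have := (StrictMono.inv_smul hk).monotone (hs.1 (h1 y hy))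
      simpa using this
    simpa using hk.monotone this

theorem DedekindComplete.exists_isGLB (hB : DedekindComplete B) {S : Set B} (hS : S.Nonempty)
    (hb : BddBelow S) : ∃ x, IsGLB S x := by
  obtain ⟨x, hx⟩ := hB (lowerBounds S) hb (hS.mono fun y hy z hz => hz hy)
  exact ⟨x, isLUB_lowerBounds.1 hx⟩

end FixedBounds

namespace PermGroup

variable {X : PermGroup.{u}}

theorem strictMono_inv_mul {r g : X.G} (hr : StrictAnti fun x : X.bar => r • x)
    (hg : StrictAnti fun x : X.bar => g • x) : StrictMono fun x : X.bar => (r⁻¹ * g) • x := by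
  intro x y hxy
  rw [← hr.lt_iff_gt]
  simpa [mul_smul] using hg hxy

/-- If all order preserving elements fixed `e`, the orbit of `e` would have at most two points,
because any two reversing elements differ by a preserving one. An interval `I` above both points and
an interval `J ⊇ I` containing both refute span-transitivity. -/
theorem SpanTransitive.exists_smul_ne (hS : X.SpanTransitive) (e : X.bar) :
    ∃ g : X.G, (StrictMono fun x : X.bar => g • x) ∧ g • e ≠ e := by
  by_contra hc
  push Not at hc
  obtain ⟨e', he'⟩ : ∃ e' : X.bar, ∀ g : X.G, g • e = e ∨ g • e = e' := by
    by_cases hr : ∃ r : X.G, StrictAnti fun x : X.bar => r • x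
    · obtain ⟨r, hr⟩ := hr
      refine ⟨r • e, fun g => ?_⟩
      rcases X.isMonotonic_smul g with hg | hg
      · exact Or.inl (hc g hg)
      · right
        have := hc _ (strictMono_inv_mul hr hg)
        rwa [mul_smul, inv_smul_eq_iff] at this
    · push Not at hr
      exact ⟨e, fun g => Or.inl (hc g ((X.isMonotonic_smul g).resolve_right (hr g)))⟩
  obtain ⟨i, hi⟩ := exists_gt (max e e')
  obtain ⟨j, hj⟩ := exists_lt (min e e')
  obtain ⟨b, hb⟩ := exists_gt e
  obtain ⟨he1, he2⟩ := max_lt_iff.1 hi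
  obtain ⟨he3, he4⟩ := lt_min_iff.1 hj
  obtain ⟨g, ⟨h1, -⟩ | ⟨-, h2⟩⟩ := hS e b hb.ne (Set.Ioo (max e e') i) (Set.Ioo j i)
    ⟨_, _, hi, rfl⟩ ⟨_, _, he3.trans he1, rfl⟩
    (Set.Ioo_subset_Ioo_left (he3.le.trans (le_max_left _ _)))
  · rcases he' g with h | h
    · rw [h] at h1; exact (le_max_left e e').not_gt h1.1
    · rw [h] at h1; exact (le_max_right e e').not_gt h1.1
  · rcases he' g with h | h
    · rw [h] at h2; exact h2 ⟨he3, he1⟩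
    · rw [h] at h2; exact h2 ⟨he4, he2⟩

/-- Otherwise the orbit of `c` under the order preserving elements would have a supremum, fixed by
all of them. -/
theorem SpanTransitive.exists_lt_smul (hS : X.SpanTransitive) (c d : X.bar) :
    ∃ g : X.G, (StrictMono fun x : X.bar => g • x) ∧ d < g • c := by
  by_contra hc
  push Not at hc
  obtain ⟨s, hs⟩ := dedekindComplete_completion
    {y : X.bar | ∃ g : X.G, (StrictMono fun x : X.bar => g • x) ∧ y = g • c}
    ⟨c, 1, fun x y h => by simpa using h, by simp⟩ ⟨d, by rintro y ⟨g, hg, rfl⟩; exact hc g hg⟩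
  obtain ⟨g, hg, hne⟩ := hS.exists_smul_ne s
  refine hne (smul_eq_of_isLUB hg hs ?_ ?_)
  · rintro y ⟨k, hk, rfl⟩
    exact ⟨g * k, by simpa only [mul_smul, Function.comp_def] using hg.comp hk, by rw [mul_smul]⟩
  · rintro y ⟨k, hk, rfl⟩
    exact ⟨g⁻¹ * k, by simpa only [mul_smul, Function.comp_def] using (StrictMono.inv_smul hg).comp hk,
      by rw [mul_smul]⟩

/-- Let `h` preserve the order with `d < h • c`. Take `I` between `d` and `h • c`, and `J` reaching
from below `c` to above `h • d`. One point is brought into `I`, the other outside `J`: if it comes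
to lie below, the two points enclose `[c, d]`; if above, they enclose `[h • c, h • d]` and `h⁻¹` is
applied. -/
theorem SpanTransitive.exists_expanding (hS : X.SpanTransitive) {a b : X.bar} (hab : a ≠ b)
    {c d : X.bar} (hcd : c < d) :
    ∃ g : X.G, (g • a < c ∧ d < g • b) ∨ (g • b < c ∧ d < g • a) := by
  obtain ⟨h, hm, hh⟩ := hS.exists_lt_smul c d
  obtain ⟨i₁, hi₁, hi⟩ := exists_between hh
  obtain ⟨i₂, hi₂, hi₃⟩ := exists_between hi
  obtain ⟨j₁, hj₁⟩ := exists_lt c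
  obtain ⟨j₂, hj₂⟩ := exists_gt (h • d)
  have hinv := StrictMono.inv_smul hm
  have key : ∀ p q : X.bar, p ∈ Set.Ioo i₁ i₂ → q ∉ Set.Ioo j₁ j₂ →
      (q < c ∧ d < p) ∨ (h⁻¹ • p < c ∧ d < h⁻¹ • q) := by
    intro p q hp hq
    rw [Set.mem_Ioo, not_and_or, not_lt, not_lt] at hq
    rcases hq with hq | hq
    · exact Or.inl ⟨hq.trans_lt hj₁, hi₁.trans hp.1⟩
    · right
      have h1 : p < h • c := hp.2.trans hi₃
      have h2 : h • d < q := hj₂.trans_le hq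
      exact ⟨by simpa using hinv h1, by simpa using hinv h2⟩
  have hcd' : h • c < h • d := hm hcd
  obtain ⟨g, ⟨h1, h2⟩ | ⟨h1, h2⟩⟩ := hS a b hab (Set.Ioo i₁ i₂) (Set.Ioo j₁ j₂)
    ⟨_, _, hi₂, rfl⟩ ⟨_, _, hj₁.trans (hcd.trans (hcd'.trans hj₂ |> hh.trans)), rfl⟩
    (Set.Ioo_subset_Ioo (hj₁.le.trans (hcd.le.trans hi₁.le))
      (hi₃.le.trans (hcd'.le.trans hj₂.le)))
  · rcases key _ _ h1 h2 with h3 | h3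
    · exact ⟨g, Or.inr h3⟩
    · exact ⟨h⁻¹ * g, Or.inl (by simpa only [mul_smul] using h3)⟩
  · rcases key _ _ h1 h2 with h3 | h3
    · exact ⟨g, Or.inl h3⟩
    · exact ⟨h⁻¹ * g, Or.inr (by simpa only [mul_smul] using h3)⟩

/-- A normal subgroup of elements with bounded support that is locally moving. -/
structure IsLocalNormal (U : Subgroup X.G) : Prop where
  conj_mem : ∀ u ∈ U, ∀ g : X.G, g⁻¹ * u * g ∈ U
  bounded : ∀ u ∈ U, ∃ a b : X.bar, a < b ∧ msupp X.bar u ⊆ Set.Ioo a b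
  moving : ∀ a b : X.bar, a < b → ∃ u ∈ U, u ≠ 1 ∧ msupp X.bar u ⊆ Set.Ioo a b

theorem strictMono_of_bounded {u : X.G} {a b : X.bar} (hu : msupp X.bar u ⊆ Set.Ioo a b) :
    StrictMono fun x : X.bar => u • x := by
  obtain ⟨c, hc⟩ := exists_lt a
  exact strictMono_of_fixes (X.isMonotonic_smul u) hc
    (notMem_msupp.1 fun h => (hu h).1.asymm hc) (notMem_msupp.1 fun h => (hu h).1.ne rfl)

theorem exists_mem_msupp {u : X.G} (hu : u ≠ 1) : ∃ x : X.bar, x ∈ msupp X.bar u := by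
  by_contra hc
  push Not at hc
  exact hu (X.faithful fun x => notMem_msupp.1 (hc x))

theorem mem_msupp_conj' {g u : X.G} {z : X.bar} :
    z ∈ msupp X.bar (g⁻¹ * u * g) ↔ g • z ∈ msupp X.bar u := by
  have := mem_msupp_conj (g := g⁻¹) (h := u) (x := z)
  rwa [inv_inv] at this

theorem conj_smul_eq_iff {g u : X.G} {z : X.bar} :
    (g⁻¹ * u * g) • z = z ↔ u • g • z = g • z := by
  rw [← notMem_msupp, mem_msupp_conj', notMem_msupp]

namespace IsLocalNormal

variable {U : Subgroup X.G}

theorem strictMono (hU : IsLocalNormal U) {u : X.G} (hu : u ∈ U) :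
    StrictMono fun x : X.bar => u • x := by
  obtain ⟨a, b, -, h⟩ := hU.bounded u hu
  exact strictMono_of_bounded h

/-- A conjugate of a nontrivial `u ∈ U` carries some point from one side of `e` to the other; being
order preserving, it cannot fix `e`. -/
theorem exists_smul_ne (hU : IsLocalNormal U) (hS : X.SpanTransitive) (e : X.bar) :
    ∃ u ∈ U, u • e ≠ e := by
  obtain ⟨a, ha⟩ := exists_gt e
  obtain ⟨u, hu, hu1, -⟩ := hU.moving e a ha
  obtain ⟨x, hx⟩ := exists_mem_msupp hu1
  obtain ⟨c, hc⟩ := exists_lt e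
  obtain ⟨g, hg⟩ := hS.exists_expanding (Ne.symm hx) (c := e) (d := a) ha
  have h1 : g⁻¹⁻¹ * u * g⁻¹ ∈ U := hU.conj_mem u hu g⁻¹
  refine ⟨_, h1, fun h2 => ?_⟩
  have hm := hU.strictMono h1
  have h3 : (g⁻¹⁻¹ * u * g⁻¹) • g • x = g • u • x := by simp [mul_smul]
  rcases hg with ⟨h4, h5⟩ | ⟨h4, h5⟩
  · have := hm h4
    simp only [h3, h2] at this
    exact this.asymm (ha.trans h5)
  · have := hm (ha.trans h5)
    simp only [h3, h2] at this
    exact this.asymm h4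

/-- Suppose that elements of `U` supported to the right of `y₀` all fix `e`, and let `l` be the
infimum of all such bounds `y < e`. The set of bounds is invariant under order preserving elements
fixing `e`, so whatever preserves the order and fixes `e` also fixes `l`. Span-transitivity, applied
to `l` and `e`, separates the two points and breaks this dependence. -/
theorem exists_right_moving (hU : IsLocalNormal U) (hS : X.SpanTransitive) {y₀ e : X.bar}
    (hy : y₀ < e) : ∃ u ∈ U, msupp X.bar u ⊆ Set.Ioi y₀ ∧ u • e ≠ e := by
  by_contra hcon
  push Not at hcon
  set T : Set X.bar := {y | y < e ∧ ∀ u ∈ U, msupp X.bar u ⊆ Set.Ioi y → u • e = e} with hT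
  have hy₀ : y₀ ∈ T := ⟨hy, hcon⟩
  have hbelow : BddBelow T := by
    obtain ⟨u, hu, hue⟩ := hU.exists_smul_ne hS e
    obtain ⟨a, b, -, hab⟩ := hU.bounded u hu
    refine ⟨a, fun y hy => not_lt.1 fun hya => hue (hy.2 u hu ?_)⟩
    exact hab.trans fun z hz => hya.trans hz.1
  obtain ⟨l, hl⟩ := dedekindComplete_completion.exists_isGLB ⟨y₀, hy₀⟩ hbelow
  have hle : l < e := (hl.1 hy₀).trans_lt hy
  have hbetween : ∀ y, l < y → y < e → y ∈ T := by
    intro y h1 h2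
    obtain ⟨y', hy', hy'y⟩ := (isGLB_lt_iff hl).1 h1
    exact ⟨h2, fun u hu hs => hy'.2 u hu (hs.trans (Set.Ioi_subset_Ioi hy'y.le))⟩
  have hpres : ∀ k : X.G, (StrictMono fun x : X.bar => k • x) → k • e = e → ∀ y ∈ T,
      k • y ∈ T := by
    intro k hk hke y hy
    refine ⟨by simpa only [hke] using hk hy.1, fun u hu hs => ?_⟩
    have := hy.2 _ (hU.conj_mem u hu k) fun z hz => by
      have := hs (mem_msupp_conj'.1 hz)
      exact hk.lt_iff_lt.1 this
    rwa [conj_smul_eq_iff, hke] at this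
  have hfix : ∀ k : X.G, (StrictMono fun x : X.bar => k • x) → k • e = e → k • l = l :=
    fun k hk hke => smul_eq_of_isGLB hk hl (hpres k hk hke)
      (hpres k⁻¹ (StrictMono.inv_smul hk) (by rw [inv_smul_eq_iff, hke]))
  obtain ⟨a, ha⟩ := exists_gt e
  -- Two nested test elements: `h` is supported in an interval of points moved by `f`. The small
  -- interval `(p, q)` is inside `supp h`, the large interval `(J₁, J₂)` contains `supp f`.
  obtain ⟨f, hf, hf1, -⟩ := hU.moving e a ha
  obtain ⟨x, hx⟩ := exists_mem_msupp hf1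
  obtain ⟨j₁, j₂, -, hj⟩ := hU.bounded f hf
  obtain ⟨i₁, i₂, hi₁, hi₂, hi⟩ := exists_Ioo_of_isOpen (X.isMonotonic_smul f).isOpen_msupp hx
  obtain ⟨h, hh, hh1, hhI⟩ := hU.moving i₁ i₂ (hi₁.trans hi₂)
  obtain ⟨x', hx'⟩ := exists_mem_msupp hh1
  obtain ⟨p, q, hp, hq, hpq⟩ := exists_Ioo_of_isOpen (X.isMonotonic_smul h).isOpen_msupp hx'
  obtain ⟨J₁, hJ₁⟩ := exists_lt (min j₁ i₁)
  obtain ⟨J₂, hJ₂⟩ := exists_gt (max j₂ i₂)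
  obtain ⟨hJj₁, hJi₁⟩ := lt_min_iff.1 hJ₁
  obtain ⟨hJj₂, hJi₂⟩ := max_lt_iff.1 hJ₂
  obtain ⟨g, ⟨h1, h2⟩ | ⟨h1, h2⟩⟩ := hS l e hle.ne (Set.Ioo p q) (Set.Ioo J₁ J₂)
    ⟨_, _, hp.trans hq, rfl⟩
    ⟨_, _, hJi₁.trans (hi₁.trans (hi₂.trans hJi₂)), rfl⟩
    (hpq.trans (hhI.trans (Set.Ioo_subset_Ioo hJi₁.le hJi₂.le)))
  -- First case, `l` goes to the small interval and `e` out of the large one: the conjugate of `f`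
  -- fixes `e` but moves `l`.
  · have hfge : f • g • e = g • e := notMem_msupp.1 fun hc =>
      h2 ⟨hJj₁.trans (hj hc).1, (hj hc).2.trans hJj₂⟩
    have h3 := hfix _ (hU.strictMono (hU.conj_mem f hf g)) (conj_smul_eq_iff.2 hfge)
    rw [conj_smul_eq_iff] at h3
    exact hi (hhI (hpq h1)) h3
  -- Second case, `e` goes to the small interval and `l` out of the large one: the conjugate of `h`
  -- moves `e`, yet its support lies to the right of a bound between `l` and `e`. If `g` reverses
  -- the order, that bound is the preimage of `i₂` instead of `i₁`.
  · refine hpq h1 (conj_smul_eq_iff.1 ?_)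
    have hI := hhI (hpq h1)
    rw [Set.mem_Ioo, not_and_or, not_lt, not_lt] at h2
    rcases X.isMonotonic_smul g with hg | hg
    · have hlt : g • l < g • e := hg hle
      have h3 : g • l ≤ J₁ := h2.resolve_right fun h4 =>
        (h4.trans hlt.le).not_gt (hI.2.trans hJi₂)
      have h4 : g⁻¹ • i₁ ∈ T := by
        refine hbetween _ (hg.lt_iff_lt.1 ?_) (hg.lt_iff_lt.1 ?_)
        · simpa using h3.trans_lt hJi₁
        · simpa using hI.1
      refine h4.2 _ (hU.conj_mem h hh g) fun z hz => hg.lt_iff_lt.1 ?_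
      simpa using (hhI (mem_msupp_conj'.1 hz)).1
    · have hlt : g • e < g • l := hg hle
      have h3 : J₂ ≤ g • l := h2.resolve_left fun h4 =>
        (hlt.le.trans h4).not_gt (hJi₁.trans hI.1)
      have h4 : g⁻¹ • i₂ ∈ T := by
        refine hbetween _ (hg.lt_iff_gt.1 ?_) (hg.lt_iff_gt.1 ?_)
        · simpa using hJi₂.trans_le h3
        · simpa using hI.2
      refine h4.2 _ (hU.conj_mem h hh g) fun z hz => hg.lt_iff_gt.1 ?_
      simpa using (hhI (mem_msupp_conj'.1 hz)).2

/-- Now the right end is varied. The supremum `s` of the bounds `y` for which elements supported in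
`(a, y)` fix `e` is finite by `exists_right_moving`. The same lemma gives an element supported to
the right of `e` that moves `s`; but such elements fix `a` and `e`, so they preserve the set of
bounds and fix `s`. -/
theorem exists_local_moving (hU : IsLocalNormal U) (hS : X.SpanTransitive) {a e b : X.bar}
    (hae : a < e) (heb : e < b) : ∃ u ∈ U, msupp X.bar u ⊆ Set.Ioo a b ∧ u • e ≠ e := by
  by_contra hcon
  push Not at hcon
  set T : Set X.bar := {y | e < y ∧ ∀ u ∈ U, msupp X.bar u ⊆ Set.Ioo a y → u • e = e} with hT
  have hb : b ∈ T := ⟨heb, hcon⟩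
  have habove : BddAbove T := by
    obtain ⟨u, hu, hua, hue⟩ := hU.exists_right_moving hS hae
    obtain ⟨c, d, -, hcd⟩ := hU.bounded u hu
    refine ⟨d, fun y hy => not_lt.1 fun hyd => hue (hy.2 u hu ?_)⟩
    exact fun z hz => ⟨hua hz, (hcd hz).2.trans hyd⟩
  obtain ⟨s, hs⟩ := dedekindComplete_completion T ⟨b, hb⟩ habove
  obtain ⟨k, hk, hke, hks⟩ := hU.exists_right_moving hS (heb.trans_le (hs.1 hb))
  have hpres : ∀ k ∈ U, msupp X.bar k ⊆ Set.Ioi e → ∀ y ∈ T, k • y ∈ T := by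
    intro k hk hke y hy
    have hm := hU.strictMono hk
    have h1 : k • e = e := notMem_msupp.1 fun h => lt_irrefl e (hke h)
    have h2 : k • a = a := notMem_msupp.1 fun h => hae.asymm (hke h)
    refine ⟨by simpa only [h1] using hm hy.1, fun u hu hs => ?_⟩
    have := hy.2 _ (hU.conj_mem u hu k) fun z hz => by
      have h3 := hs (mem_msupp_conj'.1 hz)
      refine ⟨hm.lt_iff_lt.1 ?_, hm.lt_iff_lt.1 h3.2⟩
      simpa only [h2] using h3.1
    rwa [conj_smul_eq_iff, h1] at this
  exact hks (smul_eq_of_isLUB (hU.strictMono hk) hs (hpres k hk hke)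
    (hpres k⁻¹ (U.inv_mem hk) (by rwa [msupp_inv])))

/-- Otherwise the supremum of the orbit of `x` under the elements of `U` supported in `(a, b)` would
lie in `(a, b)` and be fixed by all of them, against `exists_local_moving`. -/
theorem exists_moves (hU : IsLocalNormal U) (hS : X.SpanTransitive) {a x y b : X.bar}
    (hax : a < x) (hyb : y < b) :
    ∃ u ∈ U, (∀ z, z ∉ Set.Ioo a b → u • z = z) ∧ y < u • x := by
  by_contra hcon
  push Not at hcon
  obtain ⟨s, hs⟩ := dedekindComplete_completion
    {z : X.bar | ∃ u ∈ U, msupp X.bar u ⊆ Set.Ioo a b ∧ z = u • x}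
    ⟨x, 1, U.one_mem, by simp [msupp_one], by simp⟩ ⟨y, by
      rintro z ⟨u, hu, hs, rfl⟩
      exact hcon u hu fun z hz => notMem_msupp.1 fun h => hz (hs h)⟩
  have hxs : x ≤ s := hs.1 ⟨1, U.one_mem, by simp [msupp_one], by simp⟩
  have hsy : s ≤ y := hs.2 (by
      rintro z ⟨u, hu, hs, rfl⟩
      exact hcon u hu fun z hz => notMem_msupp.1 fun h => hz (hs h))
  obtain ⟨k, hk, hkI, hks⟩ :=
    hU.exists_local_moving hS (hax.trans_le hxs) (hsy.trans_lt hyb)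
  refine hks (smul_eq_of_isLUB (hU.strictMono hk) hs ?_ ?_)
  · rintro z ⟨u, hu, hs, rfl⟩
    exact ⟨k * u, U.mul_mem hk hu, (msupp_mul _ _).trans (Set.union_subset hkI hs),
      by rw [mul_smul]⟩
  · rintro z ⟨u, hu, hs, rfl⟩
    exact ⟨k⁻¹ * u, U.mul_mem (U.inv_mem hk) hu,
      (msupp_mul _ _).trans (Set.union_subset (by rwa [msupp_inv]) hs), by rw [mul_smul]⟩

end IsLocalNormal

theorem exists_Ioo_of_mem_bdd {u : X.G} (hu : u ∈ X.bdd) :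
    ∃ a b : X.bar, a < b ∧ msupp X.bar u ⊆ Set.Ioo a b := by
  obtain ⟨⟨b, hb⟩, ⟨a, ha⟩⟩ := hu
  obtain ⟨b', hb'⟩ := exists_gt (max a b)
  obtain ⟨a', ha'⟩ := exists_lt a
  exact ⟨a', b', ha'.trans ((le_max_left _ _).trans_lt hb'), fun z hz =>
    ⟨ha'.trans_le (ha hz), (hb hz).trans_lt ((le_max_right _ _).trans_lt hb')⟩⟩

theorem mem_bdd_of_subset_Ioo {u : X.G} {a b : X.bar} (hu : msupp X.bar u ⊆ Set.Ioo a b) :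
    u ∈ X.bdd :=
  ⟨⟨b, fun _ hz => (hu hz).2.le⟩, ⟨a, fun _ hz => (hu hz).1.le⟩⟩

theorem conj_mem_bdd {u : X.G} (hu : u ∈ X.bdd) (g : X.G) : g * u * g⁻¹ ∈ X.bdd := by
  obtain ⟨a, b, -, hab⟩ := exists_Ioo_of_mem_bdd hu
  rcases X.isMonotonic_smul g with hg | hg
  · refine mem_bdd_of_subset_Ioo (a := g • a) (b := g • b) fun z hz => ?_
    have := hab (mem_msupp_conj.1 hz)
    exact ⟨by simpa using hg this.1, by simpa using hg this.2⟩
  · refine mem_bdd_of_subset_Ioo (a := g • b) (b := g • a) fun z hz => ?_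
    have := hab (mem_msupp_conj.1 hz)
    exact ⟨by simpa using hg this.2, by simpa using hg this.1⟩

instance : X.bdd.Normal := ⟨fun _ hu g => conj_mem_bdd hu g⟩

theorem bddDer_le_bdd : X.bddDer ≤ X.bdd := Subgroup.commutator_le_left _ _

/-- For local nontriviality, take `f` supported in `(a, b)` and `k ≠ 1` supported in a subinterval
that `f` moves off itself: they do not commute, and their commutator is supported in `(a, b)`. -/
theorem LocallyMoving.isLocalNormal (hX : X.LocallyMoving) : IsLocalNormal X.bddDer := by
  refine ⟨fun u hu g => ?_, fun u hu => exists_Ioo_of_mem_bdd (bddDer_le_bdd hu),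
    fun a b hab => ?_⟩
  · have : X.bddDer.Normal := inferInstanceAs (⁅X.bdd, X.bdd⁆.Normal)
    simpa using this.conj_mem u hu g⁻¹
  · obtain ⟨f, hf, hfab⟩ := hX.exists_ne_one hab
    obtain ⟨x, hx⟩ := exists_mem_msupp hf
    obtain ⟨a', b', hab', hsub, hV⟩ := (X.isMonotonic_smul f).exists_Ioo_moved hx isOpen_Ioo
      (hfab hx)
    obtain ⟨k, hk, hkab⟩ := hX.exists_ne_one (hab'.1.trans hab'.2)
    obtain ⟨z, hz⟩ := exists_mem_msupp hk
    open scoped commutatorElement in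
    refine ⟨⁅f, k⁆, Subgroup.commutator_mem_commutator (mem_bdd_of_subset_Ioo hfab)
      (mem_bdd_of_subset_Ioo hkab), ?_, ?_⟩
    · rw [Ne, commutatorElement_eq_one_iff_mul_comm]
      exact Flexible.not_commute_of_moves hz fun h => hV z (hkab hz) (hkab h)
    · rw [commutatorElement_def]
      refine (msupp_mul _ _).trans (Set.union_subset ?_ (by
        rw [msupp_inv]; exact hkab.trans hsub))
      intro w hw
      rw [mem_msupp_conj] at hw
      have := hsub (hkab hw)
      have hf' : msupp X.bar f⁻¹ ⊆ Set.Ioo a b := by rwa [msupp_inv]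
      exact (Flexible.smul_mem_of_msupp_subset hf').1 this

/-- All subgroups containing the derived group of the bounded elements are flexible. -/
theorem flexible_of_le (hX : X ∈ KSpan) {H : Subgroup X.G} (hH : X.bddDer ≤ H) :
    Flexible H X.bar := by
  refine ⟨dedekindComplete_completion, fun h => X.isMonotonic_smul (h : X.G), fun h hh => ?_,
    fun a x y b ha hx hy => ?_⟩
  · exact Subtype.ext (X.faithful hh)
  · obtain ⟨u, hu, h1, h2⟩ := hX.1.isLocalNormal.exists_moves hX.2 ha hy
    exact ⟨⟨u, hH hu⟩, h1, h2⟩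

theorem flexible (hX : X ∈ KSpan) : Flexible X.G X.bar := by
  refine ⟨dedekindComplete_completion, X.isMonotonic_smul, fun h hh => X.faithful hh,
    fun a x y b ha hx hy => ?_⟩
  obtain ⟨u, hu, h1, h2⟩ := hX.1.isLocalNormal.exists_moves hX.2 ha hy
  exact ⟨u, h1, h2⟩

end PermGroup

end NearlyOrdered

namespace NearlyOrdered

/-! ### Isomorphisms of groups and monotonic bijections of completions -/

theorem isLUB_image_of_strictMono {α β : Type*} [LinearOrder α] [LinearOrder β] {τ : α ≃ β}
    (hτ : StrictMono τ) {S : Set α} {x : α} (h : IsLUB S x) : IsLUB (τ '' S) (τ x) := by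
  refine ⟨?_, fun y hy => ?_⟩
  · rintro _ ⟨z, hz, rfl⟩
    exact hτ.monotone (h.1 hz)
  · have : x ≤ τ.symm y := h.2 fun z hz => by
      have := (StrictMono.equiv_symm hτ).monotone (hy ⟨z, hz, rfl⟩)
      simpa using this
    simpa using hτ.monotone this

theorem isGLB_image_of_strictMono {α β : Type*} [LinearOrder α] [LinearOrder β] {τ : α ≃ β}
    (hτ : StrictMono τ) {S : Set α} {x : α} (h : IsGLB S x) : IsGLB (τ '' S) (τ x) := by
  refine ⟨?_, fun y hy => ?_⟩
  · rintro _ ⟨z, hz, rfl⟩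
    exact hτ.monotone (h.1 hz)
  · have : τ.symm y ≤ x := h.2 fun z hz => by
      have := (StrictMono.equiv_symm hτ).monotone (hy ⟨z, hz, rfl⟩)
      simpa using this
    simpa using hτ.monotone this

theorem isGLB_image_of_strictAnti {α β : Type*} [LinearOrder α] [LinearOrder β] {τ : α ≃ β}
    (hτ : StrictAnti τ) {S : Set α} {x : α} (h : IsLUB S x) : IsGLB (τ '' S) (τ x) := by
  have hτ' : StrictMono (τ.trans OrderDual.toDual) := fun x y hxy => hτ hxy
  have h' : IsLUB ((τ.trans OrderDual.toDual) '' S) ((τ.trans OrderDual.toDual) x) :=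
    isLUB_image_of_strictMono (τ := τ.trans OrderDual.toDual) hτ' h
  exact h'

theorem isLUB_image_of_strictAnti {α β : Type*} [LinearOrder α] [LinearOrder β] {τ : α ≃ β}
    (hτ : StrictAnti τ) {S : Set α} {x : α} (h : IsGLB S x) : IsLUB (τ '' S) (τ x) := by
  have hτ' : StrictMono (τ.trans OrderDual.toDual) := fun x y hxy => hτ hxy
  have h' : IsGLB ((τ.trans OrderDual.toDual) '' S) ((τ.trans OrderDual.toDual) x) :=
    isGLB_image_of_strictMono (τ := τ.trans OrderDual.toDual) hτ' h
  exact h'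

namespace PermGroup

variable {X Y : PermGroup.{u}}

theorem supp_subset_var (g : X.G) : X.supp g ⊆ X.var g :=
  interior_maximal subset_closure (X.isMonotonic_smul g).isOpen_msupp

/-- `supp g ⊆ var g ⊆ cl (supp g)`, and closures have the same upper bounds. So endpoints may be
computed from supports. -/
theorem upperBounds_var (g : X.G) : upperBounds (X.var g) = upperBounds (X.supp g) := by
  refine Set.Subset.antisymm (upperBounds_mono_set (supp_subset_var g)) ?_
  rw [← upperBounds_closure (X.supp g)]
  exact upperBounds_mono_set interior_subset

theorem lowerBounds_var (g : X.G) : lowerBounds (X.var g) = lowerBounds (X.supp g) := by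
  refine Set.Subset.antisymm (lowerBounds_mono_set (supp_subset_var g)) ?_
  rw [← lowerBounds_closure (X.supp g)]
  exact lowerBounds_mono_set interior_subset

theorem mem_ep_iff {x : X.bar} : x ∈ X.ep ↔ EndPt X.G x := by
  refine exists_congr fun g => ?_
  rw [IsLUB, IsGLB, upperBounds_var, lowerBounds_var]
  rfl

/-- `h'` is the conjugate of `h` by `τ`. -/
def Conjugates (τ : X.bar ≃ Y.bar) (h : X.G) (h' : Y.G) : Prop :=
  ∀ x : X.bar, τ (h • x) = h' • τ x

theorem induces_iff {τ : X.bar ≃ Y.bar} {α : X.G ≃* Y.G} :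
    Induces τ α ↔ ∀ h : X.G, Conjugates τ h (α h) := by
  constructor
  · intro h g x
    rw [h g (τ x), τ.symm_apply_apply]
  · intro h g y
    rw [h g (τ.symm y), τ.apply_symm_apply]

theorem Conjugates.symm {τ : X.bar ≃ Y.bar} {h : X.G} {h' : Y.G} (hc : Conjugates τ h h') :
    Conjugates τ.symm h' h := by
  intro y
  rw [τ.symm_apply_eq, hc, τ.apply_symm_apply]

theorem Conjugates.msupp_eq {τ : X.bar ≃ Y.bar} {h : X.G} {h' : Y.G} (hc : Conjugates τ h h') :
    msupp Y.bar h' = τ '' msupp X.bar h := by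
  ext y
  obtain ⟨x, rfl⟩ := τ.surjective y
  rw [τ.injective.mem_set_image, mem_msupp, mem_msupp, ← hc, Ne, τ.apply_eq_iff_eq]

theorem Conjugates.unique {τ : X.bar ≃ Y.bar} {h : X.G} {h' h'' : Y.G} (hc : Conjugates τ h h')
    (hc' : Conjugates τ h h'') : h' = h'' := by
  have : (h''⁻¹ * h') = 1 := Y.faithful fun y => by
    obtain ⟨x, rfl⟩ := τ.surjective y
    rw [mul_smul, ← hc, hc', inv_smul_smul]
  rwa [inv_mul_eq_one, eq_comm] at this

theorem Conjugates.mem_lft {τ : X.bar ≃ Y.bar} {h : X.G} {h' : Y.G} (hc : Conjugates τ h h')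
    (hτ : StrictMono τ) (hh : h ∈ X.lft) : h' ∈ Y.lft := by
  obtain ⟨b, hb⟩ := hh
  refine ⟨τ b, ?_⟩
  rw [supp_eq, hc.msupp_eq]
  rintro _ ⟨z, hz, rfl⟩
  exact hτ.monotone (hb hz)

theorem Conjugates.mem_rt {τ : X.bar ≃ Y.bar} {h : X.G} {h' : Y.G} (hc : Conjugates τ h h')
    (hτ : StrictMono τ) (hh : h ∈ X.rt) : h' ∈ Y.rt := by
  obtain ⟨b, hb⟩ := hh
  refine ⟨τ b, ?_⟩
  rw [supp_eq, hc.msupp_eq]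
  rintro _ ⟨z, hz, rfl⟩
  exact hτ.monotone (hb hz)

theorem Conjugates.mem_rt_of_mem_lft {τ : X.bar ≃ Y.bar} {h : X.G} {h' : Y.G}
    (hc : Conjugates τ h h') (hτ : StrictAnti τ) (hh : h ∈ X.lft) : h' ∈ Y.rt := by
  obtain ⟨b, hb⟩ := hh
  refine ⟨τ b, ?_⟩
  rw [supp_eq, hc.msupp_eq]
  rintro _ ⟨z, hz, rfl⟩
  exact hτ.antitone (hb hz)

theorem Conjugates.mem_lft_of_mem_rt {τ : X.bar ≃ Y.bar} {h : X.G} {h' : Y.G}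
    (hc : Conjugates τ h h') (hτ : StrictAnti τ) (hh : h ∈ X.rt) : h' ∈ Y.lft := by
  obtain ⟨b, hb⟩ := hh
  refine ⟨τ b, ?_⟩
  rw [supp_eq, hc.msupp_eq]
  rintro _ ⟨z, hz, rfl⟩
  exact hτ.antitone (hb hz)

theorem Conjugates.mem_bdd {τ : X.bar ≃ Y.bar} {h : X.G} {h' : Y.G} (hc : Conjugates τ h h')
    (hτ : IsMonotonic τ) (hh : h ∈ X.bdd) : h' ∈ Y.bdd := by
  rcases hτ with hτ | hτ
  · exact ⟨hc.mem_lft hτ hh.1, hc.mem_rt hτ hh.2⟩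
  · exact ⟨hc.mem_lft_of_mem_rt hτ hh.2, hc.mem_rt_of_mem_lft hτ hh.1⟩

theorem Conjugates.mem_opp {τ : X.bar ≃ Y.bar} {h : X.G} {h' : Y.G} (hc : Conjugates τ h h')
    (hτ : IsMonotonic τ) (hh : h ∈ X.opp) : h' ∈ Y.opp := by
  rw [mem_opp_iff] at hh ⊢
  have : (fun y : Y.bar => h' • y) = τ ∘ (fun x : X.bar => h • x) ∘ τ.symm := by
    funext y
    simp [hc _]
  rw [this]
  rcases hτ with hτ | hτ
  · exact hτ.comp (hh.comp (StrictMono.equiv_symm hτ))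
  · exact hτ.comp (hh.comp_strictAnti (StrictAnti.equiv_symm hτ))

theorem Conjugates.mem_ep {τ : X.bar ≃ Y.bar} {α : X.G ≃* Y.G} (hτ : IsMonotonic τ)
    (hc : ∀ h : X.G, Conjugates τ h (α h)) {x : X.bar} (hx : x ∈ X.ep) : τ x ∈ Y.ep := by
  rw [mem_ep_iff] at hx ⊢
  obtain ⟨g, hg⟩ := hx
  refine ⟨α g, ?_⟩
  rw [(hc g).msupp_eq]
  rcases hτ with hτ | hτ
  · exact hg.imp (isLUB_image_of_strictMono hτ) (isGLB_image_of_strictMono hτ)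
  · exact hg.symm.imp (isLUB_image_of_strictAnti hτ) (isGLB_image_of_strictAnti hτ)

theorem conjugates_symm {τ : X.bar ≃ Y.bar} {α : X.G ≃* Y.G}
    (hc : ∀ h : X.G, Conjugates τ h (α h)) (h : Y.G) : Conjugates τ.symm h (α.symm h) := by
  have := (hc (α.symm h)).symm
  rwa [α.apply_symm_apply] at this

theorem mem_ep_iff_of_conjugates {τ : X.bar ≃ Y.bar} {α : X.G ≃* Y.G} (hτ : IsMonotonic τ)
    (hc : ∀ h : X.G, Conjugates τ h (α h)) {x : X.bar} : x ∈ X.ep ↔ τ x ∈ Y.ep := by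
  refine ⟨Conjugates.mem_ep hτ hc, fun h => ?_⟩
  have := Conjugates.mem_ep hτ.symm (conjugates_symm hc) h
  rwa [τ.symm_apply_apply] at this

theorem Act.point_injective {S : Set X.bar} {H : Subgroup X.G} :
    Function.Injective (Act.point : S → X.Act S H) := Sum.inl_injective

theorem Act.elt_injective {S : Set X.bar} {H : Subgroup X.G} :
    Function.Injective (Act.elt : H → X.Act S H) := Sum.inr_injective

theorem Act.point_ne_elt {S : Set X.bar} {H : Subgroup X.G} (x : S) (h : H) :
    (Act.point x : X.Act S H) ≠ Act.elt h := Sum.inl_ne_inr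

theorem Act.cases {S : Set X.bar} {H : Subgroup X.G} (c : X.Act S H) :
    (∃ x : S, c = Act.point x) ∨ ∃ h : H, c = Act.elt h := by
  rcases c with x | h
  · exact Or.inl ⟨x, rfl⟩
  · exact Or.inr ⟨h, rfl⟩

/-- Maps of points and of group elements that respect the relations give an isomorphism. -/
theorem actIso_of_conjugates {τ : X.bar ≃ Y.bar} {α : X.G ≃* Y.G} (hτ : IsMonotonic τ)
    (hc : ∀ h : X.G, Conjugates τ h (α h)) {S : Set X.bar} {T : Set Y.bar}
    (hST : ∀ x, x ∈ S ↔ τ x ∈ T) : ActIso S T τ α := by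
  let ψ : X.Act S ⊤ ≃ Y.Act T ⊤ := Equiv.sumCongr (τ.subtypeEquiv hST)
    (Subgroup.topEquiv.trans (α.trans Subgroup.topEquiv.symm)).toEquiv
  have hp : ∀ x : S, ψ (Act.point x) = Act.point ⟨τ x, (hST x).1 x.2⟩ := fun _ => rfl
  have he : ∀ h : (⊤ : Subgroup X.G), ψ (Act.elt h) = Act.elt ⟨α h, Subgroup.mem_top _⟩ :=
    fun _ => rfl
  have hpe : ∀ (c : X.Act S ⊤) (y : T), ψ c = Act.point y ↔
      ∃ x : S, τ x = y ∧ c = Act.point x := by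
    intro c y
    rcases Act.cases c with ⟨x, rfl⟩ | ⟨h, rfl⟩
    · rw [hp, Act.point_injective.eq_iff]
      constructor
      · intro e
        exact ⟨x, congrArg Subtype.val e, rfl⟩
      · rintro ⟨x', h1, h2⟩
        rw [Act.point_injective.eq_iff] at h2
        subst h2
        exact Subtype.ext h1
    · rw [he]
      exact ⟨fun e => absurd e.symm (Act.point_ne_elt _ _), fun ⟨x, _, e⟩ =>
        absurd e.symm (Act.point_ne_elt _ _)⟩
  have hee : ∀ (c : X.Act S ⊤) (k : (⊤ : Subgroup Y.G)), ψ c = Act.elt k ↔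
      ∃ h : (⊤ : Subgroup X.G), α h = k ∧ c = Act.elt h := by
    intro c k
    rcases Act.cases c with ⟨x, rfl⟩ | ⟨h, rfl⟩
    · rw [hp]
      exact ⟨fun e => absurd e (Act.point_ne_elt _ _), fun ⟨x, _, e⟩ =>
        absurd e (Act.point_ne_elt _ _)⟩
    · rw [he, Act.elt_injective.eq_iff]
      constructor
      · intro e
        exact ⟨h, congrArg Subtype.val e, rfl⟩
      · rintro ⟨h', h1, h2⟩
        rw [Act.elt_injective.eq_iff] at h2
        subst h2
        exact Subtype.ext h1
  have hT : ∀ y : T, ∃ x : S, τ x = y := fun y =>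
    ⟨⟨τ.symm y, (hST _).2 (by rw [τ.apply_symm_apply]; exact y.2)⟩, τ.apply_symm_apply _⟩
  have hα : ∀ k : (⊤ : Subgroup Y.G), ∃ h : (⊤ : Subgroup X.G), α h = k := fun k =>
    ⟨⟨α.symm k, Subgroup.mem_top _⟩, α.apply_symm_apply _⟩
  let Φ : actLang.Equiv (X.Act S ⊤) (Y.Act T ⊤) :=
    { toEquiv := ψ
      map_fun' := fun f => f.elim
      map_rel' := by
        intro n r v
        cases r with
        | pt =>
          change (∃ y : T, ψ (v 0) = Act.point y) ↔ ∃ x : S, v 0 = Act.point x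
          simp only [hpe]
          exact ⟨fun ⟨y, x, _, e⟩ => ⟨x, e⟩, fun ⟨x, e⟩ => ⟨⟨τ x, (hST x).1 x.2⟩, x, rfl, e⟩⟩
        | grp =>
          change (∃ k : (⊤ : Subgroup Y.G), ψ (v 0) = Act.elt k) ↔
            ∃ h : (⊤ : Subgroup X.G), v 0 = Act.elt h
          simp only [hee]
          exact ⟨fun ⟨y, x, _, e⟩ => ⟨x, e⟩, fun ⟨x, e⟩ =>
            ⟨⟨α x, Subgroup.mem_top _⟩, x, rfl, e⟩⟩
        | ed =>
          change (∃ x₁ x₂ y₁ y₂ : T, ψ (v 0) = Act.point x₁ ∧ ψ (v 1) = Act.point x₂ ∧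
            ψ (v 2) = Act.point y₁ ∧ ψ (v 3) = Act.point y₂ ∧ Ed (x₁ : Y.bar) x₂ y₁ y₂) ↔
            ∃ x₁ x₂ y₁ y₂ : S, v 0 = Act.point x₁ ∧ v 1 = Act.point x₂ ∧
            v 2 = Act.point y₁ ∧ v 3 = Act.point y₂ ∧ Ed (x₁ : X.bar) x₂ y₁ y₂
          simp only [hpe]
          constructor
          · rintro ⟨_, _, _, _, ⟨a, ha, e1⟩, ⟨b, hb, e2⟩, ⟨c, hc, e3⟩, ⟨d, hd, e4⟩, h⟩
            rw [← ha, ← hb, ← hc, ← hd, hτ.ed_iff] at h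
            exact ⟨a, b, c, d, e1, e2, e3, e4, h⟩
          · rintro ⟨a, b, c, d, e1, e2, e3, e4, h⟩
            exact ⟨⟨τ a, (hST a).1 a.2⟩, ⟨τ b, (hST b).1 b.2⟩, ⟨τ c, (hST c).1 c.2⟩,
              ⟨τ d, (hST d).1 d.2⟩, ⟨a, rfl, e1⟩, ⟨b, rfl, e2⟩, ⟨c, rfl, e3⟩, ⟨d, rfl, e4⟩,
              (hτ.ed_iff _ _ _ _).2 h⟩
        | mul =>
          change (∃ g h : (⊤ : Subgroup Y.G), ψ (v 0) = Act.elt g ∧ ψ (v 1) = Act.elt h ∧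
            ψ (v 2) = Act.elt (g * h)) ↔ ∃ g h : (⊤ : Subgroup X.G), v 0 = Act.elt g ∧
            v 1 = Act.elt h ∧ v 2 = Act.elt (g * h)
          simp only [hee]
          constructor
          · rintro ⟨g, h, ⟨a, ha, e1⟩, ⟨b, hb, e2⟩, ⟨c, hc, e3⟩⟩
            refine ⟨a, b, e1, e2, ?_⟩
            rw [e3]
            congr 1
            refine Subtype.ext (α.injective ?_)
            rw [hc, Subgroup.coe_mul, Subgroup.coe_mul, map_mul, ha, hb]
          · rintro ⟨a, b, e1, e2, e3⟩
            exact ⟨⟨α a, Subgroup.mem_top _⟩, ⟨α b, Subgroup.mem_top _⟩, ⟨a, rfl, e1⟩,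
              ⟨b, rfl, e2⟩, ⟨a * b, by simp, e3⟩⟩
        | ap =>
          change (∃ (g : (⊤ : Subgroup Y.G)) (x y : T), ψ (v 0) = Act.elt g ∧
            ψ (v 1) = Act.point x ∧ ψ (v 2) = Act.point y ∧ (g : Y.G) • (x : Y.bar) = y) ↔
            ∃ (g : (⊤ : Subgroup X.G)) (x y : S), v 0 = Act.elt g ∧
            v 1 = Act.point x ∧ v 2 = Act.point y ∧ (g : X.G) • (x : X.bar) = y
          simp only [hpe, hee]
          constructor
          · rintro ⟨_, _, _, ⟨g, hg, e1⟩, ⟨x, hx, e2⟩, ⟨y, hy, e3⟩, h⟩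
            rw [← hg, ← hx, ← hy, ← hc, τ.apply_eq_iff_eq] at h
            exact ⟨g, x, y, e1, e2, e3, h⟩
          · rintro ⟨g, x, y, e1, e2, e3, h⟩
            exact ⟨⟨α g, Subgroup.mem_top _⟩, ⟨τ x, (hST x).1 x.2⟩, ⟨τ y, (hST y).1 y.2⟩,
              ⟨g, rfl, e1⟩, ⟨x, rfl, e2⟩, ⟨y, rfl, e3⟩, by
              change α g • τ x = τ y
              rw [← h, hc]⟩ }
  exact ⟨Φ, fun x => ⟨(hST x).1 x.2, rfl⟩, fun g => rfl⟩

/-- The application relation of the triple `g`, `x`, `g • x` is preserved, which is the conjugation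
formula. -/
theorem induces_of_actIso {τ : X.bar ≃ Y.bar} {α : X.G ≃* Y.G}
    (h : ActIso Set.univ Set.univ τ α) : Induces τ α := by
  obtain ⟨Φ, hp, hg⟩ := h
  rw [induces_iff]
  intro g x
  have := Φ.map_rel ActRel.ap ![Act.ofG g, Act.point ⟨x, trivial⟩, Act.point ⟨g • x, trivial⟩]
  have h2 := this.2 ⟨⟨g, Subgroup.mem_top g⟩, ⟨x, trivial⟩, ⟨g • x, trivial⟩, rfl, rfl, rfl, rfl⟩
  obtain ⟨k, y, z, e1, e2, e3, e⟩ := h2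
  obtain ⟨h3, h4⟩ := hp ⟨x, trivial⟩
  obtain ⟨h5, h6⟩ := hp ⟨g • x, trivial⟩
  change Φ (Act.ofG g) = _ at e1
  change Φ (Act.point ⟨x, trivial⟩) = _ at e2
  change Φ (Act.point ⟨g • x, trivial⟩) = _ at e3
  rw [h4] at e2
  rw [h6] at e3
  rw [hg] at e1
  have e1' : α g = k := congrArg Subtype.val (Act.elt_injective e1)
  have e2' : τ x = y := congrArg Subtype.val (Act.point_injective e2)
  have e3' : τ (g • x) = z := congrArg Subtype.val (Act.point_injective e3)
  rw [e3', e1', e2', e]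

theorem exists_conjugating (hX : X ∈ KSpan) (hY : Y ∈ KSpan) (α : X.G ≃* Y.G) :
    ∃ τ : X.bar ≃ Y.bar, IsMonotonic τ ∧ ∀ h : X.G, Conjugates τ h (α h) :=
  (flexible hX).exists_inducing (flexible hY) α

theorem ptLE_of_strictMono {τ : X.bar ≃ Y.bar} {α : X.G ≃* Y.G} (hτ : StrictMono τ)
    (hc : ∀ h : X.G, Conjugates τ h (α h)) (f g : X.G) :
    X.PtLE f g ↔ Y.PtLE (α f) (α g) := by
  rw [ptLE_iff, ptLE_iff, τ.surjective.forall]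
  refine forall_congr' fun x => ?_
  rw [← hc f x, ← hc g x, hτ.le_iff_le]

theorem ptLE_of_strictAnti {τ : X.bar ≃ Y.bar} {α : X.G ≃* Y.G} (hτ : StrictAnti τ)
    (hc : ∀ h : X.G, Conjugates τ h (α h)) (f g : X.G) :
    X.PtLE f g ↔ Y.PtLE (α g) (α f) := by
  rw [ptLE_iff, ptLE_iff, τ.surjective.forall]
  refine forall_congr' fun x => ?_
  rw [← hc f x, ← hc g x, hτ.le_iff_ge]

theorem PtLE.antisymm {f g : X.G} (h1 : X.PtLE f g) (h2 : X.PtLE g f) : f = g := by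
  rw [ptLE_iff] at h1 h2
  have : g⁻¹ * f = 1 := X.faithful fun x => by
    rw [mul_smul, le_antisymm (h1 x) (h2 x), inv_smul_smul]
  rwa [inv_mul_eq_one, eq_comm] at this

/-- If the pointwise order is nontrivial and preserved, then the inducing map preserves order. -/
theorem strictMono_of_ptLE {τ : X.bar ≃ Y.bar} {α : X.G ≃* Y.G} (hτ : IsMonotonic τ)
    (hc : ∀ h : X.G, Conjugates τ h (α h)) (hn : X.PtNontrivial)
    (hα : ∀ f g, X.PtLE f g ↔ Y.PtLE (α f) (α g)) : StrictMono τ := by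
  refine hτ.resolve_right fun ha => ?_
  obtain ⟨f, g, hne, hfg⟩ := hn
  refine hne (hfg.antisymm ?_)
  rw [hα g f, ← ptLE_of_strictAnti ha hc]
  exact hfg

theorem orbitIso_of_conjugates {τ : X.bar ≃ Y.bar} {α : X.G ≃* Y.G}
    (hc : ∀ h : X.G, Conjugates τ h (α h)) (M : Set X.bar) : OrbitIso M (τ '' M) τ α :=
  ⟨τ.injective.injOn.bijOn_image, fun g x _ => hc g x⟩

theorem image_orbit {τ : X.bar ≃ Y.bar} {α : X.G ≃* Y.G}
    (hc : ∀ h : X.G, Conjugates τ h (α h)) (x : X.bar) :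
    τ '' MulAction.orbit X.G x = MulAction.orbit Y.G (τ x) := by
  ext y
  constructor
  · rintro ⟨_, ⟨g, rfl⟩, rfl⟩
    exact ⟨α g, (hc g x).symm⟩
  · rintro ⟨g, rfl⟩
    refine ⟨α.symm g • x, ⟨_, rfl⟩, ?_⟩
    rw [hc, α.apply_symm_apply]

theorem bijOn_orbits {τ : X.bar ≃ Y.bar} {α : X.G ≃* Y.G}
    (hc : ∀ h : X.G, Conjugates τ h (α h)) :
    Set.BijOn (fun M => τ '' M) X.orbits Y.orbits := by
  refine ⟨?_, τ.injective.image_injective.injOn, ?_⟩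
  · rintro _ ⟨x, rfl⟩
    exact ⟨τ x, (image_orbit hc x).symm⟩
  · rintro _ ⟨y, rfl⟩
    refine ⟨_, ⟨τ.symm y, rfl⟩, ?_⟩
    simp only [image_orbit hc, τ.apply_symm_apply]

end PermGroup

open PermGroup

theorem isoReconstruction {X Y : PermGroup.{u}} (hX : X ∈ KSpan) (hY : Y ∈ KSpan) :
    IsoReconstruction X Y := by
  intro α
  have huniq : ∀ τ σ : X.bar ≃ Y.bar, Induces τ α → Induces σ α → τ = σ := fun τ σ h1 h2 =>
    (flexible hX).inducing_unique α (induces_iff.1 h1) (induces_iff.1 h2)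
  obtain ⟨τ, hτ, hc⟩ := exists_conjugating hX hY α
  refine ⟨⟨τ, ⟨hτ, induces_iff.2 hc⟩, fun σ hσ => huniq _ _ hσ.2 (induces_iff.2 hc)⟩,
    ⟨τ, ⟨isEdIso_iff.2 hτ, actIso_of_conjugates hτ hc fun _ => Iff.rfl⟩,
      fun σ hσ => huniq _ _ (induces_of_actIso hσ.2) (induces_iff.2 hc)⟩, ?_⟩
  intro τ hτ hc
  rw [induces_iff] at hc
  refine ⟨actIso_of_conjugates hτ hc fun x => mem_ep_iff_of_conjugates hτ hc,
    bijOn_orbits hc, ?_, strictMono_of_ptLE hτ hc⟩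
  rcases hτ with hτ | hτ
  · exact Or.inl ⟨hτ, fun M _ => ⟨hτ.strictMonoOn _, orbitIso_of_conjugates hc M⟩,
      ptLE_of_strictMono hτ hc⟩
  · exact Or.inr ⟨hτ, fun M _ => ⟨hτ.strictAntiOn _, orbitIso_of_conjugates hc M⟩,
      ptLE_of_strictAnti hτ hc⟩

end NearlyOrdered

/-! ### Automorphism groups as normalizers, and characteristic subgroups -/

namespace NearlyOrdered

namespace PermGroup

variable {X : PermGroup.{u}}

theorem toPermHom_injective : Function.Injective (MulAction.toPermHom X.G X.bar) := by
  rw [injective_iff_map_eq_one]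
  intro g hg
  exact X.faithful fun x => congrArg (fun p : Equiv.Perm X.bar => p x) hg

theorem mem_img {H : Subgroup X.G} {p : Equiv.Perm X.bar} :
    p ∈ X.img H ↔ ∃ h ∈ H, ∀ x, p x = h • x := by
  constructor
  · rintro ⟨h, hh, rfl⟩
    exact ⟨h, hh, fun x => rfl⟩
  · rintro ⟨h, hh, e⟩
    exact ⟨h, hh, Equiv.ext fun x => (e x).symm⟩

theorem exists_conjugates_of_mem_normalizer {H : Subgroup X.G} {τ : Equiv.Perm X.bar}
    (hτ : τ ∈ Subgroup.normalizer (X.img H : Set (Equiv.Perm X.bar))) {h : X.G} (hh : h ∈ H) :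
    ∃ h' ∈ H, Conjugates τ h h' := by
  have h1 : MulAction.toPermHom X.G X.bar h ∈ X.img H := ⟨h, hh, rfl⟩
  obtain ⟨h', hh', e⟩ := mem_img.1 ((Subgroup.mem_normalizer_iff.1 hτ _).1 h1)
  refine ⟨h', hh', fun x => ?_⟩
  rw [← e (τ x)]
  simp

theorem mem_normalizer_of_conjugates {H : Subgroup X.G} {τ : Equiv.Perm X.bar}
    (h1 : ∀ h ∈ H, ∃ h' ∈ H, Conjugates τ h h') (h2 : ∀ h' ∈ H, ∃ h ∈ H, Conjugates τ h h') :
    τ ∈ Subgroup.normalizer (X.img H : Set (Equiv.Perm X.bar)) := by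
  rw [Subgroup.mem_normalizer_iff]
  intro p
  rw [mem_img, mem_img]
  constructor
  · rintro ⟨h, hh, e⟩
    obtain ⟨h', hh', hc⟩ := h1 h hh
    refine ⟨h', hh', fun x => ?_⟩
    have := hc (τ⁻¹ x)
    simpa [e] using this
  · rintro ⟨h', hh', e⟩
    obtain ⟨h, hh, hc⟩ := h2 h' hh'
    refine ⟨h, hh, fun x => τ.injective ?_⟩
    have := e (τ x)
    rw [hc]
    simpa using this

theorem exists_conjugates_of_mem_normalizer' {H : Subgroup X.G} {τ : Equiv.Perm X.bar}
    (hτ : τ ∈ Subgroup.normalizer (X.img H : Set (Equiv.Perm X.bar))) {h' : X.G} (hh : h' ∈ H) :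
    ∃ h ∈ H, Conjugates τ h h' := by
  obtain ⟨h, hh, hc⟩ := exists_conjugates_of_mem_normalizer (inv_mem hτ) hh
  refine ⟨h, hh, ?_⟩
  have := hc.symm
  exact this

/-- Conjugation identifies the normalizer of a large subgroup with its automorphism group. -/
theorem autEqNorm (hX : X ∈ KSpan) {H : Subgroup X.G} (hH : X.bddDer ≤ H)
    {A : Subgroup (Equiv.Perm X.bar)}
    (hA : ∀ τ : Equiv.Perm X.bar, IsMonotonic τ →
      τ ∈ Subgroup.normalizer (X.img H : Set (Equiv.Perm X.bar)) → τ ∈ A) : X.AutEqNorm A H := by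
  have F := flexible_of_le hX hH
  let e : H ≃* X.img H := H.equivMapOfInjective _ toPermHom_injective
  let φ : X.norm A H →* MulAut H := (MulAut.congr e.symm).toMonoidHom.comp
    ((X.img H).normalizerMonoidHom.comp (Subgroup.inclusion inf_le_right))
  have he : ∀ (k : H) (x : X.bar), ((e k : X.img H) : Equiv.Perm X.bar) x = (k : X.G) • x :=
    fun k x => rfl
  have hφ : ∀ (τ : X.norm A H) (h : H) (x : X.bar), ((φ τ h : H) : X.G) • x =
      (τ : Equiv.Perm X.bar) ((h : X.G) • (τ : Equiv.Perm X.bar)⁻¹ x) := by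
    intro τ h x
    have h1 : e (φ τ h) =
        (X.img H).normalizerMonoidHom (Subgroup.inclusion inf_le_right τ) (e h) :=
      e.apply_symm_apply _
    rw [← he, h1]
    rfl
  have hconj : ∀ (τ : X.norm A H) (h : H) (x : X.bar),
      (τ : Equiv.Perm X.bar) (h • x) = φ τ h • (τ : Equiv.Perm X.bar) x := by
    intro τ h x
    refine Eq.trans ?_ (hφ τ h ((τ : Equiv.Perm X.bar) x)).symm
    exact congrArg (fun y => (τ : Equiv.Perm X.bar) ((h : X.G) • y))
      ((τ : Equiv.Perm X.bar).symm_apply_apply x).symm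
  refine ⟨MulEquiv.ofBijective φ ⟨fun τ σ hτσ => ?_, fun α => ?_⟩, hφ⟩
  · refine Subtype.ext (F.inducing_unique (φ τ) (hconj τ) ?_)
    rw [hτσ]
    exact hconj σ
  -- Surjectivity: the map inducing an automorphism of `H` normalizes the image of `H`, and
  -- hypothesis `hA` places it in `A`.
  · obtain ⟨τ, hτ, hc⟩ := F.exists_inducing F α
    have hn : τ ∈ Subgroup.normalizer (X.img H : Set (Equiv.Perm X.bar)) := by
      refine mem_normalizer_of_conjugates (fun h hh => ⟨α ⟨h, hh⟩, (α ⟨h, hh⟩).2, hc ⟨h, hh⟩⟩)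
        fun h hh => ⟨α.symm ⟨h, hh⟩, (α.symm ⟨h, hh⟩).2, ?_⟩
      have := hc (α.symm ⟨h, hh⟩)
      rw [α.apply_symm_apply] at this
      exact this
    refine ⟨⟨τ, hA τ hτ hn, hn⟩, MulEquiv.ext fun h => Subtype.ext (toPermHom_injective ?_)⟩
    ext x
    change ((φ ⟨τ, hA τ hτ hn, hn⟩ h : H) : X.G) • x = ((α h : H) : X.G) • x
    rw [hφ]
    refine (hc h (τ⁻¹ x)).trans ?_
    exact congrArg (fun y => ((α h : H) : X.G) • y) (τ.apply_symm_apply x)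

theorem bddDer_le_lft : X.bddDer ≤ X.lft := bddDer_le_bdd.trans inf_le_left

theorem bddDer_le_rt : X.bddDer ≤ X.rt := bddDer_le_bdd.trans inf_le_right

theorem bdd_le_opp : X.bdd ≤ X.opp := by
  intro u hu
  obtain ⟨a, b, -, h⟩ := exists_Ioo_of_mem_bdd hu
  exact (X.mem_opp_iff).2 (strictMono_of_bounded h)

theorem autEqNorm_edAut (hX : X ∈ KSpan) {H : Subgroup X.G} (hH : X.bddDer ≤ H) :
    X.AutEqNorm (edAut X.bar) H := autEqNorm hX hH fun _ hτ _ => mem_edAut_iff.2 hτ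

/-- Maps normalizing the image of `G` are monotonic. -/
theorem isMonotonic_of_mem_normalizer (hX : X ∈ KSpan) {τ : Equiv.Perm X.bar}
    (hτ : τ ∈ Subgroup.normalizer (X.img ⊤ : Set (Equiv.Perm X.bar))) : IsMonotonic τ := by
  have F := flexible_of_le hX (le_top : X.bddDer ≤ ⊤)
  obtain ⟨Θ, hΘ⟩ := autEqNorm hX (A := ⊤) (le_top : X.bddDer ≤ ⊤) fun _ _ _ => trivial
  obtain ⟨σ, hσ, hc⟩ := F.exists_inducing F (Θ ⟨τ, trivial, hτ⟩)
  -- The automorphism given by conjugation with `τ` is also induced by the monotonic `σ`; uniqueness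
  -- among all bijections makes them equal.
  have : τ = σ := F.inducing_unique (Θ ⟨τ, trivial, hτ⟩) (fun h x => by
    refine Eq.trans ?_ (hΘ ⟨τ, trivial, hτ⟩ h (τ x)).symm
    exact congrArg (fun y => τ ((h : X.G) • y)) (τ.symm_apply_apply x).symm) hc
  rwa [this]

theorem norm_edAut_eq_norm_homeoGroup (hX : X ∈ KSpan) :
    X.norm (edAut X.bar) ⊤ = X.norm (homeoGroup X.L) ⊤ := by
  ext τ
  constructor
  · rintro ⟨h1, h2⟩
    have hm := mem_edAut_iff.1 h1
    exact ⟨⟨hm.continuous_equiv, hm.symm.continuous_equiv⟩, h2⟩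
  · rintro ⟨-, h2⟩
    exact ⟨mem_edAut_iff.2 (isMonotonic_of_mem_normalizer hX h2), h2⟩

theorem induces_unique (hX : X ∈ KSpan) {α : X.G ≃* X.G} {τ σ : X.bar ≃ X.bar}
    (hτ : ∀ h : X.G, Conjugates τ h (α h)) (hσ : ∀ h : X.G, Conjugates σ h (α h)) : τ = σ :=
  (flexible hX).inducing_unique α hτ hσ

theorem mem_oAut_iff {α : MulAut X.G} {τ : X.bar ≃ X.bar} (hτ : IsMonotonic τ)
    (hc : ∀ h : X.G, Conjugates τ h (α h)) (hn : X.PtNontrivial) :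
    α ∈ X.oAut ↔ StrictMono τ := by
  constructor
  · intro hα
    exact strictMono_of_ptLE hτ hc hn fun f g => (hα f g).symm
  · intro hm f g
    exact (ptLE_of_strictMono hm hc f g).symm

/-- When the pointwise order is nontrivial, membership in `oAut` means being induced by an order
preserving map, and two order reversing maps compose to an order preserving one. When it is
equality, every automorphism preserves it. -/
theorem index_oAut (hX : X ∈ KSpan) : X.oAut.index = 1 ∨ X.oAut.index = 2 := by
  by_cases hn : X.PtNontrivial
  · by_cases htop : X.oAut = ⊤
    · exact Or.inl (Subgroup.index_eq_one.2 htop)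
    · right
      rw [Subgroup.index_eq_two_iff]
      obtain ⟨β, hβ⟩ : ∃ β, β ∉ X.oAut := by
        by_contra hc
        push Not at hc
        exact htop ((Subgroup.eq_top_iff' _).2 hc)
      refine ⟨β, fun α => ?_⟩
      obtain ⟨σ, hσ, hcσ⟩ := exists_conjugating hX hX β
      obtain ⟨τ, hτ, hcτ⟩ := exists_conjugating hX hX α
      have hc : ∀ h : X.G, Conjugates (σ.trans τ) h ((α * β) h) := fun h x => by
        change τ (σ (h • x)) = α (β h) • τ (σ x)
        rw [hcσ, hcτ]
      have hm : IsMonotonic (σ.trans τ) := by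
        have := IsMonotonic.comp hτ hσ
        exact this
      rw [mem_oAut_iff hσ hcσ hn] at hβ
      have hσ' := hσ.resolve_left hβ
      rw [mem_oAut_iff hm hc hn, mem_oAut_iff hτ hcτ hn]
      obtain ⟨a, b, hab⟩ := exists_pair_lt X.L
      have hab' := toCompletion_strictMono hab
      rcases hτ with hτ | hτ
      · exact Or.inr ⟨hτ, fun h => (h hab').asymm (hτ (hσ' hab'))⟩
      · refine Or.inl ⟨hτ.comp hσ', fun h => (h hab').asymm (hτ hab')⟩
  · left
    rw [Subgroup.index_eq_one, Subgroup.eq_top_iff']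
    intro α f g
    have key : ∀ f g : X.G, X.PtLE f g ↔ f = g := fun f g =>
      ⟨fun h => by_contra fun hne => hn ⟨f, g, hne, h⟩, fun h => h ▸ fun a => le_rfl⟩
    rw [key, key, EmbeddingLike.apply_eq_iff_eq]

end PermGroup

open PermGroup

variable {X : PermGroup.{u}}

theorem autReconstruction (hX : X ∈ KSpan) : AutReconstruction X := by
  refine ⟨autEqNorm_edAut hX le_top,
    autEqNorm hX le_top fun τ hτ _ => ⟨hτ.continuous_equiv, hτ.symm.continuous_equiv⟩,
    norm_edAut_eq_norm_homeoGroup hX, fun α => ?_, index_oAut hX, fun hn α hα => ?_⟩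
  · obtain ⟨τ, hτ, hc⟩ := exists_conjugating hX hX α
    exact ⟨τ, ⟨mem_edAut_iff.2 hτ, induces_iff.2 hc⟩, fun σ hσ =>
      induces_unique hX (induces_iff.1 hσ.2) hc⟩
  · obtain ⟨τ, hτ, hc⟩ := exists_conjugating hX hX α
    exact ⟨τ, ⟨(mem_oAut_iff hτ hc hn).1 hα, induces_iff.2 hc⟩, fun σ hσ =>
      induces_unique hX (induces_iff.1 hσ.2) hc⟩

namespace PermGroup

/-- A subgroup invariant under monotonic conjugation is characteristic. -/
theorem characteristic_of_conjugates (hX : X ∈ KSpan) {H : Subgroup X.G}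
    (hH : ∀ (τ : X.bar ≃ X.bar) (h h' : X.G), IsMonotonic τ → Conjugates τ h h' → h ∈ H → h' ∈ H) :
    H.Characteristic := by
  rw [Subgroup.characteristic_iff_map_le]
  rintro α _ ⟨h, hh, rfl⟩
  obtain ⟨τ, hτ, hc⟩ := exists_conjugating hX hX α
  exact hH τ h _ hτ (hc h) hh

theorem norm_le_norm {H K : Subgroup X.G} (hHK : H ≤ K)
    (hH : ∀ (τ : X.bar ≃ X.bar) (h h' : X.G), IsMonotonic τ → Conjugates τ h h' → h ∈ H → h' ∈ H) :
    X.norm (edAut X.bar) K ≤ X.norm (edAut X.bar) H := by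
  rintro τ ⟨h1, h2⟩
  have hm := mem_edAut_iff.1 h1
  refine ⟨h1, mem_normalizer_of_conjugates (fun h hh => ?_) fun h hh => ?_⟩
  · obtain ⟨h', -, hc⟩ := exists_conjugates_of_mem_normalizer h2 (hHK hh)
    exact ⟨h', hH τ h h' hm hc hh, hc⟩
  · obtain ⟨h', -, hc⟩ := exists_conjugates_of_mem_normalizer' h2 (hHK hh)
    exact ⟨h', hH τ.symm h h' hm.symm hc.symm hh, hc⟩

/-- Conjugation commutes with forming commutator subgroups. -/
theorem norm_bdd_le_norm_bddDer :
    X.norm (edAut X.bar) X.bdd ≤ X.norm (edAut X.bar) X.bddDer := by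
  rintro τ ⟨h1, h2⟩
  replace h2 : τ ∈ Subgroup.normalizer (X.img X.bdd : Set (Equiv.Perm X.bar)) := h2
  refine ⟨h1, ?_⟩
  change τ ∈ Subgroup.normalizer (X.img X.bddDer : Set (Equiv.Perm X.bar))
  rw [Subgroup.mem_normalizer_iff_map_conj_eq] at h2 ⊢
  have : X.img X.bddDer = ⁅X.img X.bdd, X.img X.bdd⁆ := Subgroup.map_commutator _ _ _
  rw [this, Subgroup.map_commutator, h2]

/-- The derived group of the bounded elements is flexible by itself, so the maps inducing the two
automorphisms are already determined by its point stabilizers. -/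
theorem eq_of_eqOn_bddDer (hX : X ∈ KSpan) {α β : MulAut X.G} (h : ∀ k ∈ X.bddDer, α k = β k) :
    α = β := by
  obtain ⟨τ, hτ, hc⟩ := exists_conjugating hX hX α
  obtain ⟨σ, hσ, hc'⟩ := exists_conjugating hX hX β
  have F := flexible_of_le hX (le_refl X.bddDer)
  have hτσ : τ = σ := by
    ext1 x
    have : σ.symm (τ x) = x := by
      refine F.eq_of_stabilizer fun k hk => ?_
      have hk' : (k : X.G) • x = x := hk
      change (k : X.G) • σ.symm (τ x) = _
      rw [← σ.apply_eq_iff_eq, hc', σ.apply_symm_apply, ← h k k.2, ← hc, hk']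
    rw [← this, σ.apply_symm_apply, this]
  subst hτσ
  exact MulEquiv.ext fun g => (hc g).unique (hc' g)

theorem map_eq_of_conjugates {α : MulAut X.G} {H K : Subgroup X.G} (h1 : ∀ h ∈ H, α h ∈ K)
    (h2 : ∀ k ∈ K, α.symm k ∈ H) : H.map α.toMonoidHom = K := by
  ext k
  constructor
  · rintro ⟨h, hh, rfl⟩
    exact h1 h hh
  · intro hk
    exact ⟨_, h2 k hk, α.apply_symm_apply k⟩

theorem map_lft_rt_of_strictMono {α : MulAut X.G} {τ : X.bar ≃ X.bar} (hτ : StrictMono τ)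
    (hc : ∀ h : X.G, Conjugates τ h (α h)) :
    X.lft.map α.toMonoidHom = X.lft ∧ X.rt.map α.toMonoidHom = X.rt :=
  ⟨map_eq_of_conjugates (fun h hh => (hc h).mem_lft hτ hh) fun k hk =>
      (conjugates_symm hc k).mem_lft (StrictMono.equiv_symm hτ) hk,
    map_eq_of_conjugates (fun h hh => (hc h).mem_rt hτ hh) fun k hk =>
      (conjugates_symm hc k).mem_rt (StrictMono.equiv_symm hτ) hk⟩

theorem map_lft_rt_of_strictAnti {α : MulAut X.G} {τ : X.bar ≃ X.bar} (hτ : StrictAnti τ)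
    (hc : ∀ h : X.G, Conjugates τ h (α h)) :
    X.lft.map α.toMonoidHom = X.rt ∧ X.rt.map α.toMonoidHom = X.lft :=
  ⟨map_eq_of_conjugates (fun h hh => (hc h).mem_rt_of_mem_lft hτ hh) fun k hk =>
      (conjugates_symm hc k).mem_lft_of_mem_rt (StrictAnti.equiv_symm hτ) hk,
    map_eq_of_conjugates (fun h hh => (hc h).mem_lft_of_mem_rt hτ hh) fun k hk =>
      (conjugates_symm hc k).mem_rt_of_mem_lft (StrictAnti.equiv_symm hτ) hk⟩

/-- Monotonic maps normalizing `Lft(G)` or `Rt(G)` preserve the order, unless all elements of the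
group are bounded. -/
theorem strictMono_of_mem_normalizer {H : Subgroup X.G} (hH : H = X.lft ∨ H = X.rt)
    (hne : H ≠ X.bdd) {τ : Equiv.Perm X.bar} (hτ : IsMonotonic τ)
    (hn : τ ∈ Subgroup.normalizer (X.img H : Set (Equiv.Perm X.bar))) : StrictMono τ := by
  refine hτ.resolve_right fun ha => hne ?_
  rcases hH with rfl | rfl
  · refine le_antisymm (fun h hh => ⟨hh, ?_⟩) inf_le_left
    obtain ⟨h', hh', hc⟩ := exists_conjugates_of_mem_normalizer' hn hh
    exact hc.mem_rt_of_mem_lft ha hh'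
  · refine le_antisymm (fun h hh => ⟨?_, hh⟩) inf_le_right
    obtain ⟨h', hh', hc⟩ := exists_conjugates_of_mem_normalizer' hn hh
    exact hc.mem_lft_of_mem_rt ha hh'

end PermGroup

theorem characteristicSubgroups (hX : X ∈ KSpan) : CharacteristicSubgroups X := by
  have hbdd : X.bdd.Characteristic :=
    characteristic_of_conjugates hX fun τ h h' hτ hc hh => hc.mem_bdd hτ hh
  refine ⟨⟨hbdd, inferInstanceAs (⁅X.bdd, X.bdd⁆.Characteristic)⟩, fun α => ?_,
    ⟨autEqNorm_edAut hX le_top, autEqNorm_edAut hX bddDer_le_bdd, autEqNorm_edAut hX le_rfl,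
      norm_le_norm le_top fun τ h h' hτ hc hh => hc.mem_bdd hτ hh, norm_bdd_le_norm_bddDer,
      fun α β h => eq_of_eqOn_bddDer hX h⟩, fun H hH => ?_⟩
  · obtain ⟨τ, hτ | hτ, hc⟩ := exists_conjugating hX hX α
    · exact Or.inl (map_lft_rt_of_strictMono hτ hc)
    · exact Or.inr (map_lft_rt_of_strictAnti hτ hc)
  · have hle : X.bddDer ≤ H := by
      rcases hH with rfl | rfl
      · exact bddDer_le_lft
      · exact bddDer_le_rt
    refine ⟨fun hn α hα => ?_, fun α β h => eq_of_eqOn_bddDer hX fun k hk => h k (hle hk),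
      fun hne => autEqNorm hX hle fun τ hτ hn => strictMono_of_mem_normalizer hH hne hτ hn⟩
    obtain ⟨τ, hτ, hc⟩ := exists_conjugating hX hX α
    have := map_lft_rt_of_strictMono ((mem_oAut_iff hτ hc hn).1 hα) hc
    rcases hH with rfl | rfl
    · exact this.1
    · exact this.2

theorem opp_properties (hX : X ∈ KSpan) : X.opp.Characteristic ∧
    X.AutEqNorm (edAut X.bar) X.opp ∧
    X.norm (edAut X.bar) ⊤ ≤ X.norm (edAut X.bar) X.opp ∧
    X.norm (edAut X.bar) X.opp ≤ X.norm (edAut X.bar) X.bdd :=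
  ⟨characteristic_of_conjugates hX fun _ _ _ hτ hc hh => hc.mem_opp hτ hh,
    autEqNorm_edAut hX (bddDer_le_bdd.trans bdd_le_opp),
    norm_le_norm le_top fun _ _ _ hτ hc hh => hc.mem_opp hτ hh,
    norm_le_norm bdd_le_opp fun _ _ _ hτ hc hh => hc.mem_bdd hτ hh⟩

/-! ### The orbit criterion -/

namespace PermGroup

/-- An equivariant map from the chain to the completion is the inclusion. -/
theorem eq_toCompletion (hX : X ∈ KSpan) {σ : X.L → X.bar}
    (hσ : ∀ (g : X.G) (a : X.L), σ (g • a) = g • σ a) (a : X.L) : σ a = toCompletion a := by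
  refine (flexible hX).eq_of_stabilizer fun g hg => ?_
  rw [X.smul_toCompletion] at hg
  rw [← hσ, toCompletion_strictMono.injective hg]

theorem range_toCompletion_mem_orbits (h : MulAction.IsPretransitive X.G X.L) :
    Set.range (toCompletion (L := X.L)) ∈ X.orbits := by
  refine ⟨toCompletion (Classical.arbitrary X.L), ?_⟩
  ext x
  constructor
  · rintro ⟨g, rfl⟩
    exact ⟨g • Classical.arbitrary X.L, (X.smul_toCompletion _ _).symm⟩
  · rintro ⟨a, rfl⟩
    obtain ⟨g, rfl⟩ := h.exists_smul_eq (Classical.arbitrary X.L) a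
    exact ⟨g, X.smul_toCompletion _ _⟩

theorem edAut_ext_bar {s t : edAut X.L} (h : ∀ x : X.bar, s • x = t • x) : s = t := by
  refine Subtype.ext (Equiv.ext fun a => ?_)
  have := h (toCompletion a)
  rw [NearlyOrdered.smul_toCompletion, NearlyOrdered.smul_toCompletion] at this
  exact toCompletion_strictMono.injective this

theorem smul_bar (g : X.G) (x : X.bar) : g • x = (g : edAut X.L) • x := rfl

/-- If `β` is induced by a permutation of the completion mapping the chain onto itself, then it is
conjugation by a monotonic permutation of the chain. -/
theorem exists_edAut_of_range {τ : X.bar ≃ X.bar} (hτ : IsMonotonic τ) {β : MulAut X.G}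
    (hc : ∀ h : X.G, Conjugates τ h (β h))
    (hr : Set.range (fun a : X.L => τ (toCompletion a)) = Set.range (toCompletion (L := X.L))) :
    ∃ s : edAut X.L, ∀ g : X.G, ((β g : X.G) : edAut X.L) = s * g * s⁻¹ := by
  have h1 : ∀ a : X.L, ∃ b : X.L, toCompletion b = τ (toCompletion a) := fun a => by
    have : τ (toCompletion a) ∈ Set.range (toCompletion (L := X.L)) := hr ▸ ⟨a, rfl⟩
    exact this
  have h2 : ∀ b : X.L, ∃ a : X.L, τ (toCompletion a) = toCompletion b := fun b => by
    have : toCompletion b ∈ Set.range (fun a : X.L => τ (toCompletion a)) := hr ▸ ⟨b, rfl⟩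
    exact this
  choose f hf using h1
  have hbij : Function.Bijective f := by
    constructor
    · intro a b hab
      refine toCompletion_strictMono.injective (τ.injective ?_)
      rw [← hf, ← hf, hab]
    · intro b
      obtain ⟨a, ha⟩ := h2 b
      exact ⟨a, toCompletion_strictMono.injective ((hf a).trans ha)⟩
  have hmono : IsMonotonic (Equiv.ofBijective f hbij) := by
    refine hτ.imp (fun h a b hab => ?_) fun h a b hab => ?_
    · refine toCompletion_strictMono.lt_iff_lt.1 ?_
      change toCompletion (f a) < toCompletion (f b)
      rw [hf, hf]
      exact h (toCompletion_strictMono hab)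
    · refine toCompletion_strictMono.lt_iff_lt.1 ?_
      change toCompletion (f b) < toCompletion (f a)
      rw [hf, hf]
      exact h (toCompletion_strictMono hab)
  refine ⟨⟨Equiv.ofBijective f hbij, mem_edAut_iff.2 hmono⟩, fun g => ?_⟩
  rw [eq_mul_inv_iff_mul_eq]
  refine Subtype.ext (Equiv.ext fun a => toCompletion_strictMono.injective ?_)
  change toCompletion (β g • f a) = toCompletion (f (g • a))
  rw [hf, ← X.smul_toCompletion, ← X.smul_toCompletion, hf, hc]

end PermGroup

/-- Let `τ` induce `β`. An isomorphism from `L` to an orbit twisted by `β` must be `τ` restricted to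
`L`, since equivariant maps are inclusions. Thus the orbit differs from `L` exactly when `τ` does
not map `L` onto itself, that is, when `β` is not conjugation by an automorphism of `ED(L)`. -/
theorem orbitCriterion (hX : X ∈ KSpan) : OrbitCriterion X := by
  intro htr
  constructor
  · rintro ⟨Θ, hΘ⟩ ⟨M, -, hne, σ, β, hM, -, hσ⟩
    obtain ⟨τ, -, hc⟩ := exists_conjugating hX hX β
    have h1 : ∀ a : X.L, σ a = τ (toCompletion a) := fun a => by
      have := eq_toCompletion hX (σ := fun a => τ.symm (σ a)) (fun g a => by
        rw [τ.symm_apply_eq, hc, τ.apply_symm_apply, hσ]) a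
      rw [← this, τ.apply_symm_apply]
    set s := Θ.symm β with hs
    have hβ : ∀ g : X.G, ((β g : X.G) : edAut X.L) = (s : edAut X.L) * g * (s : edAut X.L)⁻¹ := by
      intro g
      rw [← hΘ, hs, Θ.apply_symm_apply]
    -- Both maps induce `β` on the completion; the second is the extension of a permutation of `L`,
    -- so it preserves `L`.
    have h2 : τ = MulAction.toPerm (s : edAut X.L) := induces_unique hX hc fun g x => by
      change (s : edAut X.L) • (g • x) = β g • ((s : edAut X.L) • x)
      rw [smul_bar, smul_bar, hβ, ← mul_smul, ← mul_smul, inv_mul_cancel_right]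
    refine hne (hM ▸ ?_)
    ext x
    constructor
    · rintro ⟨a, rfl⟩
      rw [h1, h2]
      exact ⟨_, (NearlyOrdered.smul_toCompletion (s : edAut X.L) a).symm⟩
    · rintro ⟨a, rfl⟩
      refine ⟨((s : edAut X.L) : Equiv.Perm X.L).symm a, ?_⟩
      rw [h1, h2]
      refine (NearlyOrdered.smul_toCompletion (s : edAut X.L) _).trans ?_
      rw [Equiv.apply_symm_apply]
  · intro hno
    refine ⟨MulEquiv.ofBijective X.G.normalizerMonoidHom ⟨fun s t hst => ?_, fun β => ?_⟩,
      fun σ g => rfl⟩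
    · have key : ∀ (r : Subgroup.normalizer (X.G : Set (edAut X.L))) (g : X.G) (x : X.bar),
          (r : edAut X.L) • g • x = X.G.normalizerMonoidHom r g • (r : edAut X.L) • x := by
        intro r g x
        have : ((X.G.normalizerMonoidHom r g : X.G) : edAut X.L) =
          (r : edAut X.L) * g * (r : edAut X.L)⁻¹ := rfl
        rw [smul_bar, smul_bar, this, ← mul_smul, ← mul_smul, inv_mul_cancel_right]
      have := induces_unique hX (τ := MulAction.toPerm (s : edAut X.L))
        (σ := MulAction.toPerm (t : edAut X.L)) (α := X.G.normalizerMonoidHom s)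
        (fun g x => key s g x) (by rw [hst]; exact fun g x => key t g x)
      exact Subtype.ext (edAut_ext_bar fun x => congrArg (fun p : X.bar ≃ X.bar => p x) this)
    · obtain ⟨τ, hτ, hc⟩ := exists_conjugating hX hX β
      have hr : Set.range (fun a : X.L => τ (toCompletion a)) =
          Set.range (toCompletion (L := X.L)) := by
        -- If `τ` moved `L`, its image would be another orbit isomorphic to `L` or to its reverse,
        -- which is excluded.
        by_contra hne
        refine hno ⟨_, ?_, hne, fun a => τ (toCompletion a), β, rfl, hτ.comp
          (Or.inl toCompletion_strictMono), fun g a => ?_⟩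
        · have := (bijOn_orbits hc).mapsTo (range_toCompletion_mem_orbits htr)
          change τ '' _ ∈ _ at this
          rwa [← Set.range_comp] at this
        · change τ (toCompletion (g • a)) = β g • τ (toCompletion a)
          rw [← X.smul_toCompletion, hc]
      obtain ⟨s, hs⟩ := exists_edAut_of_range hτ hc hr
      have hn : s ∈ Subgroup.normalizer (X.G : Set (edAut X.L)) := by
        rw [Subgroup.mem_normalizer_iff]
        intro g
        constructor
        · intro hg
          rw [← hs ⟨g, hg⟩]
          exact (β ⟨g, hg⟩).2
        · intro hg
          have h1 := hs (β.symm ⟨_, hg⟩)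
          rw [β.apply_symm_apply] at h1
          have h2 : g = (β.symm ⟨_, hg⟩ : X.G) := by simpa using h1
          rw [h2]
          exact (β.symm ⟨_, hg⟩ : X.G).2
      exact ⟨⟨s, hn⟩, MulEquiv.ext fun g => Subtype.ext (hs g).symm⟩

end NearlyOrdered

namespace NearlyOrdered

/-! ### Uniform definability -/

/-- Uniform definability in the structures `M i`, with parameters from `E i`, abstracted from a
logic: a collection of predicates closed under the first order operations. -/
structure Definability {ι : Type*} (M : ι → Type u) (E : ι → Type*) where
  /-- the definable predicates -/
  Def : ∀ {α : Type}, (∀ i, E i → (α → M i) → Prop) → Prop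
  falsum : ∀ {α : Type}, Def (α := α) fun _ _ _ => False
  imp : ∀ {α : Type} {P Q : ∀ i, E i → (α → M i) → Prop}, Def P → Def Q →
    Def fun i e v => P i e v → Q i e v
  all : ∀ {α : Type} {P : ∀ i, E i → (α → M i) → M i → Prop},
    Def (α := Option α) (fun i e v => P i e (fun a => v (some a)) (v none)) →
      Def fun i e v => ∀ x, P i e v x
  eq : ∀ {α : Type} (a b : α), Def fun _ _ v => v a = v b
  relabel : ∀ {α β : Type} {P : ∀ i, E i → (α → M i) → Prop} (f : α → β), Def P →
    Def fun i e v => P i e fun a => v (f a)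

namespace Definability

section Basic

variable {ι : Type*} {M : ι → Type u} {E : ι → Type*} (D : Definability M E) {α : Type}

theorem congr {P Q : ∀ i, E i → (α → M i) → Prop} (hP : D.Def P)
    (h : ∀ i e v, Q i e v ↔ P i e v) : D.Def Q := by
  have : Q = P := by
    funext i e v
    exact propext (h i e v)
  rwa [this]

variable {D}

theorem not {P : ∀ i, E i → (α → M i) → Prop} (hP : D.Def P) : D.Def fun i e v => ¬ P i e v :=
  D.imp hP D.falsum

theorem or {P Q : ∀ i, E i → (α → M i) → Prop} (hP : D.Def P) (hQ : D.Def Q) :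
    D.Def fun i e v => P i e v ∨ Q i e v :=
  D.congr (D.imp (not hP) hQ) fun _ _ _ => or_iff_not_imp_left

theorem and {P Q : ∀ i, E i → (α → M i) → Prop} (hP : D.Def P) (hQ : D.Def Q) :
    D.Def fun i e v => P i e v ∧ Q i e v :=
  D.congr (not (D.imp hP (not hQ))) fun _ _ _ => by rw [Classical.not_imp, not_not]

theorem ex {P : ∀ i, E i → (α → M i) → M i → Prop}
    (hP : D.Def (α := Option α) (fun i e v => P i e (fun a => v (some a)) (v none))) :
    D.Def fun i e v => ∃ x, P i e v x :=
  D.congr (not (D.all (P := fun i e v x => ¬ P i e v x) (not hP))) fun _ _ _ => by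
    rw [not_forall_not]

theorem iff {P Q : ∀ i, E i → (α → M i) → Prop} (hP : D.Def P) (hQ : D.Def Q) :
    D.Def fun i e v => P i e v ↔ Q i e v :=
  D.congr (and (D.imp hP hQ) (D.imp hQ hP)) fun _ _ _ => iff_iff_implies_and_implies

theorem allFin {k : ℕ} {P : Fin k → ∀ i, E i → (α → M i) → Prop} (hP : ∀ j, D.Def (P j)) :
    D.Def fun i e v => ∀ j, P j i e v := by
  induction k with
  | zero => exact D.congr (D.imp D.falsum D.falsum) fun _ _ _ => by simp
  | succ k ih =>
    exact D.congr (and (hP 0) (ih fun j => hP j.succ)) fun _ _ _ => Fin.forall_fin_succ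

theorem exFin {k : ℕ} {P : Fin k → ∀ i, E i → (α → M i) → Prop} (hP : ∀ j, D.Def (P j)) :
    D.Def fun i e v => ∃ j, P j i e v :=
  D.congr (not (allFin fun j => not (hP j))) fun _ _ _ => by rw [not_forall_not]

theorem exTuple {k : ℕ} {α : Type} {P : ∀ i, E i → (α → M i) → (Fin k → M i) → Prop}
    (hP : D.Def (α := α ⊕ Fin k) fun i e v => P i e (fun a => v (.inl a)) fun j => v (.inr j)) :
    D.Def fun i e v => ∃ u, P i e v u := by
  induction k generalizing α with
  | zero =>
    refine D.congr (D.relabel (β := α) (Sum.elim id Fin.elim0) hP) fun i e v =>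
      ⟨fun ⟨u, hu⟩ => ?_, fun hu => ⟨_, hu⟩⟩
    rwa [Subsingleton.elim u] at hu
  | succ k ih =>
    refine D.congr (ex (P := fun i e v x => ∃ u, P i e v (Fin.cons x u)) (ih ?_))
      fun i e v => Fin.exists_fin_succ_pi
    refine D.congr (D.relabel (β := Option α ⊕ Fin k) (fun o => o.elim (fun a => .inl (some a))
      fun j => Fin.cases (.inl none) .inr j) hP) fun i e v => ?_
    refine iff_of_eq (congrArg (P i e _) ?_)
    funext j
    refine Fin.cases rfl (fun j => rfl) j

/-- Definable sets of elements of the structures. -/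
def DefSet (D : Definability M E) (P : ∀ i, E i → (α → M i) → Set (M i)) : Prop :=
  D.Def (α := Option α) fun i e v => v none ∈ P i e fun a => v (some a)

theorem mem {β : Type} {P : ∀ i, E i → (α → M i) → Set (M i)} (hP : D.DefSet P) (f : α → β)
    (b : β) : D.Def fun i e v => v b ∈ P i e fun a => v (f a) :=
  D.relabel (P := fun i e v => v none ∈ P i e fun a => v (some a)) (fun o => o.elim b f) hP

theorem subset {P Q : ∀ i, E i → (α → M i) → Set (M i)} (hP : D.DefSet P) (hQ : D.DefSet Q) :
    D.Def fun i e v => P i e v ⊆ Q i e v :=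
  D.all (P := fun i e v x => x ∈ P i e v → x ∈ Q i e v) (D.imp hP hQ)

end Basic

section Pairs

variable {ι : Type*} {M : ι → Type u} {E : ι → Type*}

/-- Definability for pairs of elements. -/
def pair (D : Definability M E) : Definability (fun i => Fin 2 → M i) E where
  Def {α} P := D.Def (α := α × Fin 2) fun i e v => P i e fun a j => v (a, j)
  falsum := D.falsum
  imp hP hQ := D.imp hP hQ
  all {α P} hP := by
    have h : D.Def (α := α × Fin 2) fun i e v => ∀ x y, P i e (fun a j => v (a, j)) ![x, y] := by
      refine D.all (D.all (P := fun i e v y => P i e (fun a j => v (some (a, j))) ![v none, y]) ?_)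
      refine D.congr (D.relabel (α := Option α × Fin 2) (fun p => p.1.elim
        (![some none, none] p.2) fun a => some (some (a, p.2))) hP) fun i e v => ?_
      refine iff_of_eq (congrArg (P i e _) ?_)
      funext j
      fin_cases j <;> rfl
    refine D.congr h fun i e v => ⟨fun h x y => h ![x, y], fun h x => ?_⟩
    have : x = ![x 0, x 1] := by
      funext j
      fin_cases j <;> rfl
    rw [this]
    exact h _ _
  eq a b := D.congr (and (D.eq (a, 0) (b, 0)) (D.eq (a, 1) (b, 1))) fun i e v => by
    simp [funext_iff, Fin.forall_fin_two]
  relabel f hP := D.relabel (fun p => (f p.1, p.2)) hP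

end Pairs

section FirstOrder

variable (𝓛 : FirstOrder.Language.{0, 0}) {ι : Type*} (M : ι → Type u) [∀ i, 𝓛.Structure (M i)]
  {γ : Type} {E : ι → Type*} (par : ∀ i, E i → γ → M i)

/-- First order definability with parameters. -/
def fo : Definability M E where
  Def {α} P := ∃ φ : 𝓛.Formula (α ⊕ γ), ∀ i e v, φ.Realize (Sum.elim v (par i e)) ↔ P i e v
  falsum := ⟨⊥, fun i e v => by simp⟩
  imp := fun ⟨φ, hφ⟩ ⟨ψ, hψ⟩ => ⟨φ.imp ψ, fun i e v => by
    rw [FirstOrder.Language.Formula.realize_imp, hφ, hψ]⟩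
  all := fun {α P} ⟨φ, hφ⟩ => by
    refine ⟨(φ.relabel (Sum.elim (fun o => o.elim (.inr ()) fun a => .inl (.inl a))
      fun c => .inl (.inr c)) : 𝓛.Formula ((α ⊕ γ) ⊕ Unit)).iAlls Unit, fun i e v => ?_⟩
    rw [FirstOrder.Language.Formula.realize_iAlls]
    have key : ∀ x : Unit → M i, Sum.elim (Sum.elim v (par i e)) x ∘
        (Sum.elim (fun o : Option α => o.elim (.inr ()) fun a => .inl (.inl a))
          fun c => .inl (.inr c)) = Sum.elim (fun o : Option α => o.elim (x ()) v) (par i e) := by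
      intro x
      funext o
      rcases o with (_ | _) | _ <;> rfl
    simp only [FirstOrder.Language.Formula.realize_relabel, key, hφ]
    exact ⟨fun h x => h fun _ => x, fun h x => h (x ())⟩
  eq a b := ⟨(FirstOrder.Language.var (.inl a)).equal (FirstOrder.Language.var (.inl b)),
    fun i e v => by simp⟩
  relabel f := fun ⟨φ, hφ⟩ => ⟨φ.relabel (Sum.map f id), fun i e v => by
    rw [FirstOrder.Language.Formula.realize_relabel, Sum.elim_comp_map]
    exact hφ i e (v ∘ f)⟩

theorem fo_rel {α : Type} {n : ℕ} (R : 𝓛.Relations n) (t : Fin n → α) :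
    (fo 𝓛 M par).Def fun _ _ v => FirstOrder.Language.Structure.RelMap R fun j => v (t j) :=
  ⟨R.formula fun j => FirstOrder.Language.var (.inl (t j)), fun i e v => by
    rw [FirstOrder.Language.Formula.realize_rel]; rfl⟩

theorem fo_def_iff [IsEmpty γ] {α : Type} {P : ∀ i, E i → (α → M i) → Prop} :
    (fo 𝓛 M par).Def P ↔ ∃ φ : 𝓛.Formula α, ∀ i (_ : E i) v, φ.Realize v ↔ P i ‹_› v := by
  constructor
  · rintro ⟨φ, hφ⟩
    refine ⟨φ.relabel (Sum.elim id isEmptyElim), fun i e v => ?_⟩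
    rw [← hφ, FirstOrder.Language.Formula.realize_relabel]
    refine iff_of_eq (congrArg _ ?_)
    funext o
    rcases o with _ | o
    · rfl
    · exact isEmptyElim o
  · rintro ⟨φ, hφ⟩
    refine ⟨φ.relabel Sum.inl, fun i e v => ?_⟩
    rw [← hφ, FirstOrder.Language.Formula.realize_relabel]
    rfl

end FirstOrder

end Definability

/-! ### Second order definability -/

namespace SOFormula

variable {𝓛 : FirstOrder.Language.{0, 0}}

/-- Renaming of the first order variables of a second order formula. -/
def relabel : {α β γ : Type} → {r : β → ℕ} → (α → γ) → SOFormula 𝓛 α β r → SOFormula 𝓛 γ β r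
  | _, _, _, _, _, .falsum => .falsum
  | _, _, _, _, f, .eq t₁ t₂ => .eq (t₁.relabel f) (t₂.relabel f)
  | _, _, _, _, f, .rel R t => .rel R fun i => (t i).relabel f
  | _, _, _, _, f, .var b t => .var b fun i => (t i).relabel f
  | _, _, _, _, f, .imp φ ψ => .imp (φ.relabel f) (ψ.relabel f)
  | _, _, _, _, f, .all φ => .all (φ.relabel (Option.map f))
  | _, _, _, _, f, .allRel n φ => .allRel n (φ.relabel f)

theorem realize_relabel {M : Type u} [𝓛.Structure M] {α β γ : Type} {r : β → ℕ} (f : α → γ)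
    (φ : SOFormula 𝓛 α β r) (v : γ → M) (V : (b : β) → Set (Fin (r b) → M)) :
    (φ.relabel f).Realize v V ↔ φ.Realize (fun a => v (f a)) V := by
  induction φ generalizing γ with
  | falsum => rfl
  | eq t₁ t₂ => simp only [relabel, Realize, FirstOrder.Language.Term.realize_relabel]; rfl
  | rel R t => simp only [relabel, Realize, FirstOrder.Language.Term.realize_relabel]; rfl
  | var b t => simp only [relabel, Realize, FirstOrder.Language.Term.realize_relabel]; rfl
  | imp φ ψ h₁ h₂ => simp only [relabel, Realize, h₁, h₂]
  | all φ h =>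
    simp only [relabel, Realize, h]
    refine forall_congr' fun x => iff_of_eq (congrArg (φ.Realize · V) ?_)
    funext o
    cases o <;> rfl
  | allRel n φ h => simp only [relabel, Realize, h]

/-- Renaming of the relation variables of a second order formula. -/
def relabelRel : {α β δ : Type} → {r : β → ℕ} → {s : δ → ℕ} → (g : β → δ) →
    (∀ b, s (g b) = r b) → SOFormula 𝓛 α β r → SOFormula 𝓛 α δ s
  | _, _, _, _, _, _, _, .falsum => .falsum
  | _, _, _, _, _, _, _, .eq t₁ t₂ => .eq t₁ t₂
  | _, _, _, _, _, _, _, .rel R t => .rel R t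
  | _, _, _, _, _, g, h, .var b t => .var (g b) fun i => t (i.cast (h b))
  | _, _, _, _, _, g, h, .imp φ ψ => .imp (φ.relabelRel g h) (ψ.relabelRel g h)
  | _, _, _, _, _, g, h, .all φ => .all (φ.relabelRel g h)
  | _, _, _, _, _, g, h, .allRel n φ => .allRel n (φ.relabelRel (Option.map g) fun o => by
      cases o
      · rfl
      · exact h _)

theorem realize_relabelRel {M : Type u} [𝓛.Structure M] {α β δ : Type} {r : β → ℕ} {s : δ → ℕ}
    (g : β → δ) (h : ∀ b, s (g b) = r b) (φ : SOFormula 𝓛 α β r) (v : α → M)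
    (V : (b : δ) → Set (Fin (s b) → M)) :
    (φ.relabelRel g h).Realize v V ↔
      φ.Realize v fun b => {w | (fun i => w (i.cast (h b))) ∈ V (g b)} := by
  induction φ generalizing δ with
  | falsum => rfl
  | eq t₁ t₂ => rfl
  | rel R t => rfl
  | var b t => rfl
  | imp φ ψ h₁ h₂ => simp only [relabelRel, Realize, h₁, h₂]
  | all φ ih => simp only [relabelRel, Realize, ih]
  | allRel n φ ih =>
    simp only [relabelRel, Realize, ih]
    refine forall_congr' fun A => iff_of_eq (congrArg (φ.Realize v) ?_)
    funext o
    cases o <;> rfl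

end SOFormula

namespace Definability

section SecondOrder

variable (𝓛 : FirstOrder.Language.{0, 0}) {ι : Type*} (M : ι → Type u) [∀ i, 𝓛.Structure (M i)]

/-- Second order definability, with relations as parameters. -/
def so {β : Type} (r : β → ℕ) : Definability M fun i => (b : β) → Set (Fin (r b) → M i) where
  Def {α} P := ∃ φ : SOFormula 𝓛 α β r, ∀ i V v, φ.Realize v V ↔ P i V v
  falsum := ⟨.falsum, fun _ _ _ => Iff.rfl⟩
  imp := fun ⟨φ, hφ⟩ ⟨ψ, hψ⟩ => ⟨.imp φ ψ, fun i V v => by rw [SOFormula.Realize, hφ, hψ]⟩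
  all := fun ⟨φ, hφ⟩ => ⟨.all φ, fun i V v => by simp only [SOFormula.Realize, hφ]; rfl⟩
  eq a b := ⟨.eq (FirstOrder.Language.var a) (FirstOrder.Language.var b), fun _ _ _ => Iff.rfl⟩
  relabel f := fun ⟨φ, hφ⟩ => ⟨φ.relabel f, fun i V v => by
    rw [SOFormula.realize_relabel]; exact hφ _ _ _⟩

theorem so_var {β : Type} (r : β → ℕ) {α : Type} (b : β) (t : Fin (r b) → α) :
    (so 𝓛 M r).Def fun _ V v => (fun i => v (t i)) ∈ V b :=
  ⟨.var b fun i => FirstOrder.Language.var (t i), fun _ _ _ => Iff.rfl⟩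

/-- Second order definability for pairs consisting of an element and a set of elements. -/
def soPair : Definability (fun i => M i × Set (Fin 1 → M i)) fun _ => Unit where
  Def {α} P := (so 𝓛 M fun _ : α => 1).Def (α := α) fun i V v => P i ⟨⟩ fun a => (v a, V a)
  falsum := (so 𝓛 M _).falsum
  imp hP hQ := (so 𝓛 M _).imp hP hQ
  all {α P} := fun ⟨φ, hφ⟩ => by
    -- The renaming along `id` is needed because the arities produced by `allRel` agree with the
    -- constant `1` only after a case distinction.
    refine ⟨.allRel 1 (.all (φ.relabelRel (s := fun o : Option α => o.elim 1 fun _ => 1) id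
      fun o => by cases o <;> rfl)), fun i V v => ?_⟩
    simp only [SOFormula.Realize, SOFormula.realize_relabelRel, hφ, Prod.forall]
    refine forall_comm.trans (forall_congr' fun x => forall_congr' fun A => ?_)
    rfl
  eq a b := by
    refine congr _ (and ((so 𝓛 M _).eq a b) ((so 𝓛 M _).all
      (P := fun i V v x => (fun _ => x) ∈ V a ↔ (fun _ => x) ∈ V b)
      (iff (so_var 𝓛 M _ a fun _ => none) (so_var 𝓛 M _ b fun _ => none)))) fun i V v => ?_
    change (v a, V a) = (v b, V b) ↔ _
    rw [Prod.mk.injEq]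
    refine and_congr_right fun _ => ⟨fun h x => by rw [h], fun h => ?_⟩
    ext w
    have : w = fun _ => w 0 := by
      funext j
      rw [Subsingleton.elim j 0]
    rw [this]
    exact h _
  relabel f := fun ⟨φ, hφ⟩ => ⟨(φ.relabel f).relabelRel f fun _ => rfl, fun i V v => by
    rw [SOFormula.realize_relabelRel, SOFormula.realize_relabel]; exact hφ _ _ _⟩

end SecondOrder

/-! ### Definability in decoded structures -/

section Translation

variable {ι : Type*} {C : ι → Type u} {E : ι → Type*} (D : Definability C E)
  {𝓛 : FirstOrder.Language.{0, 0}} [𝓛.IsRelational] {M : ι → Type u} [∀ i, 𝓛.Structure (M i)]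

/-- If all elements of relational structures are decoded from codes so that equality and the
relations are definable for the codes, then everything that is first order definable in the
structures is definable for the codes. -/
theorem def_of_decoding (d : ∀ i, E i → C i → M i) (hd : ∀ i e, Function.Surjective (d i e))
    (heq : ∀ {α : Type} (a b : α), D.Def fun i e v => d i e (v a) = d i e (v b))
    (hrel : ∀ {α : Type} {n : ℕ} (R : 𝓛.Relations n) (t : Fin n → α),
      D.Def fun i e v => FirstOrder.Language.Structure.RelMap R fun j => d i e (v (t j)))
    {α : Type} (φ : 𝓛.Formula α) : D.Def fun i e v => φ.Realize fun a => d i e (v a) := by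
  -- The language is relational, so terms are variables.
  have hterm : ∀ {β : Type} (t : 𝓛.Term β), ∃ b, t = FirstOrder.Language.var b := by
    intro β t
    cases t with
    | var b => exact ⟨b, rfl⟩
    | func f _ => exact isEmptyElim f
  have key : ∀ {n : ℕ} (φ : 𝓛.BoundedFormula α n), D.Def (α := α ⊕ Fin n) fun i e v =>
      φ.Realize (fun a => d i e (v (.inl a))) fun j => d i e (v (.inr j)) := by
    intro n φ
    have hsum : ∀ (i) (e) {n : ℕ} (v : α ⊕ Fin n → C i) (o : α ⊕ Fin n),
        Sum.elim (fun a => d i e (v (.inl a))) (fun j => d i e (v (.inr j))) o = d i e (v o) := by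
      intro i e n v o
      cases o <;> rfl
    induction φ with
    | falsum => exact D.falsum
    | equal t₁ t₂ =>
      obtain ⟨b₁, rfl⟩ := hterm t₁
      obtain ⟨b₂, rfl⟩ := hterm t₂
      refine D.congr (heq b₁ b₂) fun i e v => ?_
      rw [← hsum, ← hsum]
      rfl
    | rel R t =>
      choose b hb using fun j => hterm (t j)
      refine D.congr (hrel R b) fun i e v => ?_
      refine iff_of_eq (congrArg (FirstOrder.Language.Structure.RelMap R) (funext fun j => ?_))
      rw [hb, ← hsum]
      rfl
    | imp φ ψ h₁ h₂ => exact D.imp h₁ h₂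
    | @all n φ h =>
      refine D.congr (D.all (P := fun i e v x => φ.Realize (fun a => d i e (v (.inl a)))
        (Fin.snoc (fun j => d i e (v (.inr j))) (d i e x))) ?_) fun i e v => ?_
      · refine D.congr (D.relabel (β := Option (α ⊕ Fin n)) (Sum.elim (fun a => some (.inl a))
          (Fin.snoc (fun j => some (.inr j)) none)) h) fun i e v => ?_
        refine iff_of_eq (congrArg (φ.Realize _) ?_)
        funext j
        refine Fin.lastCases ?_ (fun j => ?_) j <;> simp
      -- Surjectivity of the decoding turns the quantifier over codes into one over elements.
      · exact (hd i e).forall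
  refine D.congr (D.relabel (Sum.elim id Fin.elim0) (key φ)) fun i e v => ?_
  refine iff_of_eq (congrArg (FirstOrder.Language.BoundedFormula.Realize φ _) ?_)
  exact Subsingleton.elim _ _

end Translation

end Definability

end NearlyOrdered

namespace NearlyOrdered

namespace Definability

/-! ### Definability of the group theoretic predicates -/

section Group

variable {ι : Type*} {M : ι → Type u} {E : ι → Type*} [∀ i, Group (M i)]

/-- Multiplication is definable. -/
def HasMul (D : Definability M E) : Prop :=
  ∀ {α : Type} (a b c : α), D.Def fun _ _ v => v a * v b = v c

variable {D : Definability M E}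

/-- Definable functions. -/
def DefTerm (D : Definability M E) {α : Type} (t : ∀ i, E i → (α → M i) → M i) : Prop :=
  D.Def (α := Option α) fun i e v => t i e (fun a => v (some a)) = v none

theorem defTerm_var {α : Type} (a : α) : D.DefTerm fun _ _ v => v a := D.eq (some a) none

/-- Compound terms are unravelled by quantifying over the intermediate values. -/
theorem DefTerm.mul {α : Type} {t s : ∀ i, E i → (α → M i) → M i} (hD : D.HasMul)
    (ht : D.DefTerm t) (hs : D.DefTerm s) : D.DefTerm fun i e v => t i e v * s i e v := by
  refine D.congr (ex (P := fun i e v x => t i e (fun a => v (some a)) = x ∧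
    ∃ y, s i e (fun a => v (some a)) = y ∧ x * y = v none) (and ?_ (ex (and ?_ ?_))))
    fun i e v => by simp
  · exact D.relabel (fun o : Option α => o.elim none fun a => some (some a)) ht
  · exact D.relabel (fun o : Option α => o.elim none fun a => some (some (some a))) hs
  · exact hD _ _ _

theorem DefTerm.eq {α : Type} {t s : ∀ i, E i → (α → M i) → M i}
    (ht : D.DefTerm t) (hs : D.DefTerm s) : D.Def fun i e v => t i e v = s i e v :=
  D.congr (ex (P := fun i e v x => t i e v = x ∧ s i e v = x) (and ht hs)) fun i e v => by simp [eq_comm]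

theorem algDisj (hD : D.HasMul) {α : Type} (a b : α) :
    D.Def fun _ _ v => AlgDisj (v a) (v b) := by
  unfold AlgDisj
  refine D.all (D.imp (not ?_) (ex (ex (ex (ex (and ?_ (and ?_ (and ?_ (and ?_ (and (not ?_)
    ?_))))))))))
  all_goals
    refine DefTerm.eq ?_ ?_ <;>
    first
    | exact defTerm_var _
    | exact (defTerm_var _).mul hD (defTerm_var _)
    | exact (defTerm_var _).mul hD ((defTerm_var _).mul hD (defTerm_var _))

theorem sub (hD : D.HasMul) {α : Type} (a b : α) : D.Def fun _ _ v => Sub (v a) (v b) := by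
  unfold Sub
  refine D.all (D.imp (algDisj hD _ _) (DefTerm.eq ((defTerm_var _).mul hD
    ((defTerm_var _).mul hD (defTerm_var _))) (((defTerm_var _).mul hD
    (defTerm_var _)).mul hD (defTerm_var _))))

theorem dj (hD : D.HasMul) {α : Type} (a b : α) : D.Def fun _ _ v => Dj (v a) (v b) := by
  unfold Dj
  exact D.all (D.imp (sub hD _ _) (D.imp (sub hD _ _) (hD _ _ _)))

variable {α : Type} {P Q : ∀ i, E i → (α → M i) → Set (M i)}

theorem perp (hD : D.HasMul) (hP : D.DefSet P) : D.DefSet fun i e v => Perp (P i e v) := by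
  unfold DefSet
  exact D.all (D.imp (mem hP _ _) (dj hD _ _))

theorem conv (hD : D.HasMul) (hP : D.DefSet P) : D.Def fun i e v => Conv (P i e v) := by
  unfold Conv
  exact D.all (D.all (D.imp (mem hP _ _) (D.imp (mem hP _ _) (D.imp (not (hD _ _ _))
    (D.imp (not (hD _ _ _)) (ex (ex (and (mem hP _ _) (and (DefTerm.eq
      ((defTerm_var _).mul hD (defTerm_var _)) ((defTerm_var _).mul hD (defTerm_var _)))
      (not (dj hD _ _)))))))))))

theorem isRayP (hD : D.HasMul) (hP : D.DefSet P) : D.Def fun i e v => IsRayP (P i e v) := by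
  unfold IsRayP
  exact and (D.all (D.imp (perp hD (perp hD hP)) hP)) (and (conv hD hP) (and (conv hD (perp hD hP))
    (and (ex (and hP (not (hD _ _ _)))) (ex (and (perp hD hP) (not (hD _ _ _)))))))

theorem comp (hD : D.HasMul) (a b : α) : D.DefSet fun _ _ v => Comp (v a) (v b) := by
  unfold DefSet
  exact and (dj hD _ _) (D.all (D.imp (not (hD _ _ _)) (D.imp (sub hD _ _) (ex (ex (and (dj hD _ _)
    (and (DefTerm.eq ((defTerm_var _).mul hD (defTerm_var _)) ((defTerm_var _).mul hD
      (defTerm_var _))) (not (dj hD _ _)))))))))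

theorem conjSet (hD : D.HasMul) (a : α) (hP : D.DefSet P) :
    D.DefSet fun i e v => NearlyOrdered.conjSet (v a) (P i e v) := by
  unfold DefSet
  exact ex (and (mem hP _ _) (DefTerm.eq ((defTerm_var _).mul hD (defTerm_var _))
    ((defTerm_var _).mul hD (defTerm_var _))))

theorem sameP (hD : D.HasMul) (hP : D.DefSet P) (hQ : D.DefSet Q) :
    D.Def fun i e v => SameP (P i e v) (Q i e v) :=
  or (and (subset hP hQ) (subset hQ hP)) (and (subset (perp hD hP) hQ) (subset hQ (perp hD hP)))

theorem eitherP (hD : D.HasMul) {Φ : ∀ i, E i → (α → M i) → Set (M i) → Prop} (hP : D.DefSet P)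
    (hΦ : ∀ Q : ∀ i, E i → (α → M i) → Set (M i), D.DefSet Q →
      D.Def fun i e v => Φ i e v (Q i e v)) :
    D.Def fun i e v => EitherP (Φ i e v) (P i e v) :=
  or (hΦ _ hP) (hΦ _ (perp hD hP))

theorem edP (hD : D.HasMul) {P₁ P₂ Q₁ Q₂ : ∀ i, E i → (α → M i) → Set (M i)} (h₁ : D.DefSet P₁)
    (h₂ : D.DefSet P₂) (h₃ : D.DefSet Q₁) (h₄ : D.DefSet Q₂) :
    D.Def fun i e v => EdP (P₁ i e v) (P₂ i e v) (Q₁ i e v) (Q₂ i e v) := by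
  unfold EdP
  refine eitherP hD h₁ fun A₁ hA₁ => eitherP hD h₂ fun A₂ hA₂ => eitherP hD h₃ fun C₁ hC₁ =>
    eitherP hD h₄ fun C₂ hC₂ => ?_
  exact and (and (subset hA₁ hA₂) (not (subset hA₂ hA₁))) (and (and (subset hC₁ hC₂)
    (not (subset hC₂ hC₁))) (or (subset hA₁ hC₁) (subset hC₁ hA₁)))

end Group

end Definability

/-! ### Decoding -/

/-- The relations of the structure of the action, for points and group elements given by a family
of group elements (in case of a point) and a group element. -/
def ActSpec {H : Type*} [Mul H] : ∀ {m : ℕ}, ActRel m → (Fin m → Set H) → (Fin m → H) → Prop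
  | _, .pt, S, _ => IsRayP (S 0)
  | _, .grp, S, _ => ¬ IsRayP (S 0)
  | _, .ed, S, _ => (∀ j, IsRayP (S j)) ∧ EdP (S 0) (S 1) (S 2) (S 3)
  | _, .mul, S, g => (∀ j, ¬ IsRayP (S j)) ∧ g 0 * g 1 = g 2
  | _, .ap, S, g => ¬ IsRayP (S 0) ∧ IsRayP (S 1) ∧ IsRayP (S 2) ∧ SameP (conjSet (g 0) (S 1)) (S 2)

/-- The equality relation, for points and group elements given as in `ActSpec`. -/
def EqSpec {H : Type*} [Mul H] (S T : Set H) (g h : H) : Prop :=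
  (IsRayP S ∧ IsRayP T ∧ SameP S T) ∨ (¬ IsRayP S ∧ ¬ IsRayP T ∧ g = h)

namespace Definability

variable {ι : Type*} {M : ι → Type u} {E : ι → Type*} [∀ i, Group (M i)] {D : Definability M E}
  {α : Type}

theorem actSpec (hD : D.HasMul) {m : ℕ} (R : ActRel m)
    {S : Fin m → ∀ i, E i → (α → M i) → Set (M i)} (hS : ∀ j, D.DefSet (S j)) (g : Fin m → α) :
    D.Def fun i e v => ActSpec R (fun j => S j i e v) fun j => v (g j) := by
  have hR := fun j => isRayP hD (hS j)
  cases R with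
  | pt => exact hR 0
  | grp => exact not (hR 0)
  | ed => exact and (allFin hR) (edP hD (hS 0) (hS 1) (hS 2) (hS 3))
  | mul => exact and (allFin fun j => not (hR j)) (hD _ _ _)
  | ap => exact and (not (hR 0)) (and (hR 1) (and (hR 2) (sameP hD (conjSet hD _ (hS 1)) (hS 2))))

theorem eqSpec (hD : D.HasMul) {S T : ∀ i, E i → (α → M i) → Set (M i)} (hS : D.DefSet S)
    (hT : D.DefSet T) (g h : α) :
    D.Def fun i e v => EqSpec (S i e v) (T i e v) (v g) (v h) :=
  or (and (isRayP hD hS) (and (isRayP hD hT) (sameP hD hS hT)))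
    (and (not (isRayP hD hS)) (and (not (isRayP hD hT)) (D.eq _ _)))

end Definability

namespace PermGroup

variable (X : PermGroup.{u}) (T : Set X.bar)

open Classical in
/-- The point or group element given by a family of group elements and a group element. -/
def decode (S : Set X.G) (g : X.G) : X.Act T ⊤ :=
  if h : ∃ x : T, RayAt (x : X.bar) S then Act.point h.choose else Act.ofG g

/-- If a family of group elements represents a point, then it represents a point of `T`. -/
def Admissible (S : Set X.G) : Prop := IsRayP S → ∃ x : T, RayAt (x : X.bar) S

variable {X T}

theorem decode_of_rayAt (hX : X ∈ KSpan) {S : Set X.G} {x : T} (h : RayAt (x : X.bar) S)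
    (g : X.G) : X.decode T S g = Act.point x := by
  have h' : ∃ x : T, RayAt (x : X.bar) S := ⟨x, h⟩
  rw [decode, dif_pos h']
  exact congrArg _ (Subtype.ext ((flexible hX).rayAt_unique h'.choose_spec h))

theorem decode_of_not (hX : X ∈ KSpan) {S : Set X.G} (h : ¬ IsRayP S) (g : X.G) :
    X.decode T S g = Act.ofG g :=
  dif_neg fun ⟨_, hx⟩ => h ((flexible hX).isRayP_of_rayAt hx)

theorem decode_cases (hX : X ∈ KSpan) {S : Set X.G} (hS : X.Admissible T S) (g : X.G) :
    (IsRayP S ∧ ∃ x : T, RayAt (x : X.bar) S ∧ X.decode T S g = Act.point x) ∨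
      (¬ IsRayP S ∧ X.decode T S g = Act.ofG g) := by
  by_cases h : IsRayP S
  · obtain ⟨x, hx⟩ := hS h
    exact Or.inl ⟨h, x, hx, decode_of_rayAt hX hx g⟩
  · exact Or.inr ⟨h, decode_of_not hX h g⟩

theorem Act.ofG_injective {g h : X.G} (e : (Act.ofG g : X.Act T ⊤) = Act.ofG h) : g = h :=
  congrArg Subtype.val (Act.elt_injective e)

theorem decode_eq_iff (hX : X ∈ KSpan) {S S' : Set X.G} (hS : X.Admissible T S)
    (hS' : X.Admissible T S') (g g' : X.G) :
    X.decode T S g = X.decode T S' g' ↔ EqSpec S S' g g' := by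
  have F := flexible hX
  unfold EqSpec
  rcases decode_cases hX hS g with ⟨h, x, hx, e⟩ | ⟨h, e⟩ <;>
    rcases decode_cases hX hS' g' with ⟨h', x', hx', e'⟩ | ⟨h', e'⟩ <;> rw [e, e'] <;>
    simp only [h, h', true_and, false_and, not_true, not_false_eq_true, or_false, false_or,
      iff_false]
  · rw [F.sameP_iff hx hx', ← Subtype.ext_iff]
    exact ⟨fun h => Act.point_injective h, fun h => by rw [h]⟩
  · exact Act.point_ne_elt _ _
  · exact fun h => Act.point_ne_elt _ _ h.symm
  · exact ⟨fun h => Act.ofG_injective h, fun h => by rw [h]⟩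

theorem decode_eq_point_iff (hX : X ∈ KSpan) {S : Set X.G} {g : X.G} {y : T} :
    X.decode T S g = Act.point y ↔ RayAt (y : X.bar) S := by
  refine ⟨fun e => ?_, fun h => decode_of_rayAt hX h g⟩
  by_cases h : ∃ x : T, RayAt (x : X.bar) S
  · obtain ⟨x, hx⟩ := h
    rw [decode_of_rayAt hX hx] at e
    rwa [← Act.point_injective e]
  · rw [decode, dif_neg h] at e
    exact absurd e.symm (Act.point_ne_elt _ _)

theorem decode_eq_elt_iff (hX : X ∈ KSpan) {S : Set X.G} (hS : X.Admissible T S) {g : X.G}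
    {k : (⊤ : Subgroup X.G)} : X.decode T S g = Act.elt k ↔ ¬ IsRayP S ∧ g = k := by
  rcases decode_cases hX hS g with ⟨h, x, hx, e⟩ | ⟨h, e⟩ <;> rw [e]
  · exact ⟨fun e => absurd e (Act.point_ne_elt _ _), fun e => absurd h e.1⟩
  · exact ⟨fun e => ⟨h, congrArg Subtype.val (Act.elt_injective e)⟩, fun e =>
      congrArg Act.elt (Subtype.ext e.2)⟩

/-- Being a ray family separates codes of points from codes of group elements; on points, the
relations are those already expressed through rays. -/
theorem relMap_decode (hX : X ∈ KSpan) {m : ℕ} (R : ActRel m) {S : Fin m → Set X.G}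
    (hS : ∀ j, X.Admissible T (S j)) (g : Fin m → X.G) :
    FirstOrder.Language.Structure.RelMap (L := actLang) R (fun j => X.decode T (S j) (g j)) ↔
      ActSpec R S g := by
  have F := flexible hX
  cases R with
  | pt =>
    change (∃ x : T, X.decode T (S 0) (g 0) = Act.point x) ↔ IsRayP (S 0)
    simp only [decode_eq_point_iff hX]
    exact ⟨fun ⟨x, hx⟩ => F.isRayP_of_rayAt hx, hS 0⟩
  | grp =>
    change (∃ k : (⊤ : Subgroup X.G), X.decode T (S 0) (g 0) = Act.elt k) ↔ ¬ IsRayP (S 0)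
    simp only [decode_eq_elt_iff hX (hS _)]
    exact ⟨fun ⟨_, h⟩ => h.1, fun h => ⟨⟨g 0, Subgroup.mem_top _⟩, h, rfl⟩⟩
  | ed =>
    change (∃ x₁ x₂ y₁ y₂ : T, X.decode T (S 0) (g 0) = Act.point x₁ ∧
      X.decode T (S 1) (g 1) = Act.point x₂ ∧ X.decode T (S 2) (g 2) = Act.point y₁ ∧
      X.decode T (S 3) (g 3) = Act.point y₂ ∧ Ed (x₁ : X.bar) x₂ y₁ y₂) ↔
      (∀ j, IsRayP (S j)) ∧ EdP (S 0) (S 1) (S 2) (S 3)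
    simp only [decode_eq_point_iff hX]
    constructor
    · rintro ⟨x₁, x₂, y₁, y₂, h₁, h₂, h₃, h₄, h⟩
      refine ⟨fun j => ?_, (F.edP_iff h₁ h₂ h₃ h₄).2 h⟩
      fin_cases j
      exacts [F.isRayP_of_rayAt h₁, F.isRayP_of_rayAt h₂, F.isRayP_of_rayAt h₃,
        F.isRayP_of_rayAt h₄]
    · rintro ⟨hR, h⟩
      choose x hx using fun j => hS j (hR j)
      exact ⟨x 0, x 1, x 2, x 3, hx 0, hx 1, hx 2, hx 3,
        (F.edP_iff (hx 0) (hx 1) (hx 2) (hx 3)).1 h⟩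
  | mul =>
    change (∃ a b : (⊤ : Subgroup X.G), X.decode T (S 0) (g 0) = Act.elt a ∧
      X.decode T (S 1) (g 1) = Act.elt b ∧ X.decode T (S 2) (g 2) = Act.elt (a * b)) ↔
      (∀ j, ¬ IsRayP (S j)) ∧ g 0 * g 1 = g 2
    simp only [decode_eq_elt_iff hX (hS _)]
    constructor
    · rintro ⟨a, b, ⟨h₀, ha⟩, ⟨h₁, hb⟩, h₂, hc⟩
      refine ⟨fun j => ?_, by rw [ha, hb, hc]; rfl⟩
      fin_cases j
      exacts [h₀, h₁, h₂]
    · rintro ⟨hR, h⟩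
      exact ⟨⟨g 0, Subgroup.mem_top _⟩, ⟨g 1, Subgroup.mem_top _⟩, ⟨hR 0, rfl⟩, ⟨hR 1, rfl⟩,
        hR 2, h.symm⟩
  | ap =>
    change (∃ (a : (⊤ : Subgroup X.G)) (x y : T), X.decode T (S 0) (g 0) = Act.elt a ∧
      X.decode T (S 1) (g 1) = Act.point x ∧ X.decode T (S 2) (g 2) = Act.point y ∧
      (a : X.G) • (x : X.bar) = y) ↔ ¬ IsRayP (S 0) ∧ IsRayP (S 1) ∧ IsRayP (S 2) ∧
        SameP (conjSet (g 0) (S 1)) (S 2)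
    simp only [decode_eq_elt_iff hX (hS _), decode_eq_point_iff hX]
    constructor
    · rintro ⟨a, x, y, ⟨h₀, ha⟩, hx, hy, h⟩
      refine ⟨h₀, F.isRayP_of_rayAt hx, F.isRayP_of_rayAt hy, ?_⟩
      rw [ha]
      exact (F.sameP_iff (F.rayAt_conjSet _ hx) hy).2 h
    · rintro ⟨h₀, h₁, h₂, h⟩
      obtain ⟨x, hx⟩ := hS 1 h₁
      obtain ⟨y, hy⟩ := hS 2 h₂
      exact ⟨⟨g 0, Subgroup.mem_top _⟩, x, y, ⟨h₀, rfl⟩, hx, hy,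
        (F.sameP_iff (F.rayAt_conjSet _ hx) hy).1 h⟩

theorem admissible_univ (hX : X ∈ KSpan) (S : Set X.G) : X.Admissible Set.univ S := fun h =>
  let ⟨x, hx⟩ := (flexible hX).isRayP_iff.1 h
  ⟨⟨x, trivial⟩, hx⟩

/-- No definition of endpoints is needed in the coding: whenever `Comp p w` is a ray family, its
point is an end of `supp p`. -/
theorem admissible_ep (hX : X ∈ KSpan) (p w : X.G) : X.Admissible X.ep (Comp p w) := fun h =>
  let ⟨x, hx⟩ := (flexible hX).isRayP_iff.1 h
  ⟨⟨x, mem_ep_iff.2 ((flexible hX).endPt_of_rayAt_comp hx)⟩, hx⟩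

/-- Decoding from pairs of group elements. -/
def epDecode (X : PermGroup.{u}) (c : Fin 2 → X.G) : X.Act X.ep ⊤ :=
  X.decode X.ep (Comp (c 0) (c 1)) (c 0)

/-- The set of elements given by a unary relation. -/
def unarySet {H : Type*} (A : Set (Fin 1 → H)) : Set H := {k | (fun _ => k) ∈ A}

/-- Decoding from a group element and a set of group elements. -/
def barDecode (X : PermGroup.{u}) (c : X.G × Set (Fin 1 → X.G)) : X.Act Set.univ ⊤ :=
  X.decode Set.univ (unarySet c.2) c.1

/-- Nothing overlaps the identity, so `Comp g 1` has only the trivial element to offer, unlike a ray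
family. The pairs `(g, 1)` are therefore free to code group elements. -/
theorem not_isRayP_comp_one (hX : X ∈ KSpan) (g : X.G) : ¬ IsRayP (Comp g (1 : X.G)) := by
  have F := flexible hX
  rintro ⟨-, -, -, ⟨k, hk, hk1⟩, -⟩
  obtain ⟨-, c, -, -, h⟩ := hk.2 k hk1 (F.sub_iff.2 subset_closure)
  refine h (F.dj_iff.2 ?_)
  rw [msupp_one]
  exact Set.disjoint_empty _

theorem epDecode_surjective (hX : X ∈ KSpan) : Function.Surjective X.epDecode := by
  have F := flexible hX
  intro c
  rcases Act.cases c with ⟨x, rfl⟩ | ⟨h, rfl⟩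
  · obtain ⟨p, w, hx⟩ := F.exists_comp_of_endPt (mem_ep_iff.1 x.2)
    exact ⟨![p, w], decode_of_rayAt hX hx p⟩
  · exact ⟨![h, 1], decode_of_not hX (not_isRayP_comp_one hX _) _⟩

theorem not_isRayP_empty {H : Type*} [Mul H] : ¬ IsRayP (∅ : Set H) := by
  rintro ⟨-, -, -, ⟨k, hk, -⟩, -⟩
  exact hk

theorem barDecode_surjective (hX : X ∈ KSpan) : Function.Surjective X.barDecode := by
  have F := flexible hX
  intro c
  rcases Act.cases c with ⟨x, rfl⟩ | ⟨h, rfl⟩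
  · refine ⟨(1, {w | w 0 ∈ Id X.G (Set.Iio (x : X.bar))}), decode_of_rayAt hX (Or.inl ?_) 1⟩
    rfl
  · refine ⟨(h, ∅), decode_of_not hX not_isRayP_empty _⟩

end PermGroup


/-! ### Interpretations -/

namespace Definability

variable (K : Set PermGroup.{u})

/-- First order definability in the groups, without parameters. -/
abbrev grpFO : Definability (fun X : K => X.1.G) fun _ => Unit :=
  fo grpLang (fun X : K => X.1.G) (γ := Empty) fun _ _ => Empty.elim

/-- Second order definability in the groups. -/
abbrev grpSO {β : Type} (r : β → ℕ) :
    Definability (fun X : K => X.1.G) fun X => (b : β) → Set (Fin (r b) → X.1.G) :=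
  so grpLang (fun X : K => X.1.G) r

theorem hasMul_grpFO : (grpFO K).HasMul := fun a b c =>
  ⟨FirstOrder.Language.Term.equal (.func GrpFun.mul ![.var (.inl a), .var (.inl b)])
    (.var (.inl c)), fun X e v => by
    rw [FirstOrder.Language.Formula.realize_equal]; rfl⟩

theorem hasMul_grpSO {β : Type} (r : β → ℕ) : (grpSO K r).HasMul := fun a b c =>
  ⟨.eq (.func GrpFun.mul ![.var a, .var b]) (.var c), fun _ _ _ => Iff.rfl⟩

variable {K}

theorem defSet_unarySet {β α : Type} (b : β) :
    (grpSO K fun _ : β => 1).DefSet (α := α) fun _ V _ => PermGroup.unarySet (V b) :=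
  so_var grpLang _ (fun _ : β => 1) b fun _ => none

theorem grpFO_def_iff {α : Type} {P : ∀ X : K, Unit → (α → X.1.G) → Prop} :
    (grpFO K).Def P ↔ ∃ φ : grpLang.Formula α, ∀ (X : K) v, φ.Realize v ↔ P X ⟨⟩ v :=
  (fo_def_iff grpLang _ _).trans ⟨fun ⟨φ, h⟩ => ⟨φ, fun X => h X ⟨⟩⟩, fun ⟨φ, h⟩ =>
    ⟨φ, fun X _ => h X⟩⟩

end Definability

open Definability PermGroup

variable {K : Set PermGroup.{u}}

theorem foInterpretation (hK : K ⊆ KSpan) : FOInterpretation K := by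
  have hmul : (grpFO K).HasMul := hasMul_grpFO K
  have hsp : ∀ {m : ℕ} (j : Fin m), (grpFO K).DefSet (α := Fin m × Fin 2) fun _ _ v =>
    Comp (v (j, 0)) (v (j, 1)) := fun j => comp hmul _ _
  obtain ⟨φEq, hEq⟩ := grpFO_def_iff.1 (eqSpec hmul (hsp (0 : Fin 2)) (hsp 1) (0, 0) (1, 0))
  choose φR hR using fun (m : ℕ) (R : ActRel m) =>
    grpFO_def_iff.1 (actSpec hmul R (fun j => hsp j) fun j => (j, 0))
  obtain ⟨φI, hI⟩ := grpFO_def_iff.1 (and (not (isRayP hmul (comp hmul (some 0) (some 1))))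
    ((grpFO K).eq (some (0 : Fin 2)) none))
  -- Every pair is a code: of a point if `Comp` of it is a ray family, and of its first entry
  -- otherwise.
  refine ⟨2, ⊤, φEq, φR, φI, fun X => ⟨fun a => X.1.epDecode a.1, fun c => ?_, fun a => ?_,
    fun m R a => ?_, fun a x => ?_⟩⟩
  · obtain ⟨a, ha⟩ := epDecode_surjective (hK X.2) c
    exact ⟨⟨a, by simp⟩, ha⟩
  · rw [hEq]
    exact decode_eq_iff (hK X.2) (admissible_ep (hK X.2) _ _) (admissible_ep (hK X.2) _ _) _ _
  · exact (relMap_decode (hK X.2) R (fun j => admissible_ep (hK X.2) _ _) _).trans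
      (hR m R X fun p => (a p.1).1 p.2).symm
  · rw [hI]
    refine Iff.trans ?_ ((decode_eq_elt_iff (hK X.2) (admissible_ep (hK X.2) (a 0) (a 1))
      (g := a 0) (k := ⟨x, Subgroup.mem_top x⟩)).symm.trans
        ⟨fun h => ⟨by simp, h⟩, fun ⟨_, h⟩ => h⟩)
    exact Iff.rfl

theorem soInterpretation (hK : K ⊆ KSpan) : SOInterpretation K := by
  have hmul : ∀ (m : ℕ), (grpSO K fun _ : Fin m × Fin 1 => 1).HasMul := fun m => hasMul_grpSO K _
  obtain ⟨φEq, hEq⟩ := eqSpec (hmul 2) (defSet_unarySet ((0 : Fin 2), 0)) (defSet_unarySet (1, 0))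
    ((0 : Fin 2), (0 : Fin 1)) (1, 0)
  choose φR hR using fun (m : ℕ) (R : ActRel m) =>
    actSpec (hmul m) R (fun j => defSet_unarySet (j, 0)) fun j => (j, (0 : Fin 1))
  obtain ⟨φI, hI⟩ := and (not (isRayP (hasMul_grpSO K _) (defSet_unarySet (0 : Fin 1))))
    ((grpSO K _).eq (some (0 : Fin 1)) none)
  -- The formula `⊥ → ⊥` admits every pair of an element and a set as a code.
  refine ⟨1, 1, fun _ => 1, .imp .falsum .falsum, φEq, φR, φI, fun X => ⟨fun a =>
    X.1.barDecode (a.1.1 0, a.1.2 0), fun c => ?_, fun a => ?_, fun m R a => ?_, fun a x => ?_⟩⟩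
  · obtain ⟨a, ha⟩ := barDecode_surjective (hK X.2) c
    exact ⟨⟨(fun _ => a.1, fun _ => a.2), fun h => h⟩, ha⟩
  · exact (decode_eq_iff (hK X.2) (admissible_univ (hK X.2) _) (admissible_univ (hK X.2) _) _ _).trans
      (hEq X (fun p => (a p.1).1.2 p.2) fun p => (a p.1).1.1 p.2).symm
  · exact (relMap_decode (hK X.2) R (fun j => admissible_univ (hK X.2) _) _).trans (hR m R X
      (fun p => (a p.1).1.2 p.2) fun p => (a p.1).1.1 p.2).symm
  · refine (hI X _ _).trans (Iff.trans ?_ ((decode_eq_elt_iff (hK X.2) (admissible_univ (hK X.2) _)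
      (g := a.1 0) (k := ⟨x, Subgroup.mem_top x⟩)).symm.trans
        ⟨fun h => ⟨fun h => h, h⟩, fun ⟨_, h⟩ => h⟩))
    exact Iff.rfl

/-- First order properties of group elements in the structures of the action on endpoints are
first order expressible. -/
theorem foExpressible_of_formula (hK : K ⊆ KSpan) (n : ℕ) (φ : actLang.Formula (Fin n)) :
    FOExpressible K n fun X g => φ.Realize fun i => (Act.ofG (g i) : X.Act X.ep ⊤) := by
  have hmul : (grpFO K).HasMul := hasMul_grpFO K
  have hsp : ∀ {α : Type} (a : α), (grpFO K).DefSet (α := α × Fin 2) fun _ _ v =>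
    Comp (v (a, 0)) (v (a, 1)) := fun a => comp hmul _ _
  have h := def_of_decoding (pair (grpFO K)) (𝓛 := actLang)
    (M := fun X : K => X.1.Act X.1.ep ⊤) (fun X _ => X.1.epDecode)
    (fun X _ => epDecode_surjective (hK X.2))
    (fun a b => (grpFO K).congr (eqSpec hmul (hsp a) (hsp b) (a, 0) (b, 0)) fun X _ v =>
      decode_eq_iff (hK X.2) (admissible_ep (hK X.2) _ _) (admissible_ep (hK X.2) _ _) _ _)
    (fun R t => (grpFO K).congr (actSpec hmul R (fun j => hsp (t j)) fun j => (t j, 0))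
      fun X _ v => relMap_decode (hK X.2) R (fun j => admissible_ep (hK X.2) _ _) _) φ
  -- The identity, defined by `x * x = x`, is quantified and used as second entry, so that the pairs
  -- substituted decode to the given group elements.
  have h1 := ex (P := fun (X : K) _ (v : Fin n → X.1.G) x => x * x = x ∧
    φ.Realize fun a => X.1.epDecode ![v a, x]) (and (hmul _ _ _) ((grpFO K).congr
      ((grpFO K).relabel (fun p : Fin n × Fin 2 => ![some p.1, none] p.2) h) fun X e v => ?_))
  · obtain ⟨ψ, hψ⟩ := grpFO_def_iff.1 h1
    refine ⟨ψ, fun X hX g => ?_⟩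
    rw [hψ ⟨X, hX⟩]
    simp only [mul_eq_left, exists_eq_left]
    refine iff_of_eq (congrArg φ.Realize (funext fun a => ?_))
    exact decode_of_not (hK hX) (not_isRayP_comp_one (hK hX) _) _
  · refine iff_of_eq (congrArg φ.Realize (funext fun a => congrArg _ (funext fun j => ?_)))
    fin_cases j <;> rfl

/-- First order properties of group elements in the structures of the action on the completion
are second order expressible. -/
theorem soExpressible_of_formula (hK : K ⊆ KSpan) (n : ℕ) (φ : actLang.Formula (Fin n)) :
    SOExpressible K n fun X g => φ.Realize fun i => (Act.ofG (g i) : X.Act Set.univ ⊤) := by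
  have hmul : ∀ α : Type, (grpSO K fun _ : α => 1).HasMul := fun α => hasMul_grpSO K _
  obtain ⟨ψ, hψ⟩ := def_of_decoding (soPair grpLang fun X : K => X.1.G) (𝓛 := actLang)
    (M := fun X : K => X.1.Act Set.univ ⊤) (fun X _ => X.1.barDecode)
    (fun X _ => barDecode_surjective (hK X.2))
    (fun {α} a b => (grpSO K fun _ : α => 1).congr (eqSpec (hmul α) (defSet_unarySet a)
      (defSet_unarySet b) a b) fun X _ v =>
      decode_eq_iff (hK X.2) (admissible_univ (hK X.2) _) (admissible_univ (hK X.2) _) _ _)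
    (fun {α} {n} R t => (grpSO K fun _ : α => 1).congr (actSpec (hmul α) R
      (fun j => defSet_unarySet (t j)) t)
      fun X _ v => relMap_decode (hK X.2) R (fun j => admissible_univ (hK X.2) _) _) φ
  -- All set variables of `ψ` are identified with one variable that is required to be empty: an
  -- element together with the empty set codes that element.
  refine ⟨.allRel 1 (.imp (.all (.imp (.var none fun _ => .var none) .falsum))
    (ψ.relabelRel (s := fun o : Option Empty => o.elim 1 Empty.elim) (fun _ => none)
      fun _ => rfl)), fun X hX g => ?_⟩
  have key : ∀ W : (o : Option Empty) → Set (Fin (o.elim 1 Empty.elim) → X.G),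
      unarySet (W none) = ∅ → (SOFormula.Realize
      (ψ.relabelRel (s := fun o : Option Empty => o.elim 1 Empty.elim) (fun _ => none)
        fun _ => rfl) g W ↔ φ.Realize fun i => (Act.ofG (g i) : X.Act Set.univ ⊤)) := by
    intro W hW
    refine (SOFormula.realize_relabelRel _ _ ψ g _).trans ((hψ ⟨X, hX⟩ _ g).trans
      (iff_of_eq (congrArg φ.Realize (funext fun a => decode_of_not (hK hX) ?_ _))))
    change ¬ IsRayP (unarySet (W none))
    rw [hW]
    exact not_isRayP_empty
  constructor
  · intro h
    exact (key _ rfl).1 (h ∅ fun _ h => h)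
  · intro h A hA
    refine (key _ ?_).2 h
    exact Set.eq_empty_of_forall_notMem fun x hx => hA x hx

end NearlyOrdered

namespace NearlyOrdered

namespace PermGroup

/-! ### The relations of the action -/

section Relations

variable {X : PermGroup.{u}} {S : Set X.bar} {H : Subgroup X.G}

/-- Being a point. -/
def Act.IsPt (c : X.Act S H) : Prop := ∃ x : S, c = Act.point x

/-- Being a group element. -/
def Act.IsElt (c : X.Act S H) : Prop := ∃ h : H, c = Act.elt h

/-- The equal direction relation. -/
def Act.EdRel (a b c d : X.Act S H) : Prop := ∃ x₁ x₂ y₁ y₂ : S, a = Act.point x₁ ∧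
  b = Act.point x₂ ∧ c = Act.point y₁ ∧ d = Act.point y₂ ∧ Ed (x₁ : X.bar) x₂ y₁ y₂

/-- The multiplication of group elements. -/
def Act.MulRel (a b c : X.Act S H) : Prop :=
  ∃ g h : H, a = Act.elt g ∧ b = Act.elt h ∧ c = Act.elt (g * h)

/-- The application of group elements to points. -/
def Act.ApRel (a b c : X.Act S H) : Prop := ∃ (g : H) (x y : S), a = Act.elt g ∧
  b = Act.point x ∧ c = Act.point y ∧ (g : X.G) • (x : X.bar) = y

theorem Act.forall_isPt {P : X.Act S H → Prop} :
    (∀ c : X.Act S H, c.IsPt → P c) ↔ ∀ x : S, P (Act.point x) :=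
  ⟨fun h x => h _ ⟨x, rfl⟩, fun h _ ⟨x, hx⟩ => hx ▸ h x⟩

theorem Act.exists_isPt {P : X.Act S H → Prop} :
    (∃ c : X.Act S H, c.IsPt ∧ P c) ↔ ∃ x : S, P (Act.point x) :=
  ⟨fun ⟨_, ⟨x, hx⟩, h⟩ => ⟨x, hx ▸ h⟩, fun ⟨x, h⟩ => ⟨_, ⟨x, rfl⟩, h⟩⟩

theorem Act.forall_isElt {P : X.Act S H → Prop} :
    (∀ c : X.Act S H, c.IsElt → P c) ↔ ∀ x : H, P (Act.elt x) :=
  ⟨fun h x => h _ ⟨x, rfl⟩, fun h _ ⟨x, hx⟩ => hx ▸ h x⟩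

theorem Act.edRel_point {x₁ x₂ y₁ y₂ : S} :
    Act.EdRel (Act.point x₁ : X.Act S H) (Act.point x₂) (Act.point y₁) (Act.point y₂) ↔
      Ed (x₁ : X.bar) x₂ y₁ y₂ := by
  constructor
  · rintro ⟨a, b, c, d, ha, hb, hc, hd, h⟩
    rwa [Act.point_injective ha, Act.point_injective hb, Act.point_injective hc,
      Act.point_injective hd]
  · exact fun h => ⟨_, _, _, _, rfl, rfl, rfl, rfl, h⟩

theorem Act.mulRel_elt {g h k : H} :
    Act.MulRel (Act.elt g : X.Act S H) (Act.elt h) (Act.elt k) ↔ g * h = k := by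
  constructor
  · rintro ⟨a, b, ha, hb, hc⟩
    rw [Act.elt_injective ha, Act.elt_injective hb, Act.elt_injective hc]
  · exact fun h => ⟨_, _, rfl, rfl, by rw [h]⟩

theorem Act.apRel_iff {g : H} {x y : S} :
    Act.ApRel (Act.elt g : X.Act S H) (Act.point x) (Act.point y) ↔
      (g : X.G) • (x : X.bar) = y := by
  constructor
  · rintro ⟨a, b, c, ha, hb, hc, h⟩
    rwa [Act.elt_injective ha, Act.point_injective hb, Act.point_injective hc]
  · exact fun h => ⟨_, _, _, rfl, rfl, rfl, h⟩

end Relations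

end PermGroup

open PermGroup

namespace Definability

section Relations

variable {ι : Type*} {X : ι → PermGroup.{u}} {S : ∀ i, Set (X i).bar} {H : ∀ i, Subgroup (X i).G}
  {E : ι → Type*} {γ : Type} {par : ∀ i, E i → γ → (X i).Act (S i) (H i)} {α : Type}

theorem isPt (a : α) : (fo actLang (fun i => (X i).Act (S i) (H i)) par).Def fun _ _ v =>
    (v a).IsPt := fo_rel actLang _ par ActRel.pt ![a]

theorem isElt (a : α) : (fo actLang (fun i => (X i).Act (S i) (H i)) par).Def fun _ _ v =>
    (v a).IsElt := fo_rel actLang _ par ActRel.grp ![a]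

theorem edRel (a b c d : α) : (fo actLang (fun i => (X i).Act (S i) (H i)) par).Def fun _ _ v =>
    (v a).EdRel (v b) (v c) (v d) := fo_rel actLang _ par ActRel.ed ![a, b, c, d]

theorem mulRel (a b c : α) : (fo actLang (fun i => (X i).Act (S i) (H i)) par).Def fun _ _ v =>
    (v a).MulRel (v b) (v c) := fo_rel actLang _ par ActRel.mul ![a, b, c]

theorem apRel (a b c : α) : (fo actLang (fun i => (X i).Act (S i) (H i)) par).Def fun _ _ v =>
    (v a).ApRel (v b) (v c) := fo_rel actLang _ par ActRel.ap ![a, b, c]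

end Relations

end Definability

namespace PermGroup

/-! ### Invariant dense sets of points -/

/-- An order dense set of points invariant under the group. -/
structure IsDenseInvariant (X : PermGroup.{u}) (S : Set X.bar) : Prop where
  dense : ∀ {a b : X.bar}, a < b → ∃ x ∈ S, a < x ∧ x < b
  invariant : ∀ (g : X.G) {x : X.bar}, x ∈ S → g • x ∈ S

variable {X : PermGroup.{u}}

theorem isDenseInvariant_univ : X.IsDenseInvariant Set.univ where
  dense h := (exists_between h).imp fun _ hx => ⟨trivial, hx⟩
  invariant _ _ _ := trivial

/-- The supremum of the support of a nontrivial element supported in `(a, c)`, for `c` between `a`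
and `b`, lies strictly between `a` and `b`. Invariance is the conjugation invariance of endpoints
for inner automorphisms. -/
theorem isDenseInvariant_ep (hX : X ∈ KSpan) : X.IsDenseInvariant X.ep where
  dense {a b} h := by
    obtain ⟨c, hac, hcb⟩ := exists_between h
    obtain ⟨g, hg, hs⟩ := hX.1.exists_ne_one hac
    obtain ⟨z, hz⟩ := exists_mem_msupp hg
    obtain ⟨x, hx⟩ := dedekindComplete_completion (msupp X.bar g) ⟨z, hz⟩
      ⟨c, fun y hy => (hs hy).2.le⟩
    exact ⟨x, mem_ep_iff.2 ⟨g, Or.inl hx⟩, (hs hz).1.trans_le (hx.1 hz),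
      (hx.2 fun y hy => (hs hy).2.le).trans_lt hcb⟩
  invariant g x hx := Conjugates.mem_ep (τ := MulAction.toPerm g) (α := MulAut.conj g)
    (X.isMonotonic_smul g) (fun h x => by
      change g • h • x = (g * h * g⁻¹) • g • x
      rw [mul_smul, mul_smul, inv_smul_smul]) hx

namespace IsDenseInvariant

variable {S : Set X.bar} (hS : X.IsDenseInvariant S)
include hS

theorem exists_mem {U : Set X.bar} (hU : IsOpen U) (hne : U.Nonempty) : ∃ x ∈ S, x ∈ U := by
  obtain ⟨x, hx⟩ := hne
  obtain ⟨c, d, hc, hd, hs⟩ := exists_Ioo_of_isOpen hU hx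
  obtain ⟨a, ha, h1, h2⟩ := hS.dense (hc.trans hd)
  exact ⟨a, ha, hs ⟨h1, h2⟩⟩

theorem exists_lt (x : X.bar) : ∃ y ∈ S, y < x :=
  hS.exists_mem isOpen_Iio (NoMinOrder.exists_lt x)

theorem exists_gt (x : X.bar) : ∃ y ∈ S, x < y :=
  hS.exists_mem isOpen_Ioi (NoMaxOrder.exists_gt x)

theorem exists_pair : ∃ x y : S, (x : X.bar) < y := by
  obtain ⟨x, hx, -⟩ := hS.exists_lt (toCompletion (Classical.arbitrary X.L))
  obtain ⟨y, hy, hxy⟩ := hS.exists_gt x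
  exact ⟨⟨x, hx⟩, ⟨y, hy⟩, hxy⟩

/-- The set of points moved upwards is open, so if it is nonempty it meets the dense set `S`. -/
theorem exists_lt_smul_iff (g : X.G) :
    (∃ x ∈ S, x < g • x) ↔ ¬ ∀ a : X.L, g • a ≤ a := by
  have h : (∀ a : X.L, g • a ≤ a) ↔ ∀ x : X.bar, g • x ≤ x := by
    simpa only [PtLE, one_smul] using X.ptLE_iff (f := g) (g := 1)
  rw [h]
  simp only [not_forall, not_le]
  refine ⟨fun ⟨x, _, hx⟩ => ⟨x, hx⟩, fun ⟨x, hx⟩ => ?_⟩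
  have hU : IsOpen {x : X.bar | x < g • x} := isOpen_lt continuous_id (X.continuous_smul g)
  exact hS.exists_mem hU ⟨x, hx⟩

theorem exists_smul_lt_iff (g : X.G) :
    (∃ x ∈ S, g • x < x) ↔ ¬ ∀ a : X.L, a ≤ g • a := by
  have h : (∀ a : X.L, a ≤ g • a) ↔ ∀ x : X.bar, x ≤ g • x := by
    simpa only [PtLE, one_smul] using X.ptLE_iff (f := 1) (g := g)
  rw [h]
  simp only [not_forall, not_le]
  refine ⟨fun ⟨x, _, hx⟩ => ⟨x, hx⟩, fun ⟨x, hx⟩ => ?_⟩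
  have hU : IsOpen {x : X.bar | g • x < x} := isOpen_lt (X.continuous_smul g) continuous_id
  exact hS.exists_mem hU ⟨x, hx⟩

/-- No point of `S` is moved by `g` in the direction opposite to that in which `h` moves a point. -/
theorem forall_not_ed_iff (g h : X.G) :
    (∀ x y : S, ¬ Ed (x : X.bar) (g • (x : X.bar)) (h • (y : X.bar)) y) ↔
      ((∀ a : X.L, g • a ≤ a) ∨ ∀ a : X.L, a ≤ h • a) ∧
        ((∀ a : X.L, a ≤ g • a) ∨ ∀ a : X.L, h • a ≤ a) := by
  have : (∀ x y : S, ¬ Ed (x : X.bar) (g • (x : X.bar)) (h • (y : X.bar)) y) ↔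
      ¬ ((∃ x ∈ S, x < g • x) ∧ ∃ y ∈ S, h • y < y) ∧
        ¬ ((∃ x ∈ S, g • x < x) ∧ ∃ y ∈ S, y < h • y) := by
    constructor
    · exact fun H => ⟨fun ⟨⟨x, hx, h1⟩, y, hy, h2⟩ => H ⟨x, hx⟩ ⟨y, hy⟩ (Or.inl ⟨h1, h2⟩),
        fun ⟨⟨x, hx, h1⟩, y, hy, h2⟩ => H ⟨x, hx⟩ ⟨y, hy⟩ (Or.inr ⟨h1, h2⟩)⟩
    · rintro ⟨h1, h2⟩ x y (h | h)
      · exact h1 ⟨⟨x, x.2, h.1⟩, y, y.2, h.2⟩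
      · exact h2 ⟨⟨x, x.2, h.1⟩, y, y.2, h.2⟩
  rw [this, hS.exists_lt_smul_iff, hS.exists_smul_lt_iff, hS.exists_lt_smul_iff,
    hS.exists_smul_lt_iff]
  tauto

/-- A signed element never moves two points in opposite directions; this can be said with `Ed`
alone, without knowing which direction is up. -/
theorem signed_iff (g : X.G) : X.Signed g ↔ g * g ≠ g ∧
    ∀ x y : S, ¬ Ed (x : X.bar) (g • (x : X.bar)) (g • (y : X.bar)) y := by
  rw [hS.forall_not_ed_iff, Ne, mul_eq_left, Signed]
  tauto

theorem sameSign_iff (g h : X.G) : X.SameSign g h ↔ g * g ≠ g ∧ h * h ≠ h ∧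
    (∀ x y : S, ¬ Ed (x : X.bar) (g • (x : X.bar)) (g • (y : X.bar)) y) ∧
    (∀ x y : S, ¬ Ed (x : X.bar) (h • (x : X.bar)) (h • (y : X.bar)) y) ∧
    ∀ x y : S, ¬ Ed (x : X.bar) (g • (x : X.bar)) (h • (y : X.bar)) y := by
  -- Only the identity moves no point up and no point down, so a signed element has exactly one
  -- sign.
  have key : ∀ k : X.G, k ≠ 1 → ¬ ((∀ a : X.L, a ≤ k • a) ∧ ∀ a : X.L, k • a ≤ a) := by
    intro k hk hc
    refine hk (Subtype.ext (Subtype.ext (Equiv.ext fun a => ?_)))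
    exact le_antisymm (hc.2 a) (hc.1 a)
  rw [hS.forall_not_ed_iff, hS.forall_not_ed_iff, hS.forall_not_ed_iff, Ne, mul_eq_left, Ne,
    mul_eq_left, SameSign]
  have h1 := key g
  have h2 := key h
  simp only [forall_and]
  tauto

/-- The support of `g` is bounded in the direction from `x` to `y`. -/
def _root_.NearlyOrdered.PermGroup.BoundedTo (S : Set X.bar) (x y : X.bar) (g : X.G) : Prop :=
  ∃ z : S, ∀ w : S, Ed x y z w → g • (w : X.bar) = w

/-- The points of `S` beyond the bound are fixed, and those moved would form an open set meeting
`S`; so it suffices to test on `S`. -/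
theorem boundedTo_of_lt {x y : X.bar} (hxy : x < y) {g : X.G} :
    X.BoundedTo S x y g ↔ g ∈ X.lft := by
  constructor
  · rintro ⟨z, hz⟩
    refine ⟨z, fun w hw => not_lt.1 fun hzw => ?_⟩
    obtain ⟨w', hw', h1, h2⟩ := hS.exists_mem ((isOpen_Ioi (a := (z : X.bar))).inter
      ((X.isMonotonic_smul g).isOpen_msupp)) ⟨w, hzw, hw⟩
    exact h2 (hz ⟨w', hw'⟩ (Or.inl ⟨hxy, h1⟩))
  · rintro ⟨b, hb⟩
    obtain ⟨z, hz, hbz⟩ := hS.exists_gt b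
    refine ⟨⟨z, hz⟩, fun w hw => not_not.1 fun hc => ?_⟩
    rcases hw with ⟨-, hw⟩ | ⟨hw, -⟩
    · exact (hb hc).not_gt (hbz.trans hw)
    · exact hxy.asymm hw

theorem boundedTo_of_gt {x y : X.bar} (hxy : y < x) {g : X.G} :
    X.BoundedTo S x y g ↔ g ∈ X.rt := by
  constructor
  · rintro ⟨z, hz⟩
    refine ⟨z, fun w hw => not_lt.1 fun hzw => ?_⟩
    obtain ⟨w', hw', h1, h2⟩ := hS.exists_mem ((isOpen_Iio (a := (z : X.bar))).inter
      ((X.isMonotonic_smul g).isOpen_msupp)) ⟨w, hzw, hw⟩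
    exact h2 (hz ⟨w', hw'⟩ (Or.inr ⟨hxy, h1⟩))
  · rintro ⟨b, hb⟩
    obtain ⟨z, hz, hbz⟩ := hS.exists_lt b
    refine ⟨⟨z, hz⟩, fun w hw => not_not.1 fun hc => ?_⟩
    rcases hw with ⟨hw, -⟩ | ⟨-, hw⟩
    · exact hxy.asymm hw
    · exact (hb hc).not_gt (hw.trans hbz)

/-- The equal direction structure cannot name a direction. Quantifying over distinct `x`, `y` runs
through both directions, so left and right bounded elements enter symmetrically. -/
theorem exists_ne_boundedTo {P : (X.G → Prop) → Prop} :
    (∃ x y : S, (x : X.bar) ≠ y ∧ P (X.BoundedTo S x y)) ↔ P (· ∈ X.lft) ∨ P (· ∈ X.rt) := by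
  constructor
  · rintro ⟨x, y, hxy, h⟩
    rcases lt_or_gt_of_ne hxy with hxy | hxy
    · left
      convert h
      exact (hS.boundedTo_of_lt hxy).symm
    · right
      convert h
      exact (hS.boundedTo_of_gt hxy).symm
  · obtain ⟨x, y, hxy⟩ := hS.exists_pair
    rintro (h | h)
    · refine ⟨x, y, hxy.ne, ?_⟩
      convert h
      exact hS.boundedTo_of_lt hxy
    · refine ⟨y, x, hxy.ne', ?_⟩
      convert h
      exact hS.boundedTo_of_gt hxy

theorem mem_opp_iff (g : X.G) :
    g ∈ X.opp ↔ ∀ x y : S, (x : X.bar) ≠ y → Ed (x : X.bar) y (g • (x : X.bar)) (g • (y : X.bar)) := by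
  rw [X.mem_opp_iff]
  constructor
  · intro h x y hxy
    exact (lt_or_gt_of_ne hxy).imp (fun h' => ⟨h', h h'⟩) fun h' => ⟨h', h h'⟩
  · intro h
    refine (X.isMonotonic_smul g).resolve_right fun ha => ?_
    obtain ⟨x, y, hxy⟩ := hS.exists_pair
    rcases h x y hxy.ne with h' | h'
    · exact (ha hxy).asymm h'.2
    · exact hxy.asymm h'.1

/-- The exact number of orbits meeting `S` is expressed by a system of `k` inequivalent
representatives, which uses only finitely many point variables. -/
theorem encard_orbits_iff (k : ℕ) :
    {M ∈ X.orbits | (M ∩ S).Nonempty}.encard = k ↔ ∃ x : Fin k → S,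
      (∀ i j, i ≠ j → ¬ ∃ g : X.G, g • (x i : X.bar) = x j) ∧
        ∀ y : S, ∃ j, ∃ g : X.G, g • (y : X.bar) = x j := by
  have horb : ∀ x y : X.bar, MulAction.orbit X.G x = MulAction.orbit X.G y ↔
      ∃ g : X.G, g • x = y := fun x y => by
    rw [eq_comm, MulAction.orbit_eq_iff]
    exact Iff.rfl
  have hset : {M ∈ X.orbits | (M ∩ S).Nonempty} =
      Set.range fun x : S => MulAction.orbit X.G (x : X.bar) := by
    ext M
    constructor
    · rintro ⟨⟨x, rfl⟩, y, hy, hyS⟩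
      exact ⟨⟨y, hyS⟩, MulAction.orbit_eq_iff.2 hy⟩
    · rintro ⟨x, rfl⟩
      exact ⟨⟨x, rfl⟩, x, MulAction.mem_orbit_self _, x.2⟩
  rw [hset]
  constructor
  · intro h
    have hfin := Set.finite_of_encard_eq_coe h
    have := hfin.to_subtype
    have hcard : Nat.card (Set.range fun x : S => MulAction.orbit X.G (x : X.bar)) = k := by
      rw [← hfin.cast_ncard_eq, Nat.cast_inj] at h
      exact h
    let e := Finite.equivFinOfCardEq hcard
    choose x hx using fun j => (e.symm j).2
    refine ⟨x, fun i j hij hg => hij ?_, fun y => ?_⟩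
    · have := (horb _ _).2 hg
      change (fun x : S => MulAction.orbit X.G (x : X.bar)) (x i) =
        (fun x : S => MulAction.orbit X.G (x : X.bar)) (x j) at this
      rw [hx, hx] at this
      exact e.symm.injective (Subtype.ext this)
    · refine ⟨e ⟨_, y, rfl⟩, (horb _ _).1 ?_⟩
      have := hx (e ⟨_, y, rfl⟩)
      rw [e.symm_apply_apply] at this
      exact this.symm
  · rintro ⟨x, hx, hy⟩
    have hr : (Set.range fun x : S => MulAction.orbit X.G (x : X.bar)) =
        Set.range fun j => MulAction.orbit X.G (x j : X.bar) := by
      ext M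
      constructor
      · rintro ⟨y, rfl⟩
        obtain ⟨j, hj⟩ := hy y
        exact ⟨j, ((horb _ _).2 hj).symm⟩
      · rintro ⟨j, rfl⟩
        exact ⟨x j, rfl⟩
    have hinj : Function.Injective fun j => MulAction.orbit X.G (x j : X.bar) := fun i j hij =>
      by_contra fun hne => hx i j hne ((horb _ _).1 hij)
    rw [hr, ← Set.image_univ, hinj.encard_image, Set.encard_univ]
    simp

end IsDenseInvariant

end PermGroup

end NearlyOrdered

namespace NearlyOrdered

open Definability PermGroup

/-! ### Expressible properties -/

namespace PermGroup

section Formulas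

variable {X : PermGroup.{u}} {S : Set X.bar}

/-- No point is moved by `c` in the direction opposite to that in which `d` moves a point. -/
def Act.NotOpposite {H : Subgroup X.G} (c d : X.Act S H) : Prop :=
  ∀ x, x.IsPt → ∀ y, y.IsPt → ∀ x', x'.IsPt → ∀ y', y'.IsPt → Act.ApRel c x x' →
    Act.ApRel d y y' → ¬ Act.EdRel x x' y' y

/-- The support of `c` is bounded in the direction from `x` to `y`. -/
def Act.Bounded {H : Subgroup X.G} (x y c : X.Act S H) : Prop :=
  ∃ z, z.IsPt ∧ ∀ w, w.IsPt → Act.EdRel x y z w → Act.ApRel c w w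

/-- `c` preserves the equal direction relation of pairs of points and their images. -/
def Act.KeepsDirection {H : Subgroup X.G} (c : X.Act S H) : Prop :=
  ∀ x, x.IsPt → ∀ y, y.IsPt → ∀ x', x'.IsPt → ∀ y', y'.IsPt → Act.ApRel c x x' →
    Act.ApRel c y y' → x ≠ y → Act.EdRel x y x' y'

/-- The support of `c` is bounded in both directions. -/
def Act.BoundedBoth {H : Subgroup X.G} (c : X.Act S H) : Prop :=
  ∀ x, x.IsPt → ∀ y, y.IsPt → x ≠ y → Act.Bounded x y c

/-- The supports of `c` and `d` are bounded in the same direction. -/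
def Act.BoundedSame {H : Subgroup X.G} (c d : X.Act S H) : Prop :=
  ∃ x, x.IsPt ∧ ∃ y, y.IsPt ∧ x ≠ y ∧ Act.Bounded x y c ∧ Act.Bounded x y d

theorem Act.point_ne_point_iff {H : Subgroup X.G} {x y : S} :
    (Act.point x : X.Act S H) ≠ Act.point y ↔ (x : X.bar) ≠ y := by
  rw [Ne, Act.point_injective.eq_iff, Subtype.ext_iff]

theorem Act.apRel_ofG {g : X.G} {x y : S} :
    Act.ApRel (Act.ofG g : X.Act S ⊤) (Act.point x) (Act.point y) ↔ g • (x : X.bar) = y :=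
  Act.apRel_iff

theorem Act.mulRel_ofG {g h k : X.G} :
    Act.MulRel (Act.ofG g : X.Act S ⊤) (Act.ofG h) (Act.ofG k) ↔ g * h = k :=
  Act.mulRel_elt.trans Subtype.ext_iff

variable (hS : X.IsDenseInvariant S)
include hS

theorem Act.notOpposite_ofG {g h : X.G} :
    Act.NotOpposite (Act.ofG g : X.Act S ⊤) (Act.ofG h) ↔
      ∀ x y : S, ¬ Ed (x : X.bar) (g • (x : X.bar)) (h • (y : X.bar)) y := by
  simp only [Act.NotOpposite, Act.forall_isPt, Act.apRel_ofG, Act.edRel_point]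
  refine ⟨fun H x y => H x y ⟨_, hS.invariant g x.2⟩ ⟨_, hS.invariant h y.2⟩ rfl rfl, ?_⟩
  intro H x y x' y' hx hy
  rw [← hx, ← hy]
  exact H x y

theorem Act.keepsDirection_ofG {g : X.G} :
    Act.KeepsDirection (Act.ofG g : X.Act S ⊤) ↔ g ∈ X.opp := by
  simp only [Act.KeepsDirection, Act.forall_isPt, Act.apRel_ofG, Act.edRel_point,
    Act.point_ne_point_iff, hS.mem_opp_iff]
  refine ⟨fun H x y => H x y ⟨_, hS.invariant g x.2⟩ ⟨_, hS.invariant g y.2⟩ rfl rfl, ?_⟩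
  intro H x y x' y' hx hy
  rw [← hx, ← hy]
  exact H x y

omit hS in
theorem Act.bounded_ofG {g : X.G} {x y : S} :
    Act.Bounded (Act.point x : X.Act S ⊤) (Act.point y) (Act.ofG g) ↔ X.BoundedTo S x y g := by
  simp only [Act.Bounded, Act.forall_isPt, Act.exists_isPt, Act.apRel_ofG, Act.edRel_point,
    BoundedTo]

theorem Act.boundedBoth_ofG {g : X.G} :
    Act.BoundedBoth (Act.ofG g : X.Act S ⊤) ↔ g ∈ X.bdd := by
  simp only [Act.BoundedBoth, Act.forall_isPt, Act.point_ne_point_iff, Act.bounded_ofG]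
  have := hS.exists_ne_boundedTo (P := fun B => ¬ B g)
  rw [← not_iff_not]
  push Not
  rw [this, ← not_and_or]
  rfl

theorem Act.boundedSame_ofG {g h : X.G} :
    Act.BoundedSame (Act.ofG g : X.Act S ⊤) (Act.ofG h) ↔
      (g ∈ X.lft ∧ h ∈ X.lft) ∨ (g ∈ X.rt ∧ h ∈ X.rt) := by
  simp only [Act.BoundedSame, Act.exists_isPt, Act.point_ne_point_iff, Act.bounded_ofG]
  exact hS.exists_ne_boundedTo (P := fun B => B g ∧ B h)

end Formulas

end PermGroup

namespace Definability

section Formulas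

variable {ι : Type*} {X : ι → PermGroup.{u}} {S : ∀ i, Set (X i).bar} {H : ∀ i, Subgroup (X i).G}
  {E : ι → Type*} {γ : Type} {par : ∀ i, E i → γ → (X i).Act (S i) (H i)} {α : Type}

theorem allPt {P : ∀ i, E i → (α → (X i).Act (S i) (H i)) → (X i).Act (S i) (H i) → Prop}
    (hP : (fo actLang (fun i => (X i).Act (S i) (H i)) par).Def (α := Option α) fun i e v =>
      P i e (fun a => v (some a)) (v none)) :
    (fo actLang (fun i => (X i).Act (S i) (H i)) par).Def fun i e v =>
      ∀ x, x.IsPt → P i e v x :=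
  Definability.all _ (Definability.imp _ (isPt none) hP)

theorem exPt {P : ∀ i, E i → (α → (X i).Act (S i) (H i)) → (X i).Act (S i) (H i) → Prop}
    (hP : (fo actLang (fun i => (X i).Act (S i) (H i)) par).Def (α := Option α) fun i e v =>
      P i e (fun a => v (some a)) (v none)) :
    (fo actLang (fun i => (X i).Act (S i) (H i)) par).Def fun i e v =>
      ∃ x, x.IsPt ∧ P i e v x :=
  ex (and (isPt none) hP)

theorem allElt {P : ∀ i, E i → (α → (X i).Act (S i) (H i)) → (X i).Act (S i) (H i) → Prop}
    (hP : (fo actLang (fun i => (X i).Act (S i) (H i)) par).Def (α := Option α) fun i e v =>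
      P i e (fun a => v (some a)) (v none)) :
    (fo actLang (fun i => (X i).Act (S i) (H i)) par).Def fun i e v =>
      ∀ x, x.IsElt → P i e v x :=
  Definability.all _ (Definability.imp _ (isElt none) hP)

theorem const {ι : Type*} {M : ι → Type u} {E : ι → Type*} {D : Definability M E} (p : Prop) :
    D.Def (α := α) fun _ _ _ => p := by
  by_cases hp : p
  · exact D.congr (not D.falsum) fun _ _ _ => by simp [hp]
  · exact D.congr D.falsum fun _ _ _ => by simp [hp]

theorem notOpposite (a b : α) : (fo actLang (fun i => (X i).Act (S i) (H i)) par).Def fun _ _ v =>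
    Act.NotOpposite (v a) (v b) := by
  unfold Act.NotOpposite
  exact allPt (allPt (allPt (allPt (Definability.imp _ (apRel _ _ _) (Definability.imp _
    (apRel _ _ _) (not (edRel _ _ _ _)))))))

theorem bounded (a b c : α) : (fo actLang (fun i => (X i).Act (S i) (H i)) par).Def fun _ _ v =>
    Act.Bounded (v a) (v b) (v c) := by
  unfold Act.Bounded
  exact exPt (allPt (Definability.imp _ (edRel _ _ _ _) (apRel _ _ _)))

theorem keepsDirection (a : α) : (fo actLang (fun i => (X i).Act (S i) (H i)) par).Def fun _ _ v =>
    Act.KeepsDirection (v a) := by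
  unfold Act.KeepsDirection
  exact allPt (allPt (allPt (allPt (Definability.imp _ (apRel _ _ _) (Definability.imp _
    (apRel _ _ _) (Definability.imp _ (not (Definability.eq _ _ _)) (edRel _ _ _ _)))))))

theorem boundedBoth (a : α) : (fo actLang (fun i => (X i).Act (S i) (H i)) par).Def fun _ _ v =>
    Act.BoundedBoth (v a) := by
  unfold Act.BoundedBoth
  exact allPt (allPt (Definability.imp _ (not (Definability.eq _ _ _)) (bounded _ _ _)))

theorem boundedSame (a b : α) : (fo actLang (fun i => (X i).Act (S i) (H i)) par).Def fun _ _ v =>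
    Act.BoundedSame (v a) (v b) := by
  unfold Act.BoundedSame
  exact exPt (exPt (and (not (Definability.eq _ _ _)) (and (bounded _ _ _) (bounded _ _ _))))

/-- There are representatives of exactly `k` orbits. -/
theorem orbits (k : ℕ) : (fo actLang (fun i => (X i).Act (S i) (H i)) par).Def (α := α)
    fun i _ _ => ∃ u : Fin k → (X i).Act (S i) (H i), (∀ j, (u j).IsPt) ∧
      (∀ j l, j ≠ l → ¬ ∃ c, Act.ApRel c (u j) (u l)) ∧
        ∀ y, y.IsPt → ∃ j, ∃ c, Act.ApRel c y (u j) := by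
  refine exTuple (and (allFin fun j => isPt _) (and (allFin fun j => allFin fun l =>
    Definability.imp _ (const _) (not (ex (apRel _ _ _)))) (allPt (exFin fun j => ex ?_))))
  exact apRel _ _ _

end Formulas

end Definability

section Expressibility

variable {K : Set PermGroup.{u}} {S : ∀ X : PermGroup.{u}, Set X.bar}
  {E : (n : ℕ) → (∀ X : PermGroup.{u}, (Fin n → X.G) → Prop) → Prop}

/-- Expressibility of everything that is first order in the action on `S`, compatible with
equivalence of predicates on the members of `K`. -/
structure ExpressesFO (K : Set PermGroup.{u}) (S : ∀ X : PermGroup.{u}, Set X.bar)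
    (E : (n : ℕ) → (∀ X : PermGroup.{u}, (Fin n → X.G) → Prop) → Prop) : Prop where
  dense : ∀ X ∈ K, X.IsDenseInvariant (S X)
  congr : ∀ {n : ℕ} {P Q : ∀ X : PermGroup.{u}, (Fin n → X.G) → Prop}, E n P →
    (∀ X ∈ K, ∀ g, P X g ↔ Q X g) → E n Q
  formula : ∀ (n : ℕ) (φ : actLang.Formula (Fin n)),
    E n fun X g => φ.Realize fun i => (Act.ofG (g i) : X.Act (S X) ⊤)

/-- First order definability in the structures of the action. -/
abbrev actFO (K : Set PermGroup.{u}) (S : ∀ X : PermGroup.{u}, Set X.bar) :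
    Definability (fun X : K => X.1.Act (S X.1) ⊤) fun _ => Unit :=
  fo actLang (fun X : K => X.1.Act (S X.1) ⊤) (γ := Empty) fun _ _ => Empty.elim

namespace ExpressesFO

variable (h : ExpressesFO K S E)
include h

theorem of_def {n : ℕ} {P : ∀ X : K, Unit → (Fin n → X.1.Act (S X.1) ⊤) → Prop}
    (hP : (actFO K S).Def P) (Q : ∀ X : PermGroup.{u}, (Fin n → X.G) → Prop)
    (hQ : ∀ (X : PermGroup.{u}) (hX : X ∈ K) (g : Fin n → X.G),
      P ⟨X, hX⟩ ⟨⟩ (fun i => Act.ofG (g i)) ↔ Q X g) : E n Q := by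
  obtain ⟨φ, hφ⟩ := (fo_def_iff actLang _ _).1 hP
  refine h.congr (h.formula n φ) fun X hX g => ?_
  rw [← hQ X hX]
  exact hφ ⟨X, hX⟩ ⟨⟩ _

theorem opp : E 1 fun X g => g 0 ∈ X.opp :=
  h.of_def (keepsDirection 0) _ fun X hX _ => Act.keepsDirection_ofG (h.dense X hX)

theorem expressibilityResults : ExpressibilityResults E S := by
  refine ⟨h.formula, ?_, ?_, ?_, ?_, ?_, fun k => ?_⟩
  · refine h.of_def (and (not (mulRel 0 0 0)) (notOpposite 0 0)) _ fun X hX g => ?_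
    simp only [Act.mulRel_ofG, Act.notOpposite_ofG (h.dense X hX), (h.dense X hX).signed_iff]
  · refine h.of_def (and (not (mulRel 0 0 0)) (and (not (mulRel 1 1 1)) (and (notOpposite 0 0)
      (and (notOpposite 1 1) (notOpposite 0 1))))) _ fun X hX g => ?_
    simp only [Act.mulRel_ofG, Act.notOpposite_ofG (h.dense X hX), (h.dense X hX).sameSign_iff]
  · exact h.of_def (boundedBoth 0) _ fun X hX _ => Act.boundedBoth_ofG (h.dense X hX)
  · refine h.of_def (boundedSame 0 0) _ fun X hX _ =>
      (Act.boundedSame_ofG (h.dense X hX)).trans ?_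
    rw [and_self, and_self]
  · exact h.of_def (boundedSame 0 1) _ fun X hX _ => Act.boundedSame_ofG (h.dense X hX)
  · refine h.of_def (orbits k) _ fun X hX _ => ?_
    rw [(h.dense X hX).encard_orbits_iff]
    have hap : ∀ x y : S X, (∃ c, Act.ApRel c (Act.point x : X.Act (S X) ⊤) (Act.point y)) ↔
        ∃ g : X.G, g • (x : X.bar) = y := by
      intro x y
      constructor
      · rintro ⟨c, hc⟩
        obtain ⟨g, -, -, rfl, -⟩ := id hc
        exact ⟨g, Act.apRel_iff.1 hc⟩
      · rintro ⟨g, hg⟩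
        exact ⟨Act.ofG g, Act.apRel_ofG.2 hg⟩
    constructor
    · rintro ⟨u, hu, h1, h2⟩
      choose x hx using hu
      obtain rfl : u = fun j => Act.point (x j) := funext hx
      exact ⟨x, fun i j hij hg => h1 i j hij ((hap _ _).2 hg), fun y =>
        (h2 _ ⟨y, rfl⟩).imp fun j hj => (hap _ _).1 hj⟩
    · rintro ⟨x, h1, h2⟩
      refine ⟨fun j => Act.point (x j), fun j => ⟨_, rfl⟩, fun i j hij hg =>
        h1 i j hij ((hap _ _).1 hg), Act.forall_isPt.2 fun y =>
          (h2 y).imp fun j hj => (hap _ _).2 hj⟩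

theorem forall_mem_opp : E 0 fun X _ => ∀ g : X.G, g ∈ X.opp := by
  refine h.of_def (allElt (P := fun _ _ _ x => x.KeepsDirection) (keepsDirection none)) _ fun X hX _ => Act.forall_isElt.trans ?_
  exact (Subgroup.topEquiv (G := X.G)).forall_congr fun g => Act.keepsDirection_ofG (h.dense X hX)

theorem forall_mem_bdd : E 0 fun X _ => ∀ g : X.G, g ∈ X.bdd := by
  refine h.of_def (allElt (P := fun _ _ _ x => x.BoundedBoth) (boundedBoth none)) _ fun X hX _ => Act.forall_isElt.trans ?_
  exact (Subgroup.topEquiv (G := X.G)).forall_congr fun g => Act.boundedBoth_ofG (h.dense X hX)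

theorem forall_mem_lft_or_rt : E 0 fun X _ => ∀ g k : X.G,
    (g ∈ X.lft ∧ k ∈ X.lft) ∨ (g ∈ X.rt ∧ k ∈ X.rt) := by
  refine h.of_def (allElt (P := fun _ _ _ x => ∀ y, y.IsElt → x.BoundedSame y) (allElt
    (P := fun _ _ v x => Act.BoundedSame (v none) x) (boundedSame (some none) none))) _ fun X hX _ =>
    Act.forall_isElt.trans ?_
  refine (Subgroup.topEquiv (G := X.G)).forall_congr fun g => Act.forall_isElt.trans ?_
  exact (Subgroup.topEquiv (G := X.G)).forall_congr fun k => Act.boundedSame_ofG (h.dense X hX)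

theorem exists_notMem_opp : E 0 fun X _ => ∃ g : X.G, g ∉ X.opp := by
  refine h.of_def (not (allElt (P := fun _ _ _ x => x.KeepsDirection) (keepsDirection none))) _ fun X hX _ => ?_
  rw [← not_forall, not_iff_not]
  exact Act.forall_isElt.trans ((Subgroup.topEquiv (G := X.G)).forall_congr fun g =>
    Act.keepsDirection_ofG (h.dense X hX))

end ExpressesFO

end Expressibility

end NearlyOrdered

namespace NearlyOrdered

open Definability PermGroup

/-! ### The action of a subgroup -/

namespace PermGroup

section Subgroups

variable {X : PermGroup.{u}} {S : Set X.bar} (H : Subgroup X.G)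

/-- The action of a subgroup as a part of the action of the group. -/
def Act.incl (c : X.Act S H) : X.Act S ⊤ :=
  Sum.elim (fun x => Act.point x) (fun h : H => Act.ofG (h : X.G)) c

open Classical in
/-- The retraction of the action of the group to the action of a subgroup. -/
def Act.restr (c : X.Act S ⊤) : X.Act S H :=
  Sum.elim (fun x => Act.point x)
    (fun h : (⊤ : Subgroup X.G) => if hh : (h : X.G) ∈ H then Act.elt ⟨h, hh⟩ else Act.elt 1) c

variable {H}

theorem Act.restr_incl (c : X.Act S H) : Act.restr H (Act.incl H c) = c := by
  rcases Act.cases c with ⟨x, rfl⟩ | ⟨h, rfl⟩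
  · rfl
  · exact dif_pos h.2

theorem Act.restr_surjective : Function.Surjective (Act.restr H : X.Act S ⊤ → X.Act S H) :=
  fun c => ⟨_, Act.restr_incl c⟩

theorem Act.incl_injective : Function.Injective (Act.incl H : X.Act S H → X.Act S ⊤) :=
  Function.LeftInverse.injective Act.restr_incl

theorem Act.incl_eq_point_iff {c : X.Act S H} {x : S} :
    Act.incl H c = Act.point x ↔ c = Act.point x :=
  Act.incl_injective.eq_iff' rfl

theorem Act.incl_eq_elt_iff {c : X.Act S H} {k : (⊤ : Subgroup X.G)} :
    Act.incl H c = Act.elt k ↔ ∃ h : H, c = Act.elt h ∧ (h : X.G) = k := by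
  constructor
  · intro e
    rcases Act.cases c with ⟨x, rfl⟩ | ⟨h, rfl⟩
    · exact absurd e (Act.point_ne_elt _ _)
    · exact ⟨h, rfl, congrArg Subtype.val (Act.elt_injective e)⟩
  · rintro ⟨h, rfl, e⟩
    exact congrArg Act.elt (Subtype.ext e)

theorem Act.relMap_incl {m : ℕ} (R : ActRel m) (v : Fin m → X.Act S H) :
    FirstOrder.Language.Structure.RelMap (L := actLang) R (fun j => Act.incl H (v j)) ↔
      FirstOrder.Language.Structure.RelMap (L := actLang) R v := by
  cases R with
  | pt =>
    change (∃ x : S, Act.incl H (v 0) = Act.point x) ↔ ∃ x : S, v 0 = Act.point x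
    simp only [Act.incl_eq_point_iff]
  | grp =>
    change (∃ k : (⊤ : Subgroup X.G), Act.incl H (v 0) = Act.elt k) ↔ ∃ h : H, v 0 = Act.elt h
    simp only [Act.incl_eq_elt_iff]
    exact ⟨fun ⟨_, h, e, _⟩ => ⟨h, e⟩, fun ⟨h, e⟩ => ⟨⟨h, trivial⟩, h, e, rfl⟩⟩
  | ed =>
    change Act.EdRel (Act.incl H (v 0)) (Act.incl H (v 1)) (Act.incl H (v 2)) (Act.incl H (v 3)) ↔
      Act.EdRel (v 0) (v 1) (v 2) (v 3)
    simp only [Act.EdRel, Act.incl_eq_point_iff]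
  | mul =>
    change Act.MulRel (Act.incl H (v 0)) (Act.incl H (v 1)) (Act.incl H (v 2)) ↔
      Act.MulRel (v 0) (v 1) (v 2)
    simp only [Act.MulRel, Act.incl_eq_elt_iff]
    constructor
    · rintro ⟨a, b, ⟨g, e1, h1⟩, ⟨h, e2, h2⟩, k, e3, h3⟩
      refine ⟨g, h, e1, e2, e3.trans (congrArg Act.elt (Subtype.ext ?_))⟩
      rw [h3, Subgroup.coe_mul, Subgroup.coe_mul, h1, h2]
    · rintro ⟨g, h, e1, e2, e3⟩
      exact ⟨⟨g, trivial⟩, ⟨h, trivial⟩, ⟨g, e1, rfl⟩, ⟨h, e2, rfl⟩, g * h, e3, rfl⟩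
  | ap =>
    change Act.ApRel (Act.incl H (v 0)) (Act.incl H (v 1)) (Act.incl H (v 2)) ↔
      Act.ApRel (v 0) (v 1) (v 2)
    simp only [Act.ApRel, Act.incl_eq_elt_iff, Act.incl_eq_point_iff]
    constructor
    · rintro ⟨a, x, y, ⟨g, e1, h1⟩, e2, e3, h⟩
      exact ⟨g, x, y, e1, e2, e3, h1 ▸ h⟩
    · rintro ⟨g, x, y, e1, e2, e3, h⟩
      exact ⟨⟨g, trivial⟩, x, y, ⟨g, e1, rfl⟩, e2, e3, h⟩

variable (H) in
/-- Being an element of the subgroup. -/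
def Act.InSub (c : X.Act S ⊤) : Prop := ∃ h ∈ H, c = Act.ofG h

theorem Act.inSub_ofG {g : X.G} : Act.InSub H (Act.ofG g : X.Act S ⊤) ↔ g ∈ H :=
  ⟨fun ⟨_, hh, e⟩ => Act.ofG_injective e ▸ hh, fun h => ⟨g, h, rfl⟩⟩

/-- The graph of the retraction in terms of the relations of the action: points and members of `H`
stay, all other group elements go to the identity, which `MulRel d d d` singles out. -/
theorem Act.eq_incl_restr_iff {c d : X.Act S ⊤} : d = Act.incl H (Act.restr H c) ↔
    (((c.IsPt ∨ Act.InSub H c) ∧ d = c) ∨ (¬ (c.IsPt ∨ Act.InSub H c) ∧ Act.MulRel d d d)) := by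
  have hone : Act.MulRel d d d ↔ d = Act.ofG 1 := by
    constructor
    · rintro ⟨g, h, hg, hh, hgh⟩
      have h1 := Act.elt_injective (hg.symm.trans hgh)
      have h2 := Act.elt_injective (hg.symm.trans hh)
      rw [← h2, left_eq_mul] at h1
      rw [hg, h1]
      rfl
    · rintro rfl
      exact Act.mulRel_ofG.2 (one_mul 1)
  rcases Act.cases c with ⟨x, rfl⟩ | ⟨h, rfl⟩
  · have hp : (Act.point x : X.Act S ⊤).IsPt := ⟨x, rfl⟩
    simp only [hp, true_or, true_and, not_true, false_and, or_false]
    rfl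
  · have hp : ¬ (Act.elt h : X.Act S ⊤).IsPt := fun ⟨x, e⟩ => Act.point_ne_elt _ _ e.symm
    have hs : Act.InSub H (Act.elt h : X.Act S ⊤) ↔ (h : X.G) ∈ H := Act.inSub_ofG
    rw [hone, hs]
    by_cases hh : (h : X.G) ∈ H
    · have : Act.restr H (Act.elt h : X.Act S ⊤) = Act.elt ⟨h, hh⟩ := dif_pos hh
      simp only [hh, or_true, true_and, not_true, false_and, or_false, this]
      rfl
    · have : Act.restr H (Act.elt h : X.Act S ⊤) = Act.elt 1 := dif_neg hh
      simp only [hp, hh, or_false, false_and, not_false_eq_true, true_and, false_or, this]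
      rfl

end Subgroups

end PermGroup

namespace Definability

section Subgroups

variable {ι : Type*} {X : ι → PermGroup.{u}} {S : ∀ i, Set (X i).bar} {H : ∀ i, Subgroup (X i).G}
  {E : ι → Type*} {γ : Type} {par : ∀ i, E i → γ → (X i).Act (S i) ⊤}

/-- If a subgroup is definable then truth of a sentence in its action is definable. -/
theorem def_realize_subgroup
    (hH : ∀ {α : Type} (a : α), (fo actLang (fun i => (X i).Act (S i) ⊤) par).Def fun i _ v =>
      Act.InSub (H i) (v a)) (θ : actLang.Sentence) {α : Type} :
    (fo actLang (fun i => (X i).Act (S i) ⊤) par).Def (α := α) fun i _ _ =>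
      (X i).Act (S i) (H i) ⊨ θ := by
  have hc : ∀ {α : Type} (a b : α), (fo actLang (fun i => (X i).Act (S i) ⊤) par).Def fun i _ v =>
      v b = Act.incl (H i) (Act.restr (H i) (v a)) := fun a b =>
    Definability.congr _ (or (and (or (isPt a) (hH a)) (Definability.eq _ b a))
      (and (not (or (isPt a) (hH a))) (mulRel b b b))) fun i _ v => Act.eq_incl_restr_iff
  -- The retraction serves as a decoding, so the structure for `H` is decoded from the one for `G`.
  -- Equality and relations of decoded elements are expressed by naming their values under the
  -- definable retraction.
  refine Definability.congr _ (Definability.relabel _ Empty.elim (def_of_decoding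
    (fo actLang (fun i => (X i).Act (S i) ⊤) par) (𝓛 := actLang)
    (M := fun i => (X i).Act (S i) (H i)) (fun i _ => Act.restr (H i))
    (fun i _ => Act.restr_surjective) (fun a b => ?_) (fun R t => ?_) θ)) fun i _ v => ?_
  · refine Definability.congr _ (ex (P := fun i _ v x =>
      x = Act.incl (H i) (Act.restr (H i) (v a)) ∧ x = Act.incl (H i) (Act.restr (H i) (v b)))
      (and (hc _ _) (hc _ _))) fun i _ v => ?_
    simp only [exists_eq_left, Act.incl_injective.eq_iff]
  · refine Definability.congr _ (exTuple (P := fun i _ v u =>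
      (∀ j, u j = Act.incl (H i) (Act.restr (H i) (v (t j)))) ∧
        FirstOrder.Language.Structure.RelMap R u)
      (and (allFin fun j => hc _ _) (fo_rel actLang _ par R _))) fun i _ v => ?_
    simp only [← funext_iff, exists_eq_left]
    exact (Act.relMap_incl R _).symm
  · exact iff_of_eq (congrArg (fun w : Empty → (X i).Act (S i) (H i) =>
      FirstOrder.Language.Formula.Realize θ w) (Subsingleton.elim _ _))

end Subgroups

theorem def_par {𝓛 : FirstOrder.Language.{0, 0}} {ι : Type*} {M : ι → Type u}
    [∀ i, 𝓛.Structure (M i)] {γ : Type} {E : ι → Type*} {par : ∀ i, E i → γ → M i} {α : Type}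
    {P : ∀ i, E i → (α ⊕ γ → M i) → Prop} (hP : (fo 𝓛 M par).Def P) :
    (fo 𝓛 M par).Def fun i e v => P i e (Sum.elim v (par i e)) := by
  obtain ⟨φ, hφ⟩ := hP
  refine ⟨φ.relabel (Sum.elim id Sum.inr), fun i e v => ?_⟩
  refine Iff.trans ?_ (hφ i e _)
  rw [FirstOrder.Language.Formula.realize_relabel]
  refine iff_of_eq (congrArg _ ?_)
  funext o
  rcases o with (_ | _) | _ <;> rfl

end Definability

/-! ### Elementary equivalence -/

section Equivalence

variable {K : Set PermGroup.{u}}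

theorem expressesFO_ep (hK : K ⊆ KSpan) : ExpressesFO K (fun X => X.ep) (FOExpressible K) where
  dense _ hX := isDenseInvariant_ep (hK hX)
  congr := fun ⟨φ, hφ⟩ h => ⟨φ, fun _ hX g => (hφ _ hX g).trans (h _ hX g)⟩
  formula := foExpressible_of_formula hK

theorem expressesFO_univ (hK : K ⊆ KSpan) :
    ExpressesFO K (fun _ => Set.univ) (SOExpressible K) where
  dense _ _ := isDenseInvariant_univ
  congr := fun ⟨φ, hφ⟩ h => ⟨φ, fun _ hX g => (hφ _ hX g).trans (h _ hX g)⟩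
  formula := soExpressible_of_formula hK

theorem FOExpressible.iff_of_equiv {P : PermGroup.{u} → Prop}
    (h : FOExpressible K 0 fun X _ => P X) {X Y : PermGroup.{u}} (hX : X ∈ K) (hY : Y ∈ K)
    (e : grpLang.ElementarilyEquivalent X.G Y.G) : P X ↔ P Y := by
  obtain ⟨φ, hφ⟩ := h
  have key : ∀ Z ∈ K, (Z.G ⊨ (φ.relabel Fin.elim0 : grpLang.Sentence)) ↔ P Z := by
    intro Z hZ
    refine Iff.trans ?_ (hφ Z hZ Fin.elim0)
    refine (FirstOrder.Language.Formula.realize_relabel).trans ?_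
    exact iff_of_eq (congrArg _ (Subsingleton.elim _ _))
  rw [← key X hX, ← key Y hY]
  exact e.realize_sentence _

/-- Truth of a sentence in the action of a definable subgroup is truth of some sentence in the
group, the same one for all members of the class. -/
theorem epActEquiv_of_def (hK : K ⊆ KSpan) {H : ∀ X : PermGroup.{u}, Subgroup X.G}
    (hH : ∀ {α : Type} (a : α), (actFO K fun X => X.ep).Def fun X _ v =>
      Act.InSub (H X.1) (v a)) {X Y : PermGroup.{u}} (hX : X ∈ K) (hY : Y ∈ K)
    (e : grpLang.ElementarilyEquivalent X.G Y.G) : EpActEquiv X Y (H X) (H Y) := by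
  refine FirstOrder.Language.elementarilyEquivalent_iff.2 fun θ => ?_
  refine FOExpressible.iff_of_equiv (P := fun X => X.Act X.ep (H X) ⊨ θ) ?_ hX hY e
  exact (expressesFO_ep hK).of_def (def_realize_subgroup hH θ) _ fun _ _ _ => Iff.rfl

theorem epActEquiv_top (hK : K ⊆ KSpan) {X Y : PermGroup.{u}} (hX : X ∈ K) (hY : Y ∈ K)
    (e : grpLang.ElementarilyEquivalent X.G Y.G) : EpActEquiv X Y ⊤ ⊤ :=
  epActEquiv_of_def hK (H := fun _ => ⊤) (fun a => Definability.congr _ (isElt a) fun _ _ _ =>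
    ⟨fun ⟨g, _, e⟩ => ⟨⟨g, trivial⟩, e⟩, fun ⟨g, e⟩ => ⟨g, trivial, e⟩⟩) hX hY e

theorem inSub_iff {X : PermGroup.{u}} {S : Set X.bar} {H : Subgroup X.G} {P : X.Act S ⊤ → Prop}
    (h : ∀ g : X.G, P (Act.ofG g) ↔ g ∈ H) (c : X.Act S ⊤) : Act.InSub H c ↔ c.IsElt ∧ P c := by
  constructor
  · rintro ⟨g, hg, rfl⟩
    exact ⟨⟨_, rfl⟩, (h g).2 hg⟩
  · rintro ⟨⟨g, rfl⟩, hg⟩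
    exact ⟨g, (h g).1 hg, rfl⟩

theorem epActEquiv_bdd (hK : K ⊆ KSpan) {X Y : PermGroup.{u}} (hX : X ∈ K) (hY : Y ∈ K)
    (e : grpLang.ElementarilyEquivalent X.G Y.G) : EpActEquiv X Y X.bdd Y.bdd :=
  epActEquiv_of_def hK (H := fun X => X.bdd) (fun a => Definability.congr _ (and (isElt a)
    (boundedBoth a)) fun X _ _ => inSub_iff (fun _ =>
      Act.boundedBoth_ofG (isDenseInvariant_ep (hK X.2))) _) hX hY e

theorem epActEquiv_opp (hK : K ⊆ KSpan) {X Y : PermGroup.{u}} (hX : X ∈ K) (hY : Y ∈ K)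
    (e : grpLang.ElementarilyEquivalent X.G Y.G) : EpActEquiv X Y X.opp Y.opp :=
  epActEquiv_of_def hK (H := fun X => X.opp) (fun a => Definability.congr _ (and (isElt a)
    (keepsDirection a)) fun X _ _ => inSub_iff (fun _ =>
      Act.keepsDirection_ofG (isDenseInvariant_ep (hK X.2))) _) hX hY e

open Classical in
/-- The group of elements with support bounded in the direction from `x` to `y`. -/
def PermGroup.dirSub (X : PermGroup.{u}) (x y : X.bar) : Subgroup X.G :=
  if x < y then X.lft else X.rt

theorem mem_dirSub_iff {X : PermGroup.{u}} {S : Set X.bar} (hS : X.IsDenseInvariant S)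
    {x y : X.bar} (hxy : x ≠ y) {g : X.G} : X.BoundedTo S x y g ↔ g ∈ X.dirSub x y := by
  rcases lt_or_gt_of_ne hxy with h | h
  · rw [dirSub, if_pos h, hS.boundedTo_of_lt h]
  · rw [dirSub, if_neg h.asymm, hS.boundedTo_of_gt h]

/-- Sentences about the action of the elements with support bounded in a given direction are
definable from points giving the direction. -/
theorem exists_formula_dirSub (hK : K ⊆ KSpan) (θ : actLang.Sentence) :
    ∃ φ : actLang.Formula (Fin 2), ∀ X ∈ K, ∀ x y : X.ep, (x : X.bar) ≠ y →
      (φ.Realize ![(Act.point x : X.Act X.ep ⊤), Act.point y] ↔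
        X.Act X.ep (X.dirSub x y) ⊨ θ) := by
  -- The direction is fixed by indexing over groups together with a pair of distinct endpoints and
  -- using this pair as parameters; this yields one formula valid for all of them.
  let ι := Σ X : K, {p : X.1.ep × X.1.ep // (p.1 : X.1.bar) ≠ p.2}
  obtain ⟨φ, hφ⟩ := def_realize_subgroup (ι := ι) (X := fun i => i.1.1) (S := fun i => i.1.1.ep)
    (E := fun _ => Unit) (γ := Fin 2)
    (par := fun i _ => ![Act.point i.2.1.1, Act.point i.2.1.2])
    (H := fun i => i.1.1.dirSub i.2.1.1 i.2.1.2)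
    (fun a => Definability.congr _ (and (isElt a) (def_par (bounded (Sum.inr 0) (Sum.inr 1)
      (Sum.inl a)))) fun i _ v => inSub_iff (P := fun c => Act.Bounded (Act.point i.2.1.1)
        (Act.point i.2.1.2) c) (fun g => Act.bounded_ofG.trans (mem_dirSub_iff
          (isDenseInvariant_ep (hK i.1.2)) i.2.2)) _) θ (α := Empty)
  refine ⟨φ.relabel (Sum.elim Empty.elim id), fun X hX x y hxy => ?_⟩
  refine Iff.trans ?_ (hφ ⟨⟨X, hX⟩, (x, y), hxy⟩ ⟨⟩ Empty.elim)
  rw [FirstOrder.Language.Formula.realize_relabel]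
  refine iff_of_eq (congrArg φ.Realize ?_)
  funext o
  rcases o with o | o
  · exact o.elim
  · rfl

/-- Quantifying over the pair that gives the direction, `θ` is asserted for one direction and `θ'`
for the opposite one. Both choices of direction remain possible, whence the symmetric disjunction.
-/
theorem foExpressible_lft_rt (hK : K ⊆ KSpan) (θ θ' : actLang.Sentence) :
    FOExpressible K 0 fun X _ => (X.Act X.ep X.lft ⊨ θ ∧ X.Act X.ep X.rt ⊨ θ') ∨
      (X.Act X.ep X.rt ⊨ θ ∧ X.Act X.ep X.lft ⊨ θ') := by
  obtain ⟨φ, hφ⟩ := exists_formula_dirSub hK θ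
  obtain ⟨φ', hφ'⟩ := exists_formula_dirSub hK θ'
  have hdef : ∀ (ψ : actLang.Formula (Fin 2)) {α : Type} (a b : α),
      (actFO K fun X => X.ep).Def fun _ _ v => ψ.Realize ![v a, v b] := by
    intro ψ α a b
    refine Definability.congr _ (Definability.relabel _ ![a, b] ((fo_def_iff actLang _ _).2
      ⟨ψ, fun i _ v => Iff.rfl⟩)) fun i _ v => iff_of_eq (congrArg ψ.Realize (funext fun j => ?_))
    fin_cases j <;> rfl
  refine (expressesFO_ep hK).of_def (exPt (P := fun X _ _ x => ∃ y, y.IsPt ∧ x ≠ y ∧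
    φ.Realize ![x, y] ∧ φ'.Realize ![y, x]) (exPt (and (not (Definability.eq _ _ _))
      (and (hdef φ _ _) (hdef φ' _ _))))) _ fun X hX _ => ?_
  simp only [Act.exists_isPt, Act.point_ne_point_iff]
  constructor
  · rintro ⟨x, y, hxy, h, h'⟩
    rw [hφ X hX x y hxy] at h
    rw [hφ' X hX y x hxy.symm] at h'
    rcases lt_or_gt_of_ne hxy with hlt | hlt
    · rw [dirSub, if_pos hlt] at h
      rw [dirSub, if_neg hlt.asymm] at h'
      exact Or.inl ⟨h, h'⟩
    · rw [dirSub, if_neg hlt.asymm] at h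
      rw [dirSub, if_pos hlt] at h'
      exact Or.inr ⟨h, h'⟩
  · obtain ⟨x, y, hxy⟩ := (isDenseInvariant_ep (hK hX)).exists_pair
    rintro (⟨h, h'⟩ | ⟨h, h'⟩)
    · refine ⟨x, y, hxy.ne, (hφ X hX x y hxy.ne).2 ?_, (hφ' X hX y x hxy.ne').2 ?_⟩
      · rwa [dirSub, if_pos hxy]
      · rwa [dirSub, if_neg hxy.asymm]
    · refine ⟨y, x, hxy.ne', (hφ X hX y x hxy.ne').2 ?_, (hφ' X hX x y hxy.ne).2 ?_⟩
      · rwa [dirSub, if_neg hxy.asymm]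
      · rwa [dirSub, if_pos hxy]

/-- If two pairs of structures are not elementarily equivalent then a pair of sentences
distinguishes them. -/
theorem exists_sentences_of_not_equiv {L : FirstOrder.Language.{0, 0}} {A B C D : Type u}
    [L.Structure A] [L.Structure B] [L.Structure C] [L.Structure D]
    (h : ¬ (L.ElementarilyEquivalent A C ∧ L.ElementarilyEquivalent B D)) :
    ∃ θ θ' : L.Sentence, A ⊨ θ ∧ B ⊨ θ' ∧ ¬ (C ⊨ θ ∧ D ⊨ θ') := by
  have key : ∀ {A C : Type u} [L.Structure A] [L.Structure C],
      ¬ L.ElementarilyEquivalent A C → ∃ θ : L.Sentence, A ⊨ θ ∧ ¬ C ⊨ θ := by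
    intro A C _ _ h
    rw [FirstOrder.Language.elementarilyEquivalent_iff] at h
    push Not at h
    obtain ⟨θ, ⟨h1, h2⟩ | ⟨h1, h2⟩⟩ := h
    · exact ⟨θ, h1, h2⟩
    · refine ⟨∼θ, ?_, ?_⟩
      · exact FirstOrder.Language.Sentence.realize_not A |>.2 h1
      · exact fun h => (FirstOrder.Language.Sentence.realize_not C).1 h h2
  rw [not_and_or] at h
  rcases h with h | h
  · obtain ⟨θ, h1, h2⟩ := key h
    exact ⟨θ, ⊤, h1, FirstOrder.Language.BoundedFormula.realize_top.2 trivial, fun h => h2 h.1⟩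
  · obtain ⟨θ, h1, h2⟩ := key h
    exact ⟨⊤, θ, FirstOrder.Language.BoundedFormula.realize_top.2 trivial, h1, fun h => h2 h.2⟩

/-- If both matchings failed, a pair of sentences true of `Lft` and `Rt` in `X` would refute each of
them. The conjunctions of these sentences contradict the symmetric disjunction of
`foExpressible_lft_rt`, which is transferred to `Y`. -/
theorem epActEquiv_lft_rt (hK : K ⊆ KSpan) {X Y : PermGroup.{u}} (hX : X ∈ K) (hY : Y ∈ K)
    (e : grpLang.ElementarilyEquivalent X.G Y.G) :
    (EpActEquiv X Y X.lft Y.lft ∧ EpActEquiv X Y X.rt Y.rt) ∨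
      (EpActEquiv X Y X.lft Y.rt ∧ EpActEquiv X Y X.rt Y.lft) := by
  by_contra hc
  rw [not_or] at hc
  obtain ⟨θ₁, θ₁', h1, h1', h1n⟩ := exists_sentences_of_not_equiv hc.1
  obtain ⟨θ₂, θ₂', h2, h2', h2n⟩ := exists_sentences_of_not_equiv hc.2
  have hinf : ∀ {M : Type u} [actLang.Structure M] (θ θ' : actLang.Sentence),
      (M ⊨ (θ ⊓ θ' : actLang.Sentence)) ↔ M ⊨ θ ∧ M ⊨ θ' :=
    fun θ θ' => FirstOrder.Language.Formula.realize_inf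
  have := (FOExpressible.iff_of_equiv (foExpressible_lft_rt hK (θ₁ ⊓ θ₂) (θ₁' ⊓ θ₂')) hX hY e).1
    (Or.inl ⟨(hinf _ _).2 ⟨h1, h2⟩, (hinf _ _).2 ⟨h1', h2'⟩⟩)
  simp only [hinf] at this
  tauto

end Equivalence

end NearlyOrdered

namespace NearlyOrdered

open Definability PermGroup

/-! ### Subgroups elementarily equivalent to the group -/

namespace PermGroup

/-- For span-transitivity, first bring `a` into `I`. Then an element supported in the ray at the
image of `a` containing the image of `b` fixes the former and pushes the latter out of `J`. -/
theorem mem_kSpan_of_flexible {X : PermGroup.{u}} (F : Flexible X.G X.bar) : X ∈ KSpan := by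
  constructor
  · intro I hI
    obtain ⟨a, b, hab, hs⟩ : ∃ a b : X.L, a < b ∧ Set.Ioo a b ⊆ I := by
      rcases hI with ⟨a, b, hab, rfl⟩ | ⟨a, rfl | rfl⟩ | rfl
      · exact ⟨a, b, hab, subset_rfl⟩
      · obtain ⟨b, hb⟩ := exists_lt a
        exact ⟨b, a, hb, Set.Ioo_subset_Iio_self⟩
      · obtain ⟨b, hb⟩ := exists_gt a
        exact ⟨a, b, hb, Set.Ioo_subset_Ioi_self⟩
      · obtain ⟨a, b, hab⟩ := exists_pair_lt X.L
        exact ⟨a, b, hab, Set.subset_univ _⟩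
    obtain ⟨c, hac, hcb⟩ := exists_between hab
    obtain ⟨g, hg, hgs⟩ := F.exists_moving (U := Set.Ioo (toCompletion a) (toCompletion b))
      isOpen_Ioo ⟨toCompletion_strictMono hac, toCompletion_strictMono hcb⟩
    refine ⟨g, Flexible.ne_one_of_mem hg, fun d hd => toCompletion_strictMono.injective ?_⟩
    rw [← X.smul_toCompletion]
    refine notMem_msupp.1 fun h => hd (hs ?_)
    exact ⟨toCompletion_strictMono.lt_iff_lt.1 (hgs h).1,
      toCompletion_strictMono.lt_iff_lt.1 (hgs h).2⟩
  · rintro a b hab I J ⟨c, d, hcd, rfl⟩ ⟨c', d', -, rfl⟩ -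
    obtain ⟨z, hz⟩ := exists_between hcd
    obtain ⟨g, -, hg⟩ := F.exists_smul_mem isOpen_univ Set.ordConnected_univ
      (isOpen_Ioo (a := c) (b := d)) (Set.mem_univ a) (Set.mem_univ z) hz
    have hne : g • a ≠ g • b := fun h => hab (MulAction.injective g h)
    rcases lt_or_gt_of_ne hne with hlt | hlt
    · obtain ⟨y, hy⟩ := exists_gt (max (g • a) d')
      obtain ⟨u, hu, hub⟩ := F.exists_smul_mem isOpen_Ioi Set.ordConnected_Ioi
        (isOpen_Ioi (a := d')) hlt ((le_max_left _ _).trans_lt hy) ((le_max_right _ _).trans_lt hy)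
      refine ⟨u * g, Or.inl ⟨?_, ?_⟩⟩ <;> rw [mul_smul]
      · rwa [notMem_msupp.1 fun h => absurd (hu h) (lt_irrefl (g • a))]
      · exact fun h => lt_asymm h.2 hub
    · obtain ⟨y, hy⟩ := exists_lt (min (g • a) c')
      obtain ⟨u, hu, hub⟩ := F.exists_smul_mem isOpen_Iio Set.ordConnected_Iio
        (isOpen_Iio (a := c')) hlt (hy.trans_le (min_le_left _ _)) (hy.trans_le (min_le_right _ _))
      refine ⟨u * g, Or.inl ⟨?_, ?_⟩⟩ <;> rw [mul_smul]
      · rwa [notMem_msupp.1 fun h => absurd (hu h) (lt_irrefl (g • a))]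
      · exact fun h => lt_asymm h.1 hub

variable (X : PermGroup.{u})

/-- The permutation group given by a subgroup. -/
def restrict (H : Subgroup X.G) : PermGroup.{u} where
  L := X.L
  G := H.map X.G.subtype

variable {X}

/-- The elements of the permutation group given by a subgroup. -/
def restrictEquiv (H : Subgroup X.G) : H ≃* (X.restrict H).G :=
  H.equivMapOfInjective X.G.subtype X.G.subtype_injective

theorem restrict_mem_kSpan (hX : X ∈ KSpan) {H : Subgroup X.G} (hH : X.bddDer ≤ H) :
    X.restrict H ∈ KSpan := by
  have F := flexible_of_le hX hH
  refine mem_kSpan_of_flexible ⟨F.complete, (X.restrict H).isMonotonic_smul,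
    fun g hg => (X.restrict H).faithful hg, fun a x y b ha hx hy => ?_⟩
  obtain ⟨h, h1, h2⟩ := F.moves a x y b ha hx hy
  exact ⟨restrictEquiv H h, h1, h2⟩

theorem elementarilyEquivalent_of_mulEquiv {G G' : Type u} [Mul G] [Mul G'] (e : G ≃* G') :
    grpLang.ElementarilyEquivalent G G' := by
  let f : grpLang.Equiv G G' :=
    { e.toEquiv with
      map_fun' := fun {_} f v => by
        cases f
        exact e.map_mul (v 0) (v 1)
      map_rel' := fun {_} R => R.elim }
  exact FirstOrder.Language.elementarilyEquivalent_iff.2 fun φ =>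
    FirstOrder.Language.StrongHomClass.realize_sentence f φ

/-- A property of the permutation group given by a subgroup elementarily equivalent to the group
is shared by the group if it is expressible by a sentence. -/
theorem of_restrict (hX : X ∈ KSpan) {H : Subgroup X.G} (hH : X.bddDer ≤ H)
    (e : grpLang.ElementarilyEquivalent X.G H) {P : PermGroup.{u} → Prop}
    (hP : FOExpressible KSpan 0 fun X _ => P X) (h : P (X.restrict H)) : P X :=
  (hP.iff_of_equiv hX (restrict_mem_kSpan hX hH)
    (e.trans (elementarilyEquivalent_of_mulEquiv (restrictEquiv H)))).2 h

/-- In the permutation group given by `Bdd(G)` all elements are bounded; this is one first order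
sentence, so it holds in `G` as well. -/
theorem bdd_eq_top_of_equiv (hX : X ∈ KSpan) (e : grpLang.ElementarilyEquivalent X.G X.bdd) :
    X.bdd = ⊤ := by
  refine (Subgroup.eq_top_iff' _).2 (of_restrict hX bddDer_le_bdd e
    (expressesFO_ep subset_rfl).forall_mem_bdd fun g => ?_)
  obtain ⟨h, rfl⟩ := (restrictEquiv X.bdd).surjective g
  exact h.2

theorem opp_eq_top_of_equiv (hX : X ∈ KSpan) (e : grpLang.ElementarilyEquivalent X.G X.opp) :
    X.opp = ⊤ := by
  refine (Subgroup.eq_top_iff' _).2 (of_restrict hX (bddDer_le_bdd.trans bdd_le_opp) e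
    (expressesFO_ep subset_rfl).forall_mem_opp fun g => ?_)
  obtain ⟨h, rfl⟩ := (restrictEquiv X.opp).surjective g
  exact h.2

theorem lft_or_rt_eq_top (h : ∀ g k : X.G, (g ∈ X.lft ∧ k ∈ X.lft) ∨ (g ∈ X.rt ∧ k ∈ X.rt)) :
    X.lft = ⊤ ∨ X.rt = ⊤ := by
  by_contra hc
  rw [not_or, Subgroup.eq_top_iff', Subgroup.eq_top_iff', not_forall, not_forall] at hc
  obtain ⟨⟨g, hg⟩, k, hk⟩ := hc
  rcases h g k with h | h
  · exact hg h.1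
  · exact hk h.2

/-- Left and right cannot be told apart by the sentence, so the transfer only shows that `Lft(G)` or
`Rt(G)` is everything. In the second case `Lft(G) = Bdd(G)`, and the result for `Bdd(G)` applies. -/
theorem lft_eq_top_of_equiv (hX : X ∈ KSpan) (e : grpLang.ElementarilyEquivalent X.G X.lft) :
    X.lft = ⊤ := by
  refine (lft_or_rt_eq_top (of_restrict hX bddDer_le_lft e
    (expressesFO_ep subset_rfl).forall_mem_lft_or_rt fun g k => ?_)).elim id fun h => ?_
  · obtain ⟨g, rfl⟩ := (restrictEquiv X.lft).surjective g
    obtain ⟨k, rfl⟩ := (restrictEquiv X.lft).surjective k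
    exact Or.inl ⟨g.2, k.2⟩
  · have hb : X.bdd = X.lft := by rw [bdd, h, inf_top_eq]
    rw [← hb] at e ⊢
    exact bdd_eq_top_of_equiv hX e

theorem rt_eq_top_of_equiv (hX : X ∈ KSpan) (e : grpLang.ElementarilyEquivalent X.G X.rt) :
    X.rt = ⊤ := by
  refine (lft_or_rt_eq_top (of_restrict hX bddDer_le_rt e
    (expressesFO_ep subset_rfl).forall_mem_lft_or_rt fun g k => ?_)).symm.elim id fun h => ?_
  · obtain ⟨g, rfl⟩ := (restrictEquiv X.rt).surjective g
    obtain ⟨k, rfl⟩ := (restrictEquiv X.rt).surjective k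
    exact Or.inr ⟨g.2, k.2⟩
  · have hb : X.bdd = X.rt := by rw [bdd, h, top_inf_eq]
    rw [← hb] at e ⊢
    exact bdd_eq_top_of_equiv hX e

/-! ### Dedekind complete chains -/

theorem dedekindComplete_iff_surjective :
    DedekindComplete X.L ↔ Function.Surjective (toCompletion (L := X.L)) := by
  constructor
  · intro h x
    obtain ⟨a₀, ha₀⟩ := exists_toCompletion_le x
    obtain ⟨b₀, hb₀⟩ := exists_le_toCompletion x
    obtain ⟨a, ha⟩ := h {a | toCompletion a ≤ x} ⟨a₀, ha₀⟩
      ⟨b₀, fun c hc => toCompletion_strictMono.le_iff_le.1 (le_trans hc hb₀)⟩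
    refine ⟨a, le_antisymm (not_lt.1 fun hlt => ?_) (not_lt.1 fun hlt => ?_)⟩
    · obtain ⟨b, h1, h2⟩ := exists_toCompletion_between hlt
      have := ha.2 fun c hc => toCompletion_strictMono.le_iff_le.1 (le_trans hc h1.le)
      exact (toCompletion_strictMono.lt_iff_lt.1 h2).not_ge this
    · obtain ⟨b, h1, h2⟩ := exists_toCompletion_between hlt
      exact (toCompletion_strictMono.lt_iff_lt.1 h1).not_ge (ha.1 h2.le)
  · intro h T hT ⟨b, hb⟩
    obtain ⟨x, hx⟩ := dedekindComplete_completion (toCompletion '' T) (hT.image _)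
      ⟨toCompletion b, by
        rintro _ ⟨a, ha, rfl⟩
        exact toCompletion_strictMono.monotone (hb ha)⟩
    obtain ⟨a, rfl⟩ := h x
    refine ⟨a, fun c hc => toCompletion_strictMono.le_iff_le.1 (hx.1 ⟨c, hc, rfl⟩),
      fun d hd => toCompletion_strictMono.le_iff_le.1 (hx.2 ?_)⟩
    rintro _ ⟨c, hc, rfl⟩
    exact toCompletion_strictMono.monotone (hd hc)

/-- By transitivity the chain is itself an orbit in the completion, so there is a single orbit
exactly if the chain is the whole completion. -/
theorem encard_orbits_eq_one_iff (h : MulAction.IsPretransitive X.G X.L) :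
    {M ∈ X.orbits | (M ∩ Set.univ).Nonempty}.encard = (1 : ℕ) ↔ DedekindComplete X.L := by
  have hmem := range_toCompletion_mem_orbits h
  have hall : {M ∈ X.orbits | (M ∩ Set.univ).Nonempty} = X.orbits := by
    ext M
    refine ⟨fun h => h.1, fun h => ⟨h, ?_⟩⟩
    obtain ⟨x, rfl⟩ := h
    exact ⟨x, MulAction.mem_orbit_self _, trivial⟩
  rw [hall, Nat.cast_one, Set.encard_eq_one, dedekindComplete_iff_surjective,
    ← Set.range_eq_univ]
  constructor
  · rintro ⟨M, hM⟩
    rw [hM] at hmem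
    refine Set.eq_univ_of_forall fun x => ?_
    have hx : MulAction.orbit X.G x ∈ X.orbits := ⟨x, rfl⟩
    rw [hM] at hx
    rw [hmem, ← hx]
    exact MulAction.mem_orbit_self x
  · intro hr
    rw [hr] at hmem
    obtain ⟨x, hx⟩ := hmem
    refine ⟨Set.univ, Set.eq_singleton_iff_unique_mem.2 ⟨⟨x, hx⟩, ?_⟩⟩
    rintro _ ⟨y, rfl⟩
    have : y ∈ MulAction.orbit X.G x := by
      have := Set.mem_univ y
      rwa [← hx] at this
    exact (MulAction.orbit_eq_iff.2 this).trans hx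

end PermGroup

/-! ### Reconstruction -/

section Reconstruction

variable {K : Set PermGroup.{u}}

theorem secondOrderReconstruction (hK : K ⊆ KSpan) : SecondOrderReconstruction K := by
  have hE := (expressesFO_univ hK).expressibilityResults
  refine ⟨fun X hX Y hY => isoReconstruction (hK hX) (hK hY), fun X hX =>
    ⟨autReconstruction (hK hX), characteristicSubgroups (hK hX), orbitCriterion (hK hX)⟩,
    soInterpretation hK, hE, ?_⟩
  obtain ⟨φ, hφ⟩ := hE.2.2.2.2.2.2 1
  exact ⟨φ, fun X hX g => (hφ X hX.1 g).trans (encard_orbits_eq_one_iff hX.2)⟩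

theorem firstOrderReconstruction (hK : K ⊆ KSpan) : FirstOrderReconstruction K := by
  refine ⟨secondOrderReconstruction hK, foInterpretation hK,
    (expressesFO_ep hK).expressibilityResults, fun X hX Y hY e =>
      ⟨epActEquiv_top hK hX hY e, epActEquiv_bdd hK hX hY e, epActEquiv_lft_rt hK hX hY e⟩, ?_⟩
  rintro X hX H (rfl | rfl | rfl) e
  · exact bdd_eq_top_of_equiv (hK hX) e
  · exact lft_eq_top_of_equiv (hK hX) e
  · exact rt_eq_top_of_equiv (hK hX) e

theorem monotonicSecondOrderReconstruction (hK : K ⊆ KSpan) :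
    MonotonicSecondOrderReconstruction K :=
  ⟨secondOrderReconstruction hK, fun _ hX => opp_properties (hK hX), (expressesFO_univ hK).opp⟩

theorem monotonicFirstOrderReconstruction (hK : K ⊆ KSpan) :
    MonotonicFirstOrderReconstruction K :=
  ⟨firstOrderReconstruction hK, monotonicSecondOrderReconstruction hK, (expressesFO_ep hK).opp,
    fun _ hX _ hY e => epActEquiv_opp hK hX hY e, fun _ hX e => opp_eq_top_of_equiv (hK hX) e⟩

theorem linearPart_subset : linearPart K ⊆ K := fun _ h => h.1

theorem linear_or_reversing_subset : linearPart K ∪ reversingPart K ⊆ K :=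
  Set.union_subset linearPart_subset fun _ h => h.1

theorem typesDistinguished {S : ∀ X : PermGroup.{u}, Set X.bar}
    {E : Set PermGroup.{u} → (n : ℕ) → (∀ X : PermGroup.{u}, (Fin n → X.G) → Prop) → Prop}
    (h : ExpressesFO (linearPart K ∪ reversingPart K) S (E (linearPart K ∪ reversingPart K))) :
    TypesDistinguished K E :=
  ⟨h.congr h.forall_mem_opp fun _ hX _ =>
      ⟨fun ho => ⟨linear_or_reversing_subset hX, (Subgroup.eq_top_iff' _).2 ho⟩,
        fun hl => (Subgroup.eq_top_iff' _).1 hl.2⟩,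
    h.congr h.exists_notMem_opp fun _ hX _ =>
      ⟨fun ho => ⟨linear_or_reversing_subset hX, ho⟩, fun hr => hr.2⟩⟩

theorem kSpanInt_subset : KSpanInt.{u} ⊆ KSpan := fun _ h => h.1

end Reconstruction

end NearlyOrdered

end

theorem mainTheorem11 :
    (NearlyOrdered.FirstOrderReconstruction
        (NearlyOrdered.linearPart NearlyOrdered.KSpanInt.{u}) ∧
      NearlyOrdered.MonotonicFirstOrderReconstruction NearlyOrdered.KSpanInt.{u} ∧
      NearlyOrdered.TypesDistinguished NearlyOrdered.KSpanInt.{u}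
        NearlyOrdered.FOExpressible.{u}) ∧
    (NearlyOrdered.SecondOrderReconstruction
        (NearlyOrdered.linearPart NearlyOrdered.KSpan.{u}) ∧
      NearlyOrdered.MonotonicSecondOrderReconstruction NearlyOrdered.KSpan.{u} ∧
      NearlyOrdered.TypesDistinguished NearlyOrdered.KSpan.{u}
        NearlyOrdered.SOExpressible.{u}) := by
  have hI := NearlyOrdered.kSpanInt_subset.{u}
  have hL := NearlyOrdered.linearPart_subset (K := NearlyOrdered.KSpan.{u})
  exact ⟨⟨NearlyOrdered.firstOrderReconstruction (NearlyOrdered.linearPart_subset.trans hI),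
      NearlyOrdered.monotonicFirstOrderReconstruction hI,
      NearlyOrdered.typesDistinguished (NearlyOrdered.expressesFO_ep
        (NearlyOrdered.linear_or_reversing_subset.trans hI))⟩,
    NearlyOrdered.secondOrderReconstruction hL,
    NearlyOrdered.monotonicSecondOrderReconstruction subset_rfl,
    NearlyOrdered.typesDistinguished (NearlyOrdered.expressesFO_univ
      NearlyOrdered.linear_or_reversing_subset)⟩
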